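/- **Setting.** Let $N\ge1$, $p\in[1,\infty)$, $I=(0,1)$, and let $(\rho_t)_{t\in I}\subset L^1_{\rm loc}(\mathbb R^N)$ be non-negative functions. Let $J\subset I$ with $0\in\overline J$; all limits $t\to0^+$ below are along $t\in J$. $B_R$ is the open ball of radius $R$ centred at $0$. Let $S^p(\mathbb R^N)=W^{1,p}(\mathbb R^N)$ if $p>1$ and $S^1(\mathbb R^N)=BV(\mathbb R^N)$. For $u\in S^p(\mathbb R^N)$ and $\sigma\in\mathbb S^{N-1}$ let $\|\sigma\cdot Du\|_{L^p}^p$ be $\int_{\mathbb R^N}|\sigma\cdot Du|^p\,dx$ if $p>1$ and the total variation $|\sigma\cdot Du|(\mathbb R^N)$ if $p=1$. $\mathscr M^+(X)$ denotes the finite non-negative Radon measures on $X$. For $u\in L^p(\mathbb R^N)$ let $$\mathscr F_{t,p}(u)=\int_{\mathbb R^N}\frac{\|u(\cdot+z)-u\|_{L^p}^p}{|z|^p}\,\rho_t(z)\,dz ,$$ and for $\mu\in\mathscr M^+(\mathbb S^{N-1})$, $\nu\in\mathscr M^+(\mathbb R^N)$ let $$\mathscr G_p^{\mu,\nu}(u)=\int_{\mathbb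 S^{N-1}}\|\sigma\cdot Du\|_{L^p}^p\,d\mu(\sigma)+\int_{\mathbb R^N\setminus\{0\}}\frac{\|u(\cdot+z)-u\|_{L^p}^p}{|z|^p}\,d\nu(z)$$ if $u\in S^p(\mathbb R^N)$, and $\mathscr G_p^{\mu,\nu}(u)=\infty$ otherwise. **Maximal rank.** For $\tau\in I$ and $v\in\mathbb S^{N-1}$ let $\mathcal C_\tau(v)=\{x\in\mathbb R^N: x\cdot v\ge(1-\tau)|x|\}$. The family $(\rho_t)_{t\in J}$ has *maximal rank* if there are $\tau\in I$ and a basis $v_1,\dots,v_N\in\mathbb S^{N-1}$ of $\mathbb R^N$ such that $\mathcal C_\tau(v_i)\cap\mathcal C_\tau(v_j)=\{0\}$ for $i\ne j$, such that every choice of vectors $w_i\in\mathcal C_\tau(v_i)\setminus\{0\}$, $i=1,\dots,N$, is linearly independent, and such that $$\inf_{\delta>0}\ \min_{1\le i\le N}\ \liminf_{t\to0^+}\int_{B_\delta\cap\mathcal C_\tau(v_i)}\rho_t(z)\,dz>0 .$$ **Theorem.** Assume that at least one of the following holds: 1. $\displaystyle\sup_{R>0}\limsup_{t\to0^+}R^p\int_{\mathbb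 R^N}\frac{\rho_t(z)}{R^p+|z|^p}\,dz<\infty$; 2. $\displaystyle\sup_{R>0}\Big[\limsup_{t\to0^+}\int_{B_R}\rho_t\,dz+\limsup_{t\to0^+}R^p\int_{B_R^c}\frac{\rho_t(z)}{|z|^p}\,dz\Big]<\infty$; 3. there is $R_0>0$ such that $\displaystyle\sup_{R>R_0}\Big[\limsup_{t\to0^+}\int_{B_R}\rho_t\,dz+\limsup_{t\to0^+}R^p\int_{B_R^c}\frac{\rho_t(z)}{|z|^p}\,dz\Big]<\infty$; 4. $\displaystyle\sup_{R>0}\limsup_{t\to0^+}\int_{B_R}\rho_t\,dz<\infty$ and $\displaystyle\limsup_{t\to0^+}\int_{B_R^c}\frac{\rho_t(z)}{|z|^p}\,dz=0$ for all $R>0$; 5. $\displaystyle\limsup_{t\to0^+}\int_{\mathbb R^N}(1\wedge|z|^{-p})\rho_t(z)\,dz<\infty$ and $\displaystyle\limsup_{t\to0^+}\int_{B_R^c}(1\wedge|z|^{-p})\rho_t(z)\,dz=0$ for all $R>0$. Then there are a sequence $(t_k)_{k\in\mathbb N}\subset J$ with $t_k\to0$ and measures $\mu\in\mathscr M^+(\mathbb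 S^{N-1})$, $\nu\in\mathscr M^+(\mathbb R^N)$ such that: * (i) $\rho_{t_k}\mathscr L^N\overset{\star}{\rightharpoonup}\nu$ locally weakly-$\star$, i.e. $\int f\rho_{t_k}\,dz\to\int f\,d\nu$ for every $f\in C_c(\mathbb R^N)$; * (ii) $\limsup_{k}\mathscr F_{t_k,p}(u)\le\mathscr G_p^{\mu,\nu}(u)$ for every $u\in S^p(\mathbb R^N)$; * (iii) if $(u_k)_k\subset L^p(\mathbb R^N)$ converges in $L^p$ to some $u\in S^p(\mathbb R^N)$, then $\liminf_k\mathscr F_{t_k,p}(u_k)\ge\mathscr G_p^{\mu,\nu}(u)$. Consequently, on $S^p(\mathbb R^N)$, $(\mathscr F_{t_k,p})_k$ converges to $\mathscr G_p^{\mu,\nu}$ pointwise (that is, $\lim_k\mathscr F_{t_k,p}(u)=\mathscr G_p^{\mu,\nu}(u)$ for every $u\in S^p(\mathbb R^N)$) and in the $\Gamma$-sense with respect to the $L^p$ topology (that is, (iii) holds and every $u\in S^p(\mathbb R^N)$ is the $L^p$-limit of some $(u_k)_k\subset S^p(\mathbb R^N)$ with $\limsup_k\mathscr F_{t_k,p}(u_k)\le\mathscr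 G_p^{\mu,\nu}(u)$). If in addition $(\rho_t)_{t\in J}$ has maximal rank, then $(\mathscr F_{t_k,p})_k$ is coercive on $S^p(\mathbb R^N)$: whenever $(u_k)_k\subset L^p(\mathbb R^N)$ converges in $L^p$ to some $u\in L^p(\mathbb R^N)$ and $\liminf_k\mathscr F_{t_k,p}(u_k)<\infty$, one has $u\in S^p(\mathbb R^N)$. -/

import Mathlib

open MeasureTheory Filter Topology Set
open scoped ENNReal

noncomputable section

/-- The Euclidean space `ℝ^N`. -/
abbrev RN (N : ℕ) : Type := EuclideanSpace ℝ (Fin N)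

/-- The unit sphere `𝕊^{N-1}` of `ℝ^N`. -/
abbrev SphereN (N : ℕ) : Type := Metric.sphere (0 : RN N) 1

/-! ### `W^{1,p}` and `BV` -/

/-- `g` is a weak gradient of `u`: `∫ u ∇φ = - ∫ φ g` for every `φ ∈ C_c^∞(ℝ^N)`. -/
def HasWeakGradient {N : ℕ} (u : RN N → ℝ) (g : RN N → RN N) : Prop :=
  ∀ φ : RN N → ℝ, ContDiff ℝ (⊤ : ℕ∞) φ → HasCompactSupport φ →
    ∫ x, u x • gradient φ x = -∫ x, φ x • g x

/-- The finite `ℝ^N`-valued measure `D` is the distributional gradient of `u`: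
`∫ u ∇φ = - ∫ φ dD` for every `φ ∈ C_c^∞(ℝ^N)`. -/
def HasGradientMeasure {N : ℕ} (u : RN N → ℝ) (D : VectorMeasure (RN N) (RN N)) : Prop :=
  D.variation univ < ∞ ∧
  ∀ φ : RN N → ℝ, ContDiff ℝ (⊤ : ℕ∞) φ → HasCompactSupport φ →
    ∫ x, u x • gradient φ x = -∫ᵛ x, φ x ∂•D

/-- `W^{1,p}(ℝ^N)` if `p > 1`, and `BV(ℝ^N)` if `p = 1` (as a set of representatives). -/
def SobBV (N : ℕ) (p : ℝ) : Set (RN N → ℝ) :=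
  {u | MemLp u (ENNReal.ofReal p) volume ∧
    ((1 < p ∧ ∃ g : RN N → RN N, MemLp g (ENNReal.ofReal p) volume ∧ HasWeakGradient u g) ∨
     (p = 1 ∧ ∃ D : VectorMeasure (RN N) (RN N), HasGradientMeasure u D))}

open Classical in
/-- The weak gradient in `L^p` of `u` (unique almost everywhere; `0` if there is none). -/
def weakGrad {N : ℕ} (p : ℝ) (u : RN N → ℝ) : RN N → RN N :=
  if h : ∃ g : RN N → RN N, MemLp g (ENNReal.ofReal p) volume ∧ HasWeakGradient u g
  then h.choose else 0

open Classical in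
/-- The gradient measure of `u` (it is unique; `0` if there is none). -/
def gradMeasure {N : ℕ} (u : RN N → ℝ) : VectorMeasure (RN N) (RN N) :=
  if h : ∃ D : VectorMeasure (RN N) (RN N), HasGradientMeasure u D then h.choose else 0

/-- The scalar measure `σ · D`. -/
def dirMeasure {N : ℕ} (σ : RN N) (D : VectorMeasure (RN N) (RN N)) : SignedMeasure (RN N) :=
  D.mapRange (innerSL ℝ σ).toLinearMap.toAddMonoidHom (innerSL ℝ σ).continuous

open Classical in
/-- `‖σ · Du‖_{L^p}^p`: the integral of `|σ · Du|^p` if `p > 1`, and the total variation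
`|σ · Du|(ℝ^N)` if `p = 1`. Meaningful for `u ∈ SobBV N p`. -/
def dirSeminormPow {N : ℕ} (p : ℝ) (u : RN N → ℝ) (σ : RN N) : ℝ≥0∞ :=
  if 1 < p then ∫⁻ x, ENNReal.ofReal (|inner ℝ σ (weakGrad p u x)| ^ p)
  else (dirMeasure σ (gradMeasure u)).totalVariation univ

/-! ### The functionals -/

/-- The difference quotient `‖u(· + z) - u‖_{L^p}^p / |z|^p`. -/
def diffQuot {N : ℕ} (p : ℝ) (u : RN N → ℝ) (z : RN N) : ℝ≥0∞ :=
  (eLpNorm (fun x => u (x + z) - u x) (ENNReal.ofReal p) volume) ^ p / ENNReal.ofReal (‖z‖ ^ p)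

/-- The functional `𝓕_{t,p}` with kernel `r = ρ_t`. -/
def bbmEnergy {N : ℕ} (p : ℝ) (r : RN N → ℝ) (u : RN N → ℝ) : ℝ≥0∞ :=
  ∫⁻ z, diffQuot p u z * ENNReal.ofReal (r z)

open Classical in
/-- The functional `𝓖_p^{μ,ν}`. -/
def limitEnergy {N : ℕ} (p : ℝ) (μ : Measure (SphereN N)) (ν : Measure (RN N))
    (u : RN N → ℝ) : ℝ≥0∞ :=
  if u ∈ SobBV N p then
    ∫⁻ σ : SphereN N, dirSeminormPow p u (σ : RN N) ∂μ + ∫⁻ z in {0}ᶜ, diffQuot p u z ∂ν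
  else ∞

/-! ### Modes of convergence -/

/-- The measure `r 𝓛^N` of density `r`. -/
def kernelMeasure {N : ℕ} (r : RN N → ℝ) : Measure (RN N) :=
  volume.withDensity fun z => ENNReal.ofReal (r z)

/-- Local weak-star convergence: convergence of the integrals of all `f ∈ C_c(ℝ^N)`. -/
def WeakStarLoc {N : ℕ} (m : ℕ → Measure (RN N)) (ν : Measure (RN N)) : Prop :=
  ∀ f : RN N → ℝ, Continuous f → HasCompactSupport f →
    Tendsto (fun k => ∫ z, f z ∂(m k)) atTop (𝓝 (∫ z, f z ∂ν))

/-- `u_k → u` in `L^p(ℝ^N)`, all the functions being in `L^p(ℝ^N)`. -/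
def LpConv {N : ℕ} (p : ℝ) (w : ℕ → RN N → ℝ) (u : RN N → ℝ) : Prop :=
  (∀ k, MemLp (w k) (ENNReal.ofReal p) volume) ∧ MemLp u (ENNReal.ofReal p) volume ∧
    Tendsto (fun k => eLpNorm (fun x => w k x - u x) (ENNReal.ofReal p) volume) atTop (𝓝 0)

/-- `F_k → G` pointwise on `X`. -/
def PointwiseConvOn {N : ℕ} (X : Set (RN N → ℝ)) (F : ℕ → (RN N → ℝ) → ℝ≥0∞)
    (G : (RN N → ℝ) → ℝ≥0∞) : Prop :=
  ∀ u ∈ X, Tendsto (fun k => F k u) atTop (𝓝 (G u))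

/-- The `Γ`-liminf inequality on `X` with respect to the `L^p` topology. -/
def GammaLiminfOn {N : ℕ} (p : ℝ) (X : Set (RN N → ℝ)) (F : ℕ → (RN N → ℝ) → ℝ≥0∞)
    (G : (RN N → ℝ) → ℝ≥0∞) : Prop :=
  ∀ (w : ℕ → RN N → ℝ), ∀ u ∈ X, LpConv p w u → G u ≤ liminf (fun k => F k (w k)) atTop

/-- `F_k → G` on `X` in the `Γ`-sense with respect to the `L^p` topology. -/
def GammaConvOn {N : ℕ} (p : ℝ) (X : Set (RN N → ℝ)) (F : ℕ → (RN N → ℝ) → ℝ≥0∞)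
    (G : (RN N → ℝ) → ℝ≥0∞) : Prop :=
  GammaLiminfOn p X F G ∧
  ∀ u ∈ X, ∃ w : ℕ → RN N → ℝ, (∀ k, w k ∈ X) ∧ LpConv p w u ∧
    limsup (fun k => F k (w k)) atTop ≤ G u

/-- `(F_k)` is coercive on `X`. -/
def CoerciveOn {N : ℕ} (p : ℝ) (X : Set (RN N → ℝ)) (F : ℕ → (RN N → ℝ) → ℝ≥0∞) : Prop :=
  ∀ (w : ℕ → RN N → ℝ) (u : RN N → ℝ), LpConv p w u →
    liminf (fun k => F k (w k)) atTop < ∞ → u ∈ X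

/-! ### The bounds on the kernels

In all of them the limits are taken as `t → 0` along `t ∈ J`, where `J ⊆ (0,1)`. -/

/-- The upper limit, as `t → 0` in `J`, of the integral of `ρ_t` over `B_R`. -/
def innerMass {N : ℕ} (J : Set ℝ) (ρ : ℝ → RN N → ℝ) (R : ℝ) : ℝ≥0∞ :=
  limsup (fun t => ∫⁻ z in Metric.ball 0 R, ENNReal.ofReal (ρ t z)) (𝓝[J] 0)

/-- The upper limit, as `t → 0` in `J`, of the integral of `ρ_t(z) / |z|^p` over the complement
of `B_R`. -/
def outerMass {N : ℕ} (p : ℝ) (J : Set ℝ) (ρ : ℝ → RN N → ℝ) (R : ℝ) : ℝ≥0∞ :=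
  limsup (fun t => ∫⁻ z in (Metric.ball 0 R)ᶜ, ENNReal.ofReal (ρ t z / ‖z‖ ^ p)) (𝓝[J] 0)

def KernelBound1 {N : ℕ} (p : ℝ) (J : Set ℝ) (ρ : ℝ → RN N → ℝ) : Prop :=
  (⨆ (R : ℝ) (_ : 0 < R),
    limsup (fun t => ENNReal.ofReal (R ^ p) *
      ∫⁻ z, ENNReal.ofReal (ρ t z / (R ^ p + ‖z‖ ^ p))) (𝓝[J] 0)) < ∞

def KernelBound2 {N : ℕ} (p : ℝ) (J : Set ℝ) (ρ : ℝ → RN N → ℝ) : Prop :=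
  (⨆ (R : ℝ) (_ : 0 < R),
    (innerMass J ρ R + ENNReal.ofReal (R ^ p) * outerMass p J ρ R)) < ∞

def KernelBound3 {N : ℕ} (p : ℝ) (J : Set ℝ) (ρ : ℝ → RN N → ℝ) : Prop :=
  ∃ R₀ : ℝ, 0 < R₀ ∧
    (⨆ (R : ℝ) (_ : R₀ < R),
      (innerMass J ρ R + ENNReal.ofReal (R ^ p) * outerMass p J ρ R)) < ∞

def KernelBound4 {N : ℕ} (p : ℝ) (J : Set ℝ) (ρ : ℝ → RN N → ℝ) : Prop :=
  (⨆ (R : ℝ) (_ : 0 < R), innerMass J ρ R) < ∞ ∧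
  ∀ R : ℝ, 0 < R → outerMass p J ρ R = 0

def KernelBound5 {N : ℕ} (p : ℝ) (J : Set ℝ) (ρ : ℝ → RN N → ℝ) : Prop :=
  limsup (fun t => ∫⁻ z, ENNReal.ofReal (min 1 (‖z‖ ^ (-p)) * ρ t z)) (𝓝[J] 0) < ∞ ∧
  ∀ R : ℝ, 0 < R →
    limsup (fun t => ∫⁻ z in (Metric.ball 0 R)ᶜ,
      ENNReal.ofReal (min 1 (‖z‖ ^ (-p)) * ρ t z)) (𝓝[J] 0) = 0

/-! ### Maximal rank -/

/-- The closed cone `𝓒_τ(v) = {x : x · v ≥ (1 - τ) |x|}`. -/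
def coneN {N : ℕ} (τ : ℝ) (v : RN N) : Set (RN N) :=
  {x | (1 - τ) * ‖x‖ ≤ inner ℝ x v}

/-- Maximal rank: uniformly in `δ > 0` and as `t → 0` in `J`, the kernels keep a positive mass in
`B_δ ∩ 𝓒_τ(v_i)` for each of `N` cones around the vectors of a basis. The cones meet only at the
origin and are narrow enough that nonzero vectors, one in each cone, are linearly independent. -/
def HasMaximalRank {N : ℕ} (J : Set ℝ) (ρ : ℝ → RN N → ℝ) : Prop :=
  ∃ τ ∈ Ioo (0 : ℝ) 1, ∃ v : Fin N → RN N,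
    (∀ i, ‖v i‖ = 1) ∧ LinearIndependent ℝ v ∧
    (∀ i j, i ≠ j → coneN τ (v i) ∩ coneN τ (v j) = {0}) ∧
    (∀ w : Fin N → RN N, (∀ i, w i ∈ coneN τ (v i) ∧ w i ≠ 0) → LinearIndependent ℝ w) ∧
    0 < ⨅ (δ : ℝ) (_ : 0 < δ), ⨅ i : Fin N,
      liminf (fun t => ∫⁻ z in Metric.ball 0 δ ∩ coneN τ (v i), ENNReal.ofReal (ρ t z)) (𝓝[J] 0)

end

/-! Everything is expressed through the increment ω(z) = ‖u(· + z) - u‖_{L^p} (`incrNorm`), which is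
even, continuous and subadditive in z. Subadditivity makes ω(rσ)/|r| grow when r is halved. For u in
S^p its supremum over r is e(σ) = ‖σ · Du‖: by duality with test functions, the bound ω(rσ) ≤ C|r|
at dyadic scales is equivalent to a bound by C on the distribution ∂_σ u in the dual of L^q, and
e(σ) is the least such C (`exists_dirSeminorm`).

When the kernels concentrate at the origin, their directions must survive in the limit. They are
therefore transported to polar coordinates (r, σ) in ℝ × 𝕊, where the origin is blown up to a
sphere. Each of the five hypotheses yields `EventualKernelBound`, with one constant M for all large
radii. After multiplication by (1 + |r|)^(-p) the measures are tight, and Prokhorov's theorem gives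
a subsequence with a limit m' of mass at most M (`PolarBound.exists_subseq_tendsto`). Then μ is the
part of m' on r = 0, ν is the image of m' under (r, σ) ↦ rσ, and 𝓖 is a single integral against m'
(`limitEnergy_eq_lintegral`).

Upper bound (`PolarConv.limsup_le`): the quotient is at most e(σ)^p near r = 0, is continuous away
from r = 0, and is at most (2‖u‖)^p |r|^(-p) far away, where the kernel bound makes its contribution
O(R^(-p)).

Lower bound (`PolarConv.lintegral_iSup_le_liminf`): by subadditivity the quotients of u_k at all
small r dominate, up to small errors, the quotient at a fixed scale s, and the latter passes to the
limit in L^p. Letting s decrease along dyadic scales recovers e(σ)^p by monotone convergence. This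
argument does not use that u lies in S^p, so it also gives coercivity: finite energy forces sup_r
ω(rσ)/|r| < ∞ for almost every (0, σ) with respect to m'. Maximal rank gives the cones positive mass
on r = 0 (`PolarConv.measure_cone_pos`), hence N independent good directions, and bounded increments
in these put u in S^p by weak compactness of difference quotients and Riesz representation
(`mem_sobBV_of_incrNorm_le`). -/

noncomputable section

open scoped NNReal

/-! ### The `L^p` modulus of continuity -/

/-- The `L^p` norm of the increment `u(· + z) - u`, as a real number. -/
def incrNorm {N : ℕ} (p : ℝ) (u : RN N → ℝ) (z : RN N) : ℝ :=
  (eLpNorm (fun x => u (x + z) - u x) (ENNReal.ofReal p) volume).toReal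

section IncrNorm

variable {N : ℕ} {p : ℝ} {u v : RN N → ℝ}

lemma memLp_translate {q : ℝ≥0∞} (hu : MemLp u q volume) (z : RN N) :
    MemLp (fun x => u (x + z)) q volume :=
  hu.comp_measurePreserving (measurePreserving_add_right volume z)

lemma eLpNorm_translate {q : ℝ≥0∞} (hu : AEStronglyMeasurable u volume) (z : RN N) :
    eLpNorm (fun x => u (x + z)) q volume = eLpNorm u q volume :=
  eLpNorm_comp_measurePreserving hu (measurePreserving_add_right volume z)

lemma memLp_incr {q : ℝ≥0∞} (hu : MemLp u q volume) (z : RN N) :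
    MemLp (fun x => u (x + z) - u x) q volume :=
  (memLp_translate hu z).sub hu

lemma ofReal_incrNorm (hu : MemLp u (ENNReal.ofReal p) volume) (z : RN N) :
    ENNReal.ofReal (incrNorm p u z) =
      eLpNorm (fun x => u (x + z) - u x) (ENNReal.ofReal p) volume :=
  ENNReal.ofReal_toReal (memLp_incr hu z).eLpNorm_ne_top

lemma incrNorm_nonneg (z : RN N) : 0 ≤ incrNorm p u z := ENNReal.toReal_nonneg

@[simp] lemma incrNorm_zero : incrNorm p u 0 = 0 := by
  simp [incrNorm]

lemma one_le_ofReal (hp : 1 ≤ p) : (1 : ℝ≥0∞) ≤ ENNReal.ofReal p := by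
  simpa using ENNReal.ofReal_le_ofReal hp

lemma diffQuot_eq (hp : 1 ≤ p) (hu : MemLp u (ENNReal.ofReal p) volume) (z : RN N) :
    diffQuot p u z = ENNReal.ofReal ((incrNorm p u z / ‖z‖) ^ p) := by
  have hp0 : 0 < p := by linarith
  rw [diffQuot, ← ofReal_incrNorm hu, ENNReal.ofReal_rpow_of_nonneg (incrNorm_nonneg z) hp0.le]
  rcases eq_or_ne z 0 with rfl | hz
  -- At the origin both sides vanish, since 0 / 0 = 0 in `ℝ` and in `ℝ≥0∞`.
  · simp [Real.zero_rpow hp0.ne']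
  · rw [← ENNReal.ofReal_div_of_pos (by positivity),
      Real.div_rpow (incrNorm_nonneg z) (norm_nonneg z)]

/-- Translate in two stages and use translation invariance of the norm. This subadditivity is what
drives the lower bound. -/
lemma incrNorm_add_le (hp : 1 ≤ p) (hu : MemLp u (ENNReal.ofReal p) volume) (z w : RN N) :
    incrNorm p u (z + w) ≤ incrNorm p u z + incrNorm p u w := by
  have h1 := memLp_incr hu z
  have h2 := memLp_incr hu w
  have key : eLpNorm (fun x => u (x + (z + w)) - u x) (ENNReal.ofReal p) volume ≤
      eLpNorm (fun x => u (x + z) - u x) (ENNReal.ofReal p) volume +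
      eLpNorm (fun x => u (x + w) - u x) (ENNReal.ofReal p) volume := by
    have e : (fun x => u (x + (z + w)) - u x) =
        (fun x => (fun y => u (y + z) - u y) (x + w)) + fun x => u (x + w) - u x := by
      ext x
      simp only [Pi.add_apply]
      rw [show x + w + z = x + (z + w) by abel]
      ring
    rw [e]
    refine (eLpNorm_add_le (memLp_translate h1 w).1 h2.1 (one_le_ofReal hp)).trans ?_
    rw [eLpNorm_translate h1.1]
  rw [incrNorm, incrNorm, incrNorm, ← ENNReal.toReal_add h1.eLpNorm_ne_top h2.eLpNorm_ne_top]
  exact ENNReal.toReal_mono (ENNReal.add_ne_top.2 ⟨h1.eLpNorm_ne_top, h2.eLpNorm_ne_top⟩) key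

lemma incrNorm_neg (hu : MemLp u (ENNReal.ofReal p) volume) (z : RN N) :
    incrNorm p u (-z) = incrNorm p u z := by
  rw [incrNorm, incrNorm, ← eLpNorm_translate (memLp_incr hu (-z)).1 z]
  congr 1
  have : (fun x => u (x + z + -z) - u (x + z)) = -fun x => u (x + z) - u x := by
    ext x; simp
  rw [this, eLpNorm_neg]

lemma abs_incrNorm_sub_le (hp : 1 ≤ p) (hu : MemLp u (ENNReal.ofReal p) volume) (z w : RN N) :
    |incrNorm p u z - incrNorm p u w| ≤ incrNorm p u (z - w) := by
  have h1 := incrNorm_add_le hp hu (z - w) w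
  have h2 := incrNorm_add_le hp hu (w - z) z
  rw [← incrNorm_neg hu (w - z), neg_sub] at h2
  rw [sub_add_cancel] at h1 h2
  rw [abs_le]
  constructor <;> linarith

lemma incrNorm_nsmul_le (hp : 1 ≤ p) (hu : MemLp u (ENNReal.ofReal p) volume) (n : ℕ) (z : RN N) :
    incrNorm p u ((n : ℝ) • z) ≤ n * incrNorm p u z := by
  induction n with
  | zero => simp
  | succ k ih =>
    have := incrNorm_add_le hp hu ((k : ℝ) • z) z
    push_cast
    rw [add_smul, one_smul]
    linarith

/-- The error u - v enters once at x and once at x + z, hence the factor 2. The bound is uniform in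
z, so increments converge uniformly under L^p convergence. -/
lemma incrNorm_sub_le (hp : 1 ≤ p) (hu : MemLp u (ENNReal.ofReal p) volume)
    (hv : MemLp v (ENNReal.ofReal p) volume) (z : RN N) :
    incrNorm p u z ≤ incrNorm p v z +
      2 * (eLpNorm (fun x => v x - u x) (ENNReal.ofReal p) volume).toReal := by
  have hd : MemLp (fun x => v x - u x) (ENNReal.ofReal p) volume := hv.sub hu
  have h1 := memLp_incr hv z
  have key : eLpNorm (fun x => u (x + z) - u x) (ENNReal.ofReal p) volume ≤
      eLpNorm (fun x => v (x + z) - v x) (ENNReal.ofReal p) volume +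
      2 * eLpNorm (fun x => v x - u x) (ENNReal.ofReal p) volume := by
    have e : (fun x => u (x + z) - u x) =
        (fun x => v (x + z) - v x) + ((fun x => v x - u x) -
          fun x => (fun y => v y - u y) (x + z)) := by
      ext x
      simp only [Pi.add_apply, Pi.sub_apply]
      ring
    rw [e, two_mul]
    refine (eLpNorm_add_le h1.1 (hd.sub (memLp_translate hd z)).1 (one_le_ofReal hp)).trans ?_
    gcongr
    refine (eLpNorm_sub_le hd.1 (memLp_translate hd z).1 (one_le_ofReal hp)).trans ?_
    rw [eLpNorm_translate hd.1]
  have hfin : eLpNorm (fun x => v (x + z) - v x) (ENNReal.ofReal p) volume +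
      2 * eLpNorm (fun x => v x - u x) (ENNReal.ofReal p) volume ≠ ∞ :=
    ENNReal.add_ne_top.2 ⟨h1.eLpNorm_ne_top, ENNReal.mul_ne_top (by simp) hd.eLpNorm_ne_top⟩
  have := ENNReal.toReal_mono hfin key
  rwa [ENNReal.toReal_add h1.eLpNorm_ne_top
    (ENNReal.mul_ne_top (by simp) hd.eLpNorm_ne_top), ENNReal.toReal_mul] at this

lemma incrNorm_le_two_mul (hp : 1 ≤ p) (hu : MemLp u (ENNReal.ofReal p) volume) (z : RN N) :
    incrNorm p u z ≤ 2 * (eLpNorm u (ENNReal.ofReal p) volume).toReal := by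
  have h := incrNorm_sub_le hp hu (MemLp.zero (ε := ℝ)) z
  have e1 : incrNorm p (0 : RN N → ℝ) z = 0 := by simp [incrNorm]
  have e2 : (fun x => (0 : RN N → ℝ) x - u x) = -u := by ext x; simp
  rw [e1, e2, eLpNorm_neg, zero_add] at h
  exact h

lemma tendsto_incrNorm_zero (hp : 1 ≤ p) (hu : MemLp u (ENNReal.ofReal p) volume) :
    Tendsto (incrNorm p u) (𝓝 0) (𝓝 0) := by
  have : Fact (1 ≤ ENNReal.ofReal p) := ⟨one_le_ofReal hp⟩
  have : Fact (ENNReal.ofReal p ≠ ∞) := ⟨ENNReal.ofReal_ne_top⟩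
  -- Translations are written as an action of `Multiplicative (RN N)`, so that continuity of the
  -- action of `DomMulAct` on `Lp` gives continuity of translations in L^p.
  have : SMulInvariantMeasure (Multiplicative (RN N)) (RN N) volume :=
    ⟨fun c s _ => measure_preimage_add volume c.toAdd s⟩
  let _ : MeasurableSpace (Multiplicative (RN N)) := borel _
  have : BorelSpace (Multiplicative (RN N)) := ⟨rfl⟩
  have : ContinuousSMul (Multiplicative (RN N)) (RN N) :=
    ⟨(continuous_toAdd.comp continuous_fst).add continuous_snd⟩
  let F : RN N → Lp ℝ (ENNReal.ofReal p) (volume : Measure (RN N)) := fun z =>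
    DomMulAct.mk (Multiplicative.ofAdd z) • hu.toLp u
  have hF : Continuous F :=
    ((DomMulAct.continuous_mk).comp continuous_ofAdd).smul continuous_const
  have hval : ∀ z, incrNorm p u z = dist (F z) (F 0) := by
    intro z
    have e1 : F z = (memLp_translate hu z).toLp _ := by
      simp only [F]
      rw [DomMulAct.mk_smul_toLp]
      congr 1
      ext x
      exact congrArg u (add_comm z x)
    have e0 : F 0 = hu.toLp u := by
      simp [F]
    rw [e1, e0, Lp.dist_def, incrNorm]
    congr 1
    refine (eLpNorm_congr_ae ?_)
    filter_upwards [(memLp_translate hu z).coeFn_toLp, hu.coeFn_toLp] with x h1 h2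
    simp [h1, h2]
  have : Tendsto (fun z => dist (F z) (F 0)) (𝓝 0) (𝓝 (dist (F 0) (F 0))) :=
    (hF.tendsto 0).dist tendsto_const_nhds
  rw [dist_self] at this
  exact this.congr fun z => (hval z).symm

lemma continuous_incrNorm (hp : 1 ≤ p) (hu : MemLp u (ENNReal.ofReal p) volume) :
    Continuous (incrNorm p u) := by
  rw [continuous_iff_continuousAt]
  intro z
  rw [ContinuousAt, tendsto_iff_dist_tendsto_zero]
  have h0 : Tendsto (fun w => incrNorm p u (w - z)) (𝓝 z) (𝓝 0) := by
    refine (tendsto_incrNorm_zero hp hu).comp ?_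
    have : Tendsto (fun w : RN N => w - z) (𝓝 z) (𝓝 (z - z)) := tendsto_id.sub_const z
    rwa [sub_self] at this
  refine squeeze_zero (fun _ => dist_nonneg) (fun w => ?_) h0
  exact abs_incrNorm_sub_le hp hu w z

lemma measurable_diffQuot (hp : 1 ≤ p) (hu : MemLp u (ENNReal.ofReal p) volume) :
    Measurable (diffQuot p u) := by
  have : diffQuot p u = fun z => ENNReal.ofReal ((incrNorm p u z / ‖z‖) ^ p) :=
    funext (diffQuot_eq hp hu)
  rw [this]
  exact (((continuous_incrNorm hp hu).measurable.div continuous_norm.measurable).pow_const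
    p).ennreal_ofReal

/-- A small increment in the direction `σ` is controlled from below by the increment at a
fixed positive scale `s`. -/
lemma incrNorm_div_le_of_small (hp : 1 ≤ p) (hu : MemLp u (ENNReal.ofReal p) volume) {s δ r ω : ℝ}
    (hs : 0 < s) (hr : r ≠ 0) (hrδ : |r| ≤ δ) (σ : RN N) (hσ : ‖σ‖ = 1)
    (hω : ∀ h : RN N, ‖h‖ ≤ δ → incrNorm p u h ≤ ω) :
    (incrNorm p u (s • σ) - ω) / (s + δ) ≤ incrNorm p u (r • σ) / |r| := by
  have hr' : 0 < |r| := abs_pos.2 hr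
  have hδ : 0 < δ := hr'.trans_le hrδ
  have hrr : incrNorm p u (r • σ) = incrNorm p u (|r| • σ) := by
    rcases abs_cases r with ⟨h, _⟩ | ⟨h, _⟩
    · rw [h]
    · rw [h, neg_smul, incrNorm_neg hu]
  rw [hrr]
  rcases le_or_gt (incrNorm p u (s • σ) - ω) 0 with h0 | h0
  · exact (div_nonpos_of_nonpos_of_nonneg h0 (by linarith)).trans
      (div_nonneg (incrNorm_nonneg _) hr'.le)
  -- The smallest multiple of |r| reaching s: n|r| lies in [s, s + δ], so n|r|σ and sσ differ by at
  -- most δ, at a cost of at most ω.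
  set n : ℕ := ⌈s / |r|⌉₊ with hn
  have hn1 : s ≤ n * |r| := by
    have := Nat.le_ceil (s / |r|)
    rwa [div_le_iff₀ hr'] at this
  have hn2 : n * |r| ≤ s + δ := by
    have := (Nat.ceil_lt_add_one (div_nonneg hs.le hr'.le)).le
    have h3 : (n : ℝ) * |r| ≤ (s / |r| + 1) * |r| := by gcongr
    rw [add_mul, div_mul_cancel₀ _ hr'.ne', one_mul] at h3
    linarith
  have hnpos : 0 < (n : ℝ) := by
    by_contra h
    have : (n : ℝ) * |r| ≤ 0 := mul_nonpos_of_nonpos_of_nonneg (not_lt.1 h) hr'.le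
    linarith
  have h1 := incrNorm_nsmul_le hp hu n (|r| • σ)
  have h2 : incrNorm p u (s • σ) - ω ≤ incrNorm p u ((n : ℝ) • |r| • σ) := by
    have h3 := abs_le.1 (abs_incrNorm_sub_le hp hu ((n : ℝ) • |r| • σ) (s • σ))
    have h4 : incrNorm p u ((n : ℝ) • |r| • σ - s • σ) ≤ ω := by
      apply hω
      rw [smul_smul, ← sub_smul, norm_smul, hσ, mul_one, Real.norm_eq_abs,
        abs_of_nonneg (by linarith)]
      linarith
    linarith [h3.1]
  rw [div_le_div_iff₀ (by linarith) hr']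
  have h5 : (incrNorm p u (s • σ) - ω) * |r| ≤ n * incrNorm p u (|r| • σ) * |r| := by
    gcongr
    linarith
  calc _ ≤ n * incrNorm p u (|r| • σ) * |r| := h5
    _ = incrNorm p u (|r| • σ) * (n * |r|) := by ring
    _ ≤ _ := by gcongr; exact incrNorm_nonneg _

end IncrNorm

/-! ### Duality with test functions -/

section Duality

variable {N : ℕ} {p : ℝ} {q : ℝ≥0∞}

lemma enorm_integral_mul_le {α : Type*} [MeasurableSpace α] {μ : Measure α} {P Q : ℝ≥0∞}
    [P.HolderConjugate Q] {f φ : α → ℝ} (hf : MemLp f P μ) (hφ : MemLp φ Q μ) :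
    ‖∫ x, f x * φ x ∂μ‖ₑ ≤ eLpNorm f P μ * eLpNorm φ Q μ := by
  refine (enorm_integral_le_lintegral_enorm _).trans ?_
  rw [← eLpNorm_one_eq_lintegral_enorm]
  have h := eLpNorm_smul_le_mul_eLpNorm (p := P) (q := Q) (r := 1) hφ.1 hf.1
  simpa only [smul_eq_mul, Pi.smul_def'] using! h

lemma abs_integral_mul_le {α : Type*} [MeasurableSpace α] {μ : Measure α} {P Q : ℝ≥0∞}
    [P.HolderConjugate Q] {f φ : α → ℝ} (hf : MemLp f P μ) (hφ : MemLp φ Q μ) :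
    |∫ x, f x * φ x ∂μ| ≤ (eLpNorm f P μ).toReal * (eLpNorm φ Q μ).toReal := by
  rw [← ENNReal.toReal_mul, ← Real.norm_eq_abs, ← toReal_enorm]
  exact ENNReal.toReal_mono (ENNReal.mul_ne_top hf.eLpNorm_ne_top hφ.eLpNorm_ne_top)
    (enorm_integral_mul_le hf hφ)

lemma memLp_test {φ : RN N → ℝ} (h1 : ContDiff ℝ (⊤ : ℕ∞) φ) (h2 : HasCompactSupport φ)
    (q : ℝ≥0∞) : MemLp φ q (volume : Measure (RN N)) :=
  h1.continuous.memLp_of_hasCompactSupport h2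

lemma holderConjugate_toReal (hp : 1 < p) [hq : (ENNReal.ofReal p).HolderConjugate q] :
    p.HolderConjugate q.toReal := by
  have hpr : (ENNReal.ofReal p).toReal = p := ENNReal.toReal_ofReal (by linarith)
  have := ENNReal.HolderConjugate.toReal (p := ENNReal.ofReal p) (q := q) (by rwa [hpr])
  rwa [hpr] at this

lemma holderConjugate_ne_top (hp : 1 < p) [hq : (ENNReal.ofReal p).HolderConjugate q] :
    q ≠ ∞ := by
  rintro rfl
  have := (holderConjugate_toReal (q := ∞) hp).symm.pos
  simp at this

lemma one_le_of_holderConjugate (P : ℝ≥0∞) (q : ℝ≥0∞) [hq : P.HolderConjugate q] : 1 ≤ q :=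
  ENNReal.HolderConjugate.one_le q P

/-- A bound on the pairing with test functions is inherited by all functions in `L^q`. -/
lemma abs_integral_mul_le_of_test (hp : 1 < p) [hq : (ENNReal.ofReal p).HolderConjugate q]
    {f : RN N → ℝ} (hf : MemLp f (ENNReal.ofReal p) volume) {C : ℝ} (hC : 0 ≤ C)
    (h : ∀ φ : RN N → ℝ, ContDiff ℝ (⊤ : ℕ∞) φ → HasCompactSupport φ →
      |∫ x, f x * φ x| ≤ C * (eLpNorm φ q volume).toReal)
    {ψ : RN N → ℝ} (hψ : MemLp ψ q volume) :
    |∫ x, f x * ψ x| ≤ C * (eLpNorm ψ q volume).toReal := by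
  set K := (eLpNorm f (ENNReal.ofReal p) volume).toReal
  refine le_of_forall_pos_le_add fun ε hε => ?_
  -- The approximation error is paid with factor C through the assumed bound and with factor K
  -- through Hölder; the 1 keeps the denominator positive.
  have hK : 0 < C + K + 1 := by positivity
  obtain ⟨φ, h1, h2, h3⟩ := hψ.exist_eLpNorm_sub_le (holderConjugate_ne_top hp)
    (one_le_of_holderConjugate (ENNReal.ofReal p) q) (ε := ε / (C + K + 1)) (by positivity)
  have hφ := memLp_test h2 h1 q
  have hd : MemLp (ψ - φ) q volume := hψ.sub hφ
  have hdn : (eLpNorm (ψ - φ) q volume).toReal ≤ ε / (C + K + 1) :=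
    ENNReal.toReal_le_of_le_ofReal (by positivity) h3
  have hφn : (eLpNorm φ q volume).toReal ≤ (eLpNorm ψ q volume).toReal + ε / (C + K + 1) := by
    have e : φ = ψ - (ψ - φ) := by simp
    have := eLpNorm_sub_le hψ.1 hd.1 (one_le_of_holderConjugate (ENNReal.ofReal p) q)
    rw [← e] at this
    have h4 := ENNReal.toReal_mono
      (ENNReal.add_ne_top.2 ⟨hψ.eLpNorm_ne_top, hd.eLpNorm_ne_top⟩) this
    rw [ENNReal.toReal_add hψ.eLpNorm_ne_top hd.eLpNorm_ne_top] at h4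
    linarith
  have hi1 : Integrable (fun x => f x * φ x) volume := hf.integrable_mul hφ
  have hi2 : Integrable (fun x => f x * (ψ - φ) x) volume := hf.integrable_mul hd
  have e : ∫ x, f x * ψ x = (∫ x, f x * φ x) + ∫ x, f x * (ψ - φ) x := by
    rw [← integral_add hi1 hi2]
    congr 1; ext x; simp only [Pi.sub_apply]; ring
  rw [e]
  refine (abs_add_le _ _).trans ?_
  have h5 := h φ h2 h1
  have h6 := abs_integral_mul_le hf hd
  have h7 : C * (eLpNorm φ q volume).toReal ≤
      C * ((eLpNorm ψ q volume).toReal + ε / (C + K + 1)) := by gcongr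
  have h8 : K * (eLpNorm (ψ - φ) q volume).toReal ≤ K * (ε / (C + K + 1)) := by gcongr
  have h9 : (C + K) * (ε / (C + K + 1)) ≤ ε := by
    rw [mul_div_assoc', div_le_iff₀ hK]
    nlinarith
  nlinarith

/-- The extremal function sign(f)|f|^(p-1) has L^q norm ‖f‖^(p-1) because q(p - 1) = p, and its
pairing with f is ‖f‖^p. It need not be smooth: density of test functions in L^q allows it. -/
lemma eLpNorm_le_of_test_of_one_lt (hp : 1 < p) [hq : (ENNReal.ofReal p).HolderConjugate q]
    {f : RN N → ℝ} (hf : MemLp f (ENNReal.ofReal p) volume) {C : ℝ} (hC : 0 ≤ C)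
    (h : ∀ φ : RN N → ℝ, ContDiff ℝ (⊤ : ℕ∞) φ → HasCompactSupport φ →
      |∫ x, f x * φ x| ≤ C * (eLpNorm φ q volume).toReal) :
    (eLpNorm f (ENNReal.ofReal p) volume).toReal ≤ C := by
  have hp0 : 0 < p := by linarith
  have hpq := holderConjugate_toReal (q := q) hp
  have hqp : q * ENNReal.ofReal (p - 1) = ENNReal.ofReal p := by
    rw [← ENNReal.ofReal_toReal (holderConjugate_ne_top (q := q) hp),
      ← ENNReal.ofReal_mul ENNReal.toReal_nonneg]
    congr 1
    have := hpq.mul_eq_add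
    linarith
  set a := (eLpNorm f (ENNReal.ofReal p) volume).toReal with ha
  let ψ : RN N → ℝ := fun x => SignType.sign (f x) * ‖f x‖ ^ (p - 1)
  have hψn : ∀ x, ‖ψ x‖ = ‖(fun x => ‖f x‖ ^ (p - 1)) x‖ := by
    intro x
    rcases eq_or_ne (f x) 0 with h0 | h0
    · simp [ψ, h0, Real.zero_rpow (by linarith : p - 1 ≠ 0)]
    · have : ‖((SignType.sign (f x) : SignType) : ℝ)‖ = 1 := by
        rcases lt_or_gt_of_ne h0 with h | h
        · simp [sign_neg h]
        · simp [sign_pos h]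
      simp only [ψ, norm_mul, this, one_mul]
  have hψ0 : eLpNorm ψ q volume = eLpNorm f (ENNReal.ofReal p) volume ^ (p - 1) := by
    rw [eLpNorm_congr_norm_ae (Eventually.of_forall hψn), eLpNorm_norm_rpow f (by linarith), hqp]
  have hsgn : AEStronglyMeasurable ψ volume := by
    have h1 : AEMeasurable f volume := hf.1.aemeasurable
    have hs : Measurable (fun y : ℝ => ((SignType.sign y : SignType) : ℝ)) := by
      have : (fun y : ℝ => ((SignType.sign y : SignType) : ℝ)) =
          fun y => if 0 < y then 1 else if y < 0 then -1 else 0 := by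
        ext y
        rw [sign_apply]
        split_ifs <;> simp
      rw [this]
      exact Measurable.ite measurableSet_Ioi measurable_const
        (Measurable.ite measurableSet_Iio measurable_const measurable_const)
    exact ((hs.comp_aemeasurable h1).mul (h1.norm.pow_const _)).aestronglyMeasurable
  have hψ : MemLp ψ q volume := by
    refine ⟨hsgn, ?_⟩
    rw [hψ0]
    exact ENNReal.rpow_lt_top_of_nonneg (by linarith) hf.eLpNorm_ne_top
  have key := abs_integral_mul_le_of_test hp hf hC h hψ
  have e1 : ∫ x, f x * ψ x = a ^ p := by
    have : ∀ x, f x * ψ x = ‖f x‖ ^ p := by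
      intro x
      have h1 : f x * (SignType.sign (f x) : ℝ) = ‖f x‖ := by
        rw [mul_comm, sign_mul_self, Real.norm_eq_abs]
      simp only [ψ]
      rw [← mul_assoc, h1]
      rcases eq_or_ne (f x) 0 with h0 | h0
      · simp [h0, Real.zero_rpow hp0.ne']
      · have : 0 < ‖f x‖ := norm_pos_iff.2 h0
        nth_rewrite 1 [← Real.rpow_one ‖f x‖]
        rw [← Real.rpow_add this]
        congr 1; ring
    simp_rw [this]
    have h2 := hf.eLpNorm_eq_integral_rpow_norm (by simpa using hp0) ENNReal.ofReal_ne_top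
    rw [ENNReal.toReal_ofReal hp0.le] at h2
    have hI : 0 ≤ ∫ x, ‖f x‖ ^ p := integral_nonneg fun x => by positivity
    rw [ha, h2, ENNReal.toReal_ofReal (by positivity), ← Real.rpow_mul hI,
      inv_mul_cancel₀ hp0.ne', Real.rpow_one]
  rw [e1, hψ0, ← ENNReal.toReal_rpow, ← ha] at key
  have ha0 : 0 ≤ a := ENNReal.toReal_nonneg
  rcases ha0.eq_or_lt with h0 | h0
  · rw [← h0]; exact hC
  · rw [abs_of_nonneg (by positivity)] at key
    have : a ^ p = a * a ^ (p - 1) := by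
      nth_rewrite 2 [← Real.rpow_one a]
      rw [← Real.rpow_add h0]
      congr 1; ring
    rw [this] at key
    exact le_of_mul_le_mul_right key (by positivity)

/-- The total mass of the finite measure `|h| κ` is computed by testing `h κ` with smooth
functions bounded by `1`. -/
lemma integral_abs_le_of_test {κ : Measure (RN N)} [IsFiniteMeasure κ] {h : RN N → ℝ}
    (hm : Measurable h) (hb : ∀ x, |h x| ≤ 1) {C : ℝ}
    (hC : ∀ φ : RN N → ℝ, ContDiff ℝ (⊤ : ℕ∞) φ → HasCompactSupport φ → (∀ x, |φ x| ≤ 1) →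
      ∫ x, φ x * h x ∂κ ≤ C) :
    ∫ x, |h x| ∂κ ≤ C := by
  have hC0 : 0 ≤ C := by
    have := hC 0 contDiff_const HasCompactSupport.zero (by simp)
    simpa using this
  -- The extremal multiplier; it is approximated in L^1(κ) by admissible test functions.
  set sg : RN N → ℝ := fun x => if 0 ≤ h x then 1 else -1 with hsg
  have hsgm : Measurable sg :=
    Measurable.ite (measurableSet_le measurable_const hm) measurable_const measurable_const
  have hsg1 : ∀ x, |sg x| = 1 := by
    intro x; simp only [hsg]; split_ifs <;> simp
  have hsgh : ∀ x, |h x| = sg x * h x := by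
    intro x
    simp only [hsg]
    split_ifs with h0
    · rw [abs_of_nonneg h0, one_mul]
    · rw [abs_of_neg (not_le.1 h0)]; ring
  have hsgL : MemLp sg 1 κ :=
    MemLp.of_bound hsgm.aestronglyMeasurable 1
      (Eventually.of_forall fun x => by rw [Real.norm_eq_abs, hsg1])
  have key : ∀ ε : ℝ, 0 < ε → ∫ x, |h x| ∂κ ≤ (1 + ε) * C + ε + ε * κ.real univ := by
    intro ε hε
    obtain ⟨g, hgc, hgε, hgcont, hgL⟩ := hsgL.exists_hasCompactSupport_eLpNorm_sub_le
      (by simp) (ε := ENNReal.ofReal ε) (by simpa using hε)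
    -- Clipping to [-1, 1] does not increase the distance to `sg`, whose values are ±1.
    set g' : RN N → ℝ := fun x => max (-1) (min 1 (g x)) with hg'
    have hg'cont : Continuous g' := continuous_const.max (continuous_const.min hgcont)
    have hg'c : HasCompactSupport g' := by
      refine hgc.mono ?_
      intro x hx
      contrapose! hx
      have : g x = 0 := by simpa using hx
      simp [hg', this]
    have hg'1 : ∀ x, |g' x| ≤ 1 := by
      intro x
      rw [abs_le]
      exact ⟨le_max_left _ _, max_le (by norm_num) (min_le_left _ _)⟩
    have hclip : ∀ x, |sg x - g' x| ≤ |sg x - g x| := by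
      intro x
      have h1 : sg x = max (-1) (min 1 (sg x)) := by
        simp only [hsg]; split_ifs <;> norm_num
      rw [h1]
      refine (abs_max_sub_max_le_max _ _ _ _).trans ?_
      rw [sub_self, abs_zero, max_eq_right (abs_nonneg _)]
      refine (abs_min_sub_min_le_max _ _ _ _).trans ?_
      rw [sub_self, abs_zero, max_eq_right (abs_nonneg _)]
      rw [← h1]
    obtain ⟨φ, hφd, hφε, hφs⟩ := hg'cont.exists_contDiff_approx (⊤ : ℕ∞) (ε := fun _ => ε)
      continuous_const (fun _ => hε)
    have hφc : HasCompactSupport φ := hg'c.mono (hφs.trans subset_rfl)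
    have hφb : ∀ x, |φ x| ≤ 1 + ε := by
      intro x
      have h1 := hφε x
      rw [Real.dist_eq] at h1
      have h2 := hg'1 x
      have : |φ x| ≤ |φ x - g' x| + |g' x| := by
        simpa using abs_add_le (φ x - g' x) (g' x)
      linarith
    -- Smoothing may push the values up to 1 + ε; rescaling restores the bound 1.
    have hscaled := hC (fun x => (1 + ε)⁻¹ * φ x) (contDiff_const.mul hφd)
      (hφc.mul_left) (by
        intro x
        rw [abs_mul, abs_of_pos (by positivity : 0 < (1 + ε)⁻¹), inv_mul_le_iff₀ (by positivity)]
        simpa using hφb x)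
    have hφint : ∫ x, φ x * h x ∂κ ≤ (1 + ε) * C := by
      simp_rw [mul_assoc] at hscaled
      rw [integral_const_mul, inv_mul_le_iff₀ (by positivity)] at hscaled
      exact hscaled
    have hmeas : ∀ {f : RN N → ℝ} {B : ℝ}, Measurable f → (∀ x, |f x| ≤ B) → Integrable f κ :=
      fun hf hB => Integrable.of_bound hf.aestronglyMeasurable _ (Eventually.of_forall hB)
    have i1 : Integrable (fun x => φ x * h x) κ :=
      hmeas (B := (1 + ε) * 1) (hφd.continuous.measurable.mul hm) fun x => by
        rw [abs_mul]
        exact mul_le_mul (hφb x) (hb x) (abs_nonneg _) (by positivity)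
    have i2 : Integrable (fun x => |sg x - g x|) κ := ((hsgL.sub hgL).integrable le_rfl).abs
    have i3 : Integrable (fun x => |sg x - g x| + ε) κ := i2.add (integrable_const ε)
    have hle : ∀ x, |h x| ≤ φ x * h x + (|sg x - g x| + ε) := by
      intro x
      rw [hsgh]
      have h1 := hφε x
      rw [Real.dist_eq, abs_sub_comm] at h1
      have h3 : (sg x - φ x) * h x ≤ |sg x - φ x| := by
        refine (le_abs_self _).trans ?_
        rw [abs_mul]
        exact mul_le_of_le_one_right (abs_nonneg _) (hb x)
      have h4 : |sg x - φ x| ≤ |sg x - g' x| + |g' x - φ x| := abs_sub_le _ _ _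
      have h5 := hclip x
      nlinarith
    have hlast : ∫ x, |sg x - g x| ∂κ ≤ ε := by
      rw [← ENNReal.ofReal_le_ofReal_iff hε.le,
        ofReal_integral_eq_lintegral_ofReal i2 (Eventually.of_forall fun x => abs_nonneg _)]
      rw [eLpNorm_one_eq_lintegral_enorm] at hgε
      refine le_trans (le_of_eq ?_) hgε
      congr 1; ext x
      rw [Pi.sub_apply, ← ofReal_norm, Real.norm_eq_abs]
    calc ∫ x, |h x| ∂κ ≤ ∫ x, (φ x * h x + (|sg x - g x| + ε)) ∂κ :=
          integral_mono (hmeas (B := 1) hm.abs (by simpa using hb)) (i1.add i3) hle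
      _ = ∫ x, φ x * h x ∂κ + (∫ x, |sg x - g x| ∂κ + ∫ x, ε ∂κ) := by
          rw [integral_add i1 i3, integral_add i2 (integrable_const ε)]
      _ ≤ _ := by
          rw [integral_const, smul_eq_mul, mul_comm _ ε]
          linarith
  have hlim : Tendsto (fun ε : ℝ => (1 + ε) * C + ε + ε * κ.real univ) (𝓝[>] 0)
      (𝓝 ((1 + 0) * C + 0 + 0 * κ.real univ)) := by
    refine Tendsto.mono_left (Continuous.tendsto ?_ 0) nhdsWithin_le_nhds
    fun_prop
  have := ge_of_tendsto hlim (by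
    filter_upwards [self_mem_nhdsWithin] with ε hε using key ε hε)
  simpa using this

/-- Test functions are not dense in L^∞, so the argument for p > 1 fails. Instead sign f is
approximated with respect to the finite measure |f| dx, by functions bounded by 1. -/
lemma eLpNorm_one_le_of_test {f : RN N → ℝ} (hf : MemLp f 1 volume) {C : ℝ} (hC0 : 0 ≤ C)
    (h : ∀ φ : RN N → ℝ, ContDiff ℝ (⊤ : ℕ∞) φ → HasCompactSupport φ →
      |∫ x, f x * φ x| ≤ C * (eLpNorm φ ∞ volume).toReal) :
    (eLpNorm f 1 volume).toReal ≤ C := by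
  obtain ⟨f', hf'm, hff'⟩ := hf.1
  have hint : Integrable f' volume := (integrable_congr hff').1 (memLp_one_iff_integrable.1 hf)
  let κ : Measure (RN N) := volume.withDensity fun x => ‖f' x‖ₑ
  have : IsFiniteMeasure κ := isFiniteMeasure_withDensity hint.2.ne
  have hκ : ∀ g : RN N → ℝ, ∫ x, g x ∂κ = ∫ x, |f' x| * g x := by
    intro g
    have := integral_withDensity_eq_integral_smul (μ := (volume : Measure (RN N)))
      (f := fun x => ‖f' x‖₊) hf'm.measurable.nnnorm g
    refine this.trans ?_
    rfl
  have hmeas : Measurable fun x => if 0 ≤ f' x then (1 : ℝ) else -1 :=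
    Measurable.ite (measurableSet_le measurable_const hf'm.measurable)
      measurable_const measurable_const
  have habs : ∀ x, |if 0 ≤ f' x then (1 : ℝ) else -1| = 1 := by
    intro x; split_ifs <;> simp
  have key := integral_abs_le_of_test (κ := κ) hmeas (fun x => (habs x).le) (C := C) (by
    intro φ h1 h2 h3
    rw [hκ]
    have e : ∫ x, |f' x| * (φ x * if 0 ≤ f' x then (1 : ℝ) else -1) = ∫ x, f x * φ x := by
      refine integral_congr_ae ?_
      filter_upwards [hff'] with x hx
      rw [hx]
      split_ifs with h0
      · rw [abs_of_nonneg h0]; ring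
      · rw [abs_of_neg (not_le.1 h0)]; ring
    rw [e]
    refine (le_abs_self _).trans ((h φ h1 h2).trans ?_)
    refine mul_le_of_le_one_right hC0 (ENNReal.toReal_le_of_le_ofReal zero_le_one ?_)
    rw [eLpNorm_exponent_top]
    exact eLpNormEssSup_le_of_ae_bound (Eventually.of_forall h3))
  simp_rw [habs] at key
  rw [hκ] at key
  rw [eLpNorm_congr_ae hff', eLpNorm_one_eq_lintegral_enorm,
    ← integral_norm_eq_lintegral_enorm hint.1]
  simpa using key

/-- The `L^p` norm is computed by duality with test functions. -/
lemma eLpNorm_le_of_test (hp : 1 ≤ p) [hq : (ENNReal.ofReal p).HolderConjugate q]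
    {f : RN N → ℝ} (hf : MemLp f (ENNReal.ofReal p) volume) {C : ℝ} (hC : 0 ≤ C)
    (h : ∀ φ : RN N → ℝ, ContDiff ℝ (⊤ : ℕ∞) φ → HasCompactSupport φ →
      |∫ x, f x * φ x| ≤ C * (eLpNorm φ q volume).toReal) :
    (eLpNorm f (ENNReal.ofReal p) volume).toReal ≤ C := by
  rcases hp.eq_or_lt with rfl | hp
  · rw [ENNReal.ofReal_one] at hf hq ⊢
    have hq' : q = ∞ := by
      have := ENNReal.HolderConjugate.conj_eq (p := 1) (q := q)
      simpa using this
    subst hq'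
    exact eLpNorm_one_le_of_test hf hC h
  · exact eLpNorm_le_of_test_of_one_lt hp hf hC h

/-- The total variation of a signed measure is computed by duality with test functions. -/
lemma totalVariation_le_of_test (s : SignedMeasure (RN N)) {C : ℝ}
    (h : ∀ φ : RN N → ℝ, ContDiff ℝ (⊤ : ℕ∞) φ → HasCompactSupport φ → (∀ x, |φ x| ≤ 1) →
      ∫ x, φ x ∂s.toJordanDecomposition.posPart - ∫ x, φ x ∂s.toJordanDecomposition.negPart ≤ C) :
    s.totalVariation.real univ ≤ C := by
  set P := s.toJordanDecomposition.posPart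
  set M := s.toJordanDecomposition.negPart
  obtain ⟨i, hi, hP, hM⟩ := s.toJordanDecomposition.mutuallySingular
  have hTV : s.totalVariation = P + M := rfl
  -- The density of `s` with respect to its total variation: `i` is null for the positive part and
  -- its complement is null for the negative part.
  let f : RN N → ℝ := i.indicator (fun _ => -1) + iᶜ.indicator fun _ => 1
  have hfm : Measurable f := (measurable_const.indicator hi).add
    (measurable_const.indicator hi.compl)
  have hf1 : ∀ x, |f x| = 1 := by
    intro x
    by_cases hx : x ∈ i <;> simp [f, hx]
  have hPf : ∀ᵐ x ∂P, f x = 1 := by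
    rw [ae_iff]
    refine measure_mono_null ?_ hP
    intro x hx
    by_contra hxi
    exact hx (by simp [f, hxi])
  have hMf : ∀ᵐ x ∂M, f x = -1 := by
    rw [ae_iff]
    refine measure_mono_null ?_ hM
    intro x hx
    by_contra hxi
    exact hx (by simp [f, not_not.1 hxi])
  have : IsFiniteMeasure s.totalVariation := by rw [hTV]; infer_instance
  have key := integral_abs_le_of_test (κ := s.totalVariation) hfm (fun x => (hf1 x).le) (C := C)
    (by
      intro φ h1 h2 h3
      refine le_trans (le_of_eq ?_) (h φ h1 h2 h3)
      have hb : ∀ m : Measure (RN N), IsFiniteMeasure m → Integrable (fun x => φ x * f x) m :=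
        fun m _ => Integrable.of_bound (h1.continuous.measurable.mul hfm).aestronglyMeasurable 1
          (Eventually.of_forall fun x => by rw [Real.norm_eq_abs, abs_mul, hf1, mul_one]; exact h3 x)
      rw [hTV, integral_add_measure (hb P inferInstance) (hb M inferInstance), sub_eq_add_neg,
        ← integral_neg]
      congr 1
      · refine integral_congr_ae ?_
        filter_upwards [hPf] with x hx
        rw [hx, mul_one]
      · refine integral_congr_ae ?_
        filter_upwards [hMf] with x hx
        rw [hx]; ring)
  simp_rw [hf1] at key
  simpa using key

end Duality

/-! ### Increments and directional derivatives -/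

section Directional

variable {N : ℕ} {p : ℝ} {q : ℝ≥0∞} {u : RN N → ℝ}

/-- The pairing `∫ u ∂_σ φ`, which is minus the distribution `∂_σ u` applied to `φ`. -/
def dirPairing (u : RN N → ℝ) (σ : RN N) (φ : RN N → ℝ) : ℝ := ∫ x, u x * fderiv ℝ φ x σ

/-- The distributional derivative of `u` in the direction `σ` is bounded by `C` in the dual of
`L^q`. -/
def DirBound (q : ℝ≥0∞) (u : RN N → ℝ) (σ : RN N) (C : ℝ) : Prop :=
  ∀ φ : RN N → ℝ, ContDiff ℝ (⊤ : ℕ∞) φ → HasCompactSupport φ →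
    |dirPairing u σ φ| ≤ C * (eLpNorm φ q volume).toReal

/-- The integral is the convolution of u with the reflection of φ, evaluated at rσ; convolutions are
differentiated on the smooth factor. -/
lemma hasDerivAt_integral_shift (hu : LocallyIntegrable u volume) {φ : RN N → ℝ}
    (h1 : ContDiff ℝ (⊤ : ℕ∞) φ) (h2 : HasCompactSupport φ) (σ : RN N) (r : ℝ) :
    HasDerivAt (fun r : ℝ => ∫ x, u x * φ (x - r • σ))
      (-dirPairing u σ fun x => φ (x - r • σ)) r := by
  set g : RN N → ℝ := fun y => φ (-y) with hg
  have hgc : HasCompactSupport g := h2.comp_homeomorph (Homeomorph.neg (RN N))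
  have hgd : ContDiff ℝ 1 g := (h1.comp contDiff_neg).of_le (by exact_mod_cast le_top)
  set L := ContinuousLinearMap.mul ℝ ℝ
  have hF := hgc.hasFDerivAt_convolution_right (μ := volume) L hu hgd (r • σ)
  have hr : HasDerivAt (fun r : ℝ => r • σ) σ r := by
    simpa using (hasDerivAt_id r).smul_const σ
  have hcomp := hF.comp_hasDerivAt r hr
  have hfun : (convolution u g L volume ∘ fun r : ℝ => r • σ) =
      fun r : ℝ => ∫ x, u x * φ (x - r • σ) := by
    ext r
    simp only [Function.comp, convolution_def, L, hg, ContinuousLinearMap.mul_apply', neg_sub]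
  rw [hfun] at hcomp
  refine hcomp.congr_deriv ?_
  have hcont : Continuous (fderiv ℝ g) := hgd.continuous_fderiv (by simp)
  have hex := HasCompactSupport.convolutionExists_right (μ := (volume : Measure (RN N)))
    (ContinuousLinearMap.precompR (RN N) L) (hgc.fderiv (𝕜 := ℝ)) hu hcont (r • σ)
  rw [convolution_def, ContinuousLinearMap.integral_apply hex, dirPairing, ← integral_neg]
  congr 1
  ext x
  have hφd : Differentiable ℝ φ := h1.differentiable (by simp)
  have e1 : fderiv ℝ (fun x => φ (x - r • σ)) x = fderiv ℝ φ (x - r • σ) :=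
    by simpa using! ((hφd (x - r • σ)).hasFDerivAt.comp x
      ((hasFDerivAt_id x).sub_const (r • σ))).fderiv
  have e2 : fderiv ℝ g (r • σ - x) = -fderiv ℝ φ (-(r • σ - x)) := by
    simpa using! ((hφd (-(r • σ - x))).hasFDerivAt.comp (r • σ - x)
      (hasFDerivAt_id (r • σ - x)).neg).fderiv
  rw [e1, ContinuousLinearMap.precompR_apply, e2]
  simp [L]

lemma integral_shift_sub (hp : 1 ≤ p) (hu : MemLp u (ENNReal.ofReal p) volume) {φ : RN N → ℝ}
    (h1 : ContDiff ℝ (⊤ : ℕ∞) φ) (h2 : HasCompactSupport φ) (z : RN N) :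
    ∫ x, (u (x + z) - u x) * φ x = (∫ x, u x * φ (x - z)) - ∫ x, u x * φ x := by
  have hP : Fact (1 ≤ ENNReal.ofReal p) := ⟨one_le_ofReal hp⟩
  have hφ := memLp_test h1 h2 (ENNReal.conjExponent (ENNReal.ofReal p))
  have i1 : Integrable (fun x => u (x + z) * φ x) volume := (memLp_translate hu z).integrable_mul hφ
  have i2 : Integrable (fun x => u x * φ x) volume := hu.integrable_mul hφ
  simp_rw [sub_mul]
  rw [integral_sub i1 i2, ← integral_add_right_eq_self (fun x => u x * φ (x - z)) z]
  simp

lemma eLpNorm_shift_test {φ : RN N → ℝ} (h1 : ContDiff ℝ (⊤ : ℕ∞) φ) (z : RN N) :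
    eLpNorm (fun x => φ (x - z)) q volume = eLpNorm φ q volume := by
  have := eLpNorm_translate (q := q) (u := φ) h1.continuous.aestronglyMeasurable (-z)
  simpa [sub_eq_add_neg] using this

/-- A bound on the distributional directional derivative bounds the increments. -/
lemma DirBound.incrNorm_le (hp : 1 ≤ p) [hq : (ENNReal.ofReal p).HolderConjugate q]
    (hu : MemLp u (ENNReal.ofReal p) volume) {σ : RN N} {C : ℝ} (hC : 0 ≤ C)
    (h : DirBound q u σ C) (r : ℝ) : incrNorm p u (r • σ) ≤ C * |r| := by
  refine eLpNorm_le_of_test (q := q) hp (memLp_incr hu _) (by positivity) fun φ h1 h2 => ?_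
  rw [integral_shift_sub hp hu h1 h2]
  have hloc : LocallyIntegrable u volume := hu.locallyIntegrable (one_le_ofReal hp)
  -- Mean value inequality in the shift parameter. The derivative bound is uniform because
  -- translating a test function preserves its L^q norm.
  have key := Convex.norm_image_sub_le_of_norm_hasDerivWithin_le (s := univ)
    (f := fun r : ℝ => ∫ x, u x * φ (x - r • σ)) (x := 0) (y := r)
    (C := C * (eLpNorm φ q volume).toReal)
    (fun t _ => (hasDerivAt_integral_shift hloc h1 h2 σ t).hasDerivWithinAt)
    (fun t _ => by
      rw [norm_neg, Real.norm_eq_abs]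
      have h1' : ContDiff ℝ (⊤ : ℕ∞) fun x => φ (x - t • σ) := h1.comp (contDiff_id.sub contDiff_const)
      have h2' : HasCompactSupport fun x => φ (x - t • σ) :=
        h2.comp_homeomorph (Homeomorph.subRight (t • σ))
      have := h _ h1' h2'
      rwa [eLpNorm_shift_test h1] at this) convex_univ (mem_univ _) (mem_univ _)
  simp only [zero_smul, sub_zero, Real.norm_eq_abs] at key
  linarith

/-- Moving the shift onto φ turns the left side into the slope at 0 of the function differentiated
in `hasDerivAt_integral_shift`. -/
lemma tendsto_integral_incr (hp : 1 ≤ p) (hu : MemLp u (ENNReal.ofReal p) volume) {φ : RN N → ℝ}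
    (h1 : ContDiff ℝ (⊤ : ℕ∞) φ) (h2 : HasCompactSupport φ) (σ : RN N) :
    Tendsto (fun r : ℝ => ∫ x, r⁻¹ * (u (x + r • σ) - u x) * φ x) (𝓝[≠] 0)
      (𝓝 (-dirPairing u σ φ)) := by
  have hloc : LocallyIntegrable u volume := hu.locallyIntegrable (one_le_ofReal hp)
  have hd := (hasDerivAt_integral_shift hloc h1 h2 σ 0).tendsto_slope
  simp only [zero_smul, sub_zero] at hd
  refine hd.congr fun r => ?_
  simp_rw [mul_assoc]
  rw [integral_const_mul, integral_shift_sub hp hu h1 h2, slope_def_field]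
  simp only [zero_smul, sub_zero]
  rw [div_eq_inv_mul]

/-- Bounds on the increments along a sequence of scales bound the distributional directional
derivative. -/
lemma dirBound_of_tendsto (hp : 1 ≤ p) [hq : (ENNReal.ofReal p).HolderConjugate q]
    (hu : MemLp u (ENNReal.ofReal p) volume) {σ : RN N} {C : ℝ} {ι : Type*} {l : Filter ι}
    [l.NeBot] {r : ι → ℝ} (hr : Tendsto r l (𝓝[≠] 0))
    (h : ∀ᶠ j in l, incrNorm p u (r j • σ) ≤ C * |r j|) : DirBound q u σ C := by
  intro φ h1 h2
  have ht := ((tendsto_integral_incr hp hu h1 h2 σ).comp hr).abs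
  rw [abs_neg] at ht
  refine le_of_tendsto ht ?_
  have hr0 : ∀ᶠ j in l, r j ≠ 0 := hr.eventually self_mem_nhdsWithin
  filter_upwards [h, hr0] with j hj hj0
  simp only [Function.comp, mul_assoc]
  rw [integral_const_mul, abs_mul, abs_inv, inv_mul_le_iff₀ (abs_pos.2 hj0)]
  refine (abs_integral_mul_le (memLp_incr hu _) (memLp_test h1 h2 q)).trans ?_
  have : incrNorm p u (r j • σ) * (eLpNorm φ q volume).toReal ≤
      C * |r j| * (eLpNorm φ q volume).toReal := by gcongr
  calc _ ≤ _ := this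
    _ = _ := by ring

lemma integrable_mul_fderiv (hp : 1 ≤ p) (hu : MemLp u (ENNReal.ofReal p) volume) {φ : RN N → ℝ}
    (h1 : ContDiff ℝ (⊤ : ℕ∞) φ) (h2 : HasCompactSupport φ) (σ : RN N) :
    Integrable (fun x => u x * fderiv ℝ φ x σ) volume := by
  have hP : Fact (1 ≤ ENNReal.ofReal p) := ⟨one_le_ofReal hp⟩
  refine hu.integrable_mul (q := ENNReal.conjExponent (ENNReal.ofReal p)) ?_
  refine Continuous.memLp_of_hasCompactSupport ?_ ?_
  · exact (h1.continuous_fderiv (by simp)).clm_apply continuous_const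
  · exact (h2.fderiv (𝕜 := ℝ)).comp_left (g := fun A : RN N →L[ℝ] ℝ => A σ) (by simp)

lemma dirPairing_add (hp : 1 ≤ p) (hu : MemLp u (ENNReal.ofReal p) volume) {φ : RN N → ℝ}
    (h1 : ContDiff ℝ (⊤ : ℕ∞) φ) (h2 : HasCompactSupport φ) (σ τ : RN N) :
    dirPairing u (σ + τ) φ = dirPairing u σ φ + dirPairing u τ φ := by
  rw [dirPairing, dirPairing, dirPairing, ← integral_add (integrable_mul_fderiv hp hu h1 h2 σ)
    (integrable_mul_fderiv hp hu h1 h2 τ)]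
  congr 1; ext x; rw [map_add, mul_add]

lemma dirPairing_smul (c : ℝ) (σ : RN N) (φ : RN N → ℝ) :
    dirPairing u (c • σ) φ = c * dirPairing u σ φ := by
  rw [dirPairing, dirPairing, ← integral_const_mul]
  congr 1; ext x; rw [map_smul, smul_eq_mul]; ring

/-- With `DirBound.smul`, this makes the least admissible constant sublinear in the direction, hence
convex and continuous. -/
lemma DirBound.add (hp : 1 ≤ p) (hu : MemLp u (ENNReal.ofReal p) volume) {σ τ : RN N} {C D : ℝ}
    (hC : DirBound q u σ C) (hD : DirBound q u τ D) : DirBound q u (σ + τ) (C + D) := by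
  intro φ h1 h2
  rw [dirPairing_add hp hu h1 h2, add_mul]
  exact (abs_add_le _ _).trans (add_le_add (hC φ h1 h2) (hD φ h1 h2))

lemma DirBound.smul {σ : RN N} {C : ℝ} (hC : DirBound q u σ C) (c : ℝ) :
    DirBound q u (c • σ) (|c| * C) := by
  intro φ h1 h2
  rw [dirPairing_smul, abs_mul, mul_assoc]
  gcongr
  exact hC φ h1 h2

/-- Passage from the vector-valued definitions of weak gradient and gradient measure to scalar
directional pairings. -/
lemma inner_integral_smul_gradient (hp : 1 ≤ p) (hu : MemLp u (ENNReal.ofReal p) volume)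
    {φ : RN N → ℝ} (h1 : ContDiff ℝ (⊤ : ℕ∞) φ) (h2 : HasCompactSupport φ) (σ : RN N) :
    inner ℝ σ (∫ x, u x • gradient φ x) = dirPairing u σ φ := by
  have hint : Integrable (fun x => u x • gradient φ x) volume := by
    have hP : Fact (1 ≤ ENNReal.ofReal p) := ⟨one_le_ofReal hp⟩
    have hg : MemLp (gradient φ) (ENNReal.conjExponent (ENNReal.ofReal p)) volume := by
      refine Continuous.memLp_of_hasCompactSupport ?_ ?_
      · exact (InnerProductSpace.toDual ℝ (RN N)).symm.continuous.comp
          (h1.continuous_fderiv (by simp))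
      · exact (h2.fderiv (𝕜 := ℝ)).comp_left (g := (InnerProductSpace.toDual ℝ (RN N)).symm)
          (map_zero _)
    exact memLp_one_iff_integrable.1 (hg.smul hu)
  rw [← integral_inner hint, dirPairing]
  congr 1; ext x
  rw [inner_smul_right, real_inner_comm, inner_gradient_left]

end Directional

/-! ### The directional seminorms of Sobolev and `BV` functions -/

section SignedIntegral

variable {N : ℕ}

/-- The integral of a function against a signed measure, through the Jordan decomposition. -/
def signedIntegral (s : SignedMeasure (RN N)) (φ : RN N → ℝ) : ℝ :=
  ∫ x, φ x ∂s.toJordanDecomposition.posPart - ∫ x, φ x ∂s.toJordanDecomposition.negPart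

lemma lsmul_flip_real :
    (ContinuousLinearMap.lsmul ℝ ℝ : ℝ →L[ℝ] ℝ →L[ℝ] ℝ).flip = ContinuousLinearMap.lsmul ℝ ℝ := by
  ext; simp

lemma integral_vectorMeasure_toSignedMeasure (μ : Measure (RN N)) [IsFiniteMeasure μ]
    (φ : RN N → ℝ) : ∫ᵛ x, φ x ∂•μ.toSignedMeasure = ∫ x, φ x ∂μ := by
  rw [← lsmul_flip_real, VectorMeasure.integral_toSignedMeasure]

lemma integral_signedMeasure {s : SignedMeasure (RN N)} {φ : RN N → ℝ}
    (hφ : Continuous φ) (hφc : HasCompactSupport φ) :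
    ∫ᵛ x, φ x ∂•s = signedIntegral s φ := by
  nth_rewrite 1 [← s.toSignedMeasure_toJordanDecomposition]
  rw [JordanDecomposition.toSignedMeasure, VectorMeasure.integral_sub_vectorMeasure,
    integral_vectorMeasure_toSignedMeasure, integral_vectorMeasure_toSignedMeasure, signedIntegral]
  · rw [VectorMeasure.Integrable, Measure.variation_toSignedMeasure]
    exact hφ.integrable_of_hasCompactSupport hφc
  · rw [VectorMeasure.Integrable, Measure.variation_toSignedMeasure]
    exact hφ.integrable_of_hasCompactSupport hφc

lemma variation_mapRange_le {X E F : Type*} [MeasurableSpace X] [NormedAddCommGroup E]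
    [NormedSpace ℝ E] [NormedAddCommGroup F] [NormedSpace ℝ F] (D : VectorMeasure X E)
    (A : E →L[ℝ] F) :
    (D.mapRange A.toLinearMap.toAddMonoidHom A.continuous).variation ≤ ‖A‖₊ • D.variation := by
  refine VectorMeasure.variation_le_of_forall_enorm_le fun s _ => ?_
  have h1 : ‖(D.mapRange A.toLinearMap.toAddMonoidHom A.continuous) s‖ₑ ≤ ‖A‖ₑ * ‖D s‖ₑ :=
    A.le_opENorm (D s)
  refine h1.trans ?_
  grw [VectorMeasure.enorm_measure_le_variation]
  rfl

/-- Both sides extend the same set function s ↦ A (D s) through `setToFun`, over two different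
control measures. One control measure is dominated by a multiple of the other, so the extensions
agree on functions integrable for `D.variation`. -/
lemma clm_apply_integral_vectorMeasure {X E F : Type*} [MeasurableSpace X] [NormedAddCommGroup E]
    [NormedSpace ℝ E] [NormedAddCommGroup F] [NormedSpace ℝ F] [CompleteSpace E] [CompleteSpace F]
    {D : VectorMeasure X E} {φ : X → ℝ} (h1 : Integrable φ D.variation) (A : E →L[ℝ] F) :
    A (∫ᵛ x, φ x ∂•D) =
      ∫ᵛ x, φ x ∂•(D.mapRange A.toLinearMap.toAddMonoidHom A.continuous) := by
  have h2 : Integrable φ (D.mapRange A.toLinearMap.toAddMonoidHom A.continuous).variation :=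
    (h1.smul_measure_nnreal (c := ‖A‖₊)).mono_measure (variation_mapRange_le D A)
  have h4 : D.transpose ((ContinuousLinearMap.compL ℝ E E F A) ∘L ContinuousLinearMap.lsmul ℝ ℝ) =
      (D.mapRange A.toLinearMap.toAddMonoidHom A.continuous).transpose
        (ContinuousLinearMap.lsmul ℝ ℝ) := by
    ext s hs
    change A ((1 : ℝ) • D s) = (1 : ℝ) • A (D s)
    rw [map_smul]
  rw [VectorMeasure.continuousLinearMap_apply_integral (μ := D)
    (B := ContinuousLinearMap.lsmul ℝ ℝ) (C := A) h1, VectorMeasure.integral,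
    VectorMeasure.integral]
  have hT := dominatedFinMeasAdditive_cbmApplyMeasure D
    ((ContinuousLinearMap.compL ℝ E E F A) ∘L ContinuousLinearMap.lsmul ℝ ℝ)
  have hT' := hT
  rw [h4] at hT'
  refine (setToFun_congr_left hT hT' (congrArg _ h4) φ).trans ?_
  exact setToFun_congr_measure_of_integrable (‖A‖₊ : ℝ≥0∞) (by simp)
    (variation_mapRange_le D A) hT' _ φ h1

lemma inner_integral_vectorMeasure {D : VectorMeasure (RN N) (RN N)} (hD : D.variation univ < ∞)
    {φ : RN N → ℝ} (hφ : Continuous φ) (hφc : HasCompactSupport φ) (σ : RN N) :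
    inner ℝ σ (∫ᵛ x, φ x ∂•D) = signedIntegral (dirMeasure σ D) φ := by
  have : IsFiniteMeasure D.variation := ⟨hD⟩
  rw [← integral_signedMeasure hφ hφc]
  exact clm_apply_integral_vectorMeasure (hφ.integrable_of_hasCompactSupport hφc) (innerSL ℝ σ)

/-- Pointwise, not merely almost everywhere: the measures integrated against may be singular. A
closed condition holding on a dense set holds everywhere. -/
lemma abs_le_eLpNorm_top {φ : RN N → ℝ} (hφ : Continuous φ) (hφc : HasCompactSupport φ) (x : RN N) :
    |φ x| ≤ (eLpNorm φ ∞ volume).toReal := by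
  have hfin := (hφ.memLp_of_hasCompactSupport (p := ∞) (μ := (volume : Measure (RN N))) hφc)
  have hae : ∀ᵐ y ∂(volume : Measure (RN N)), |φ y| ≤ (eLpNorm φ ∞ volume).toReal := by
    have := ae_le_eLpNormEssSup (f := φ) (μ := (volume : Measure (RN N)))
    filter_upwards [this] with y hy
    rw [← eLpNorm_exponent_top] at hy
    have h3 := ENNReal.toReal_mono hfin.eLpNorm_ne_top hy
    rwa [toReal_enorm, Real.norm_eq_abs] at h3
  have hclosed : IsClosed {y | |φ y| ≤ (eLpNorm φ ∞ volume).toReal} :=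
    isClosed_le hφ.abs continuous_const
  have hdense := Measure.dense_of_ae hae
  exact hclosed.closure_subset_iff.2 subset_rfl (hdense x)

lemma abs_signedIntegral_le (s : SignedMeasure (RN N)) {φ : RN N → ℝ} (hφ : Continuous φ)
    (hφc : HasCompactSupport φ) :
    |signedIntegral s φ| ≤ s.totalVariation.real univ * (eLpNorm φ ∞ volume).toReal := by
  set K := (eLpNorm φ ∞ volume).toReal
  have hb : ∀ m : Measure (RN N), IsFiniteMeasure m → |∫ x, φ x ∂m| ≤ K * m.real univ :=
    fun m _ => by
      rw [← Real.norm_eq_abs]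
      exact norm_integral_le_of_norm_le_const
        (Eventually.of_forall fun x => abs_le_eLpNorm_top hφ hφc x)
  have h1 := hb s.toJordanDecomposition.posPart inferInstance
  have h2 := hb s.toJordanDecomposition.negPart inferInstance
  have h3 : s.totalVariation.real univ = s.toJordanDecomposition.posPart.real univ +
      s.toJordanDecomposition.negPart.real univ := by
    rw [SignedMeasure.totalVariation, measureReal_add_apply]
  rw [h3, signedIntegral]
  refine (abs_sub _ _).trans ?_
  linarith

end SignedIntegral

/-! ### Directional seminorms as least dual bounds -/

section DirSeminorm

variable {N : ℕ} {p : ℝ} {q : ℝ≥0∞} {u : RN N → ℝ}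

lemma dirSeminormPow_isLeast_of_one_lt (hp : 1 < p) [hq : (ENNReal.ofReal p).HolderConjugate q]
    (hu : MemLp u (ENNReal.ofReal p) volume)
    (hg : ∃ g : RN N → RN N, MemLp g (ENNReal.ofReal p) volume ∧ HasWeakGradient u g) (σ : RN N) :
    ∃ e : ℝ, 0 ≤ e ∧ dirSeminormPow p u σ = ENNReal.ofReal (e ^ p) ∧ DirBound q u σ e ∧
      ∀ C : ℝ, 0 ≤ C → DirBound q u σ C → e ≤ C := by
  have hp0 : 0 < p := by linarith
  have hP : Fact (1 ≤ ENNReal.ofReal p) := ⟨one_le_ofReal hp.le⟩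
  obtain ⟨hgL, hgw⟩ : MemLp (weakGrad p u) (ENNReal.ofReal p) volume ∧
      HasWeakGradient u (weakGrad p u) := by
    rw [weakGrad, dif_pos hg]; exact hg.choose_spec
  set g := weakGrad p u with hgdef
  have hσ : MemLp (fun x => inner ℝ σ (g x)) (ENNReal.ofReal p) volume :=
    hgL.const_inner σ
  have hpair : ∀ φ : RN N → ℝ, ContDiff ℝ (⊤ : ℕ∞) φ → HasCompactSupport φ →
      dirPairing u σ φ = -∫ x, inner ℝ σ (g x) * φ x := by
    intro φ h1 h2
    have hint : Integrable (fun x => φ x • g x) volume := by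
      have hφ := memLp_test h1 h2 (ENNReal.conjExponent (ENNReal.ofReal p))
      have hc : (ENNReal.conjExponent (ENNReal.ofReal p)).HolderConjugate (ENNReal.ofReal p) :=
        ENNReal.HolderConjugate.symm
      exact memLp_one_iff_integrable.1 (hgL.smul hφ)
    rw [← inner_integral_smul_gradient hp.le hu h1 h2, hgw φ h1 h2, inner_neg_right,
      ← integral_inner hint]
    congr 2; ext x; rw [inner_smul_right, mul_comm]
  refine ⟨(eLpNorm (fun x => inner ℝ σ (g x)) (ENNReal.ofReal p) volume).toReal,
    ENNReal.toReal_nonneg, ?_, ?_, ?_⟩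
  · rw [dirSeminormPow, if_pos hp, ← ENNReal.ofReal_rpow_of_nonneg ENNReal.toReal_nonneg hp0.le,
      ENNReal.ofReal_toReal hσ.eLpNorm_ne_top,
      eLpNorm_eq_lintegral_rpow_enorm_toReal (by simpa using hp0) ENNReal.ofReal_ne_top,
      ENNReal.toReal_ofReal hp0.le, ← ENNReal.rpow_mul, one_div, inv_mul_cancel₀ hp0.ne',
      ENNReal.rpow_one]
    congr 1; ext x
    rw [← hgdef, ← ENNReal.ofReal_rpow_of_nonneg (abs_nonneg _) hp0.le, ← Real.norm_eq_abs,
      ofReal_norm]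
  · intro φ h1 h2
    rw [hpair φ h1 h2, abs_neg]
    exact abs_integral_mul_le hσ (memLp_test h1 h2 q)
  · intro C hC h
    refine eLpNorm_le_of_test (q := q) hp.le hσ hC fun φ h1 h2 => ?_
    have := h φ h1 h2
    rwa [hpair φ h1 h2, abs_neg] at this

lemma dirSeminormPow_isLeast_of_eq_one [hq : (ENNReal.ofReal 1).HolderConjugate q]
    (hu : MemLp u (ENNReal.ofReal 1) volume)
    (hD : ∃ D : VectorMeasure (RN N) (RN N), HasGradientMeasure u D) (σ : RN N) :
    ∃ e : ℝ, 0 ≤ e ∧ dirSeminormPow 1 u σ = ENNReal.ofReal (e ^ (1 : ℝ)) ∧ DirBound q u σ e ∧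
      ∀ C : ℝ, 0 ≤ C → DirBound q u σ C → e ≤ C := by
  have hq' : q = ∞ := by
    rw [ENNReal.ofReal_one] at hq
    simpa using ENNReal.HolderConjugate.conj_eq (p := 1) (q := q)
  subst hq'
  have hgD : HasGradientMeasure u (gradMeasure u) := by
    rw [gradMeasure, dif_pos hD]; exact hD.choose_spec
  set D := gradMeasure u with hDdef
  set s := dirMeasure σ D with hs
  have hpair : ∀ φ : RN N → ℝ, ContDiff ℝ (⊤ : ℕ∞) φ → HasCompactSupport φ →
      dirPairing u σ φ = -signedIntegral s φ := by
    intro φ h1 h2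
    rw [← inner_integral_smul_gradient le_rfl hu h1 h2, hgD.2 φ h1 h2, inner_neg_right,
      inner_integral_vectorMeasure hgD.1 h1.continuous h2]
  have hfin : IsFiniteMeasure s.totalVariation := by
    rw [SignedMeasure.totalVariation]; infer_instance
  refine ⟨s.totalVariation.real univ, measureReal_nonneg, ?_, ?_, ?_⟩
  · rw [dirSeminormPow, if_neg (lt_irrefl _), Real.rpow_one, ofReal_measureReal]
  · intro φ h1 h2
    rw [hpair φ h1 h2, abs_neg]
    exact abs_signedIntegral_le s h1.continuous h2
  · intro C hC h
    refine totalVariation_le_of_test s fun φ h1 h2 h3 => ?_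
    have h4 := h φ h1 h2
    rw [hpair φ h1 h2, abs_neg] at h4
    refine (le_abs_self _).trans (h4.trans (mul_le_of_le_one_right hC
      (ENNReal.toReal_le_of_le_ofReal zero_le_one ?_)))
    rw [eLpNorm_exponent_top]
    exact eLpNormEssSup_le_of_ae_bound (Eventually.of_forall h3)

/-- Duality identifies the L^p norm of σ · ∇u, or the total variation of σ · Du when p = 1, with the
dual norm of the pairing. From here on the two cases and the chosen representatives of the gradient
play no role. -/
lemma dirSeminormPow_isLeast [hq : (ENNReal.ofReal p).HolderConjugate q]
    (hu : u ∈ SobBV N p) (σ : RN N) :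
    ∃ e : ℝ, 0 ≤ e ∧ dirSeminormPow p u σ = ENNReal.ofReal (e ^ p) ∧ DirBound q u σ e ∧
      ∀ C : ℝ, 0 ≤ C → DirBound q u σ C → e ≤ C := by
  rcases hu with ⟨hu, ⟨hp, hg⟩ | ⟨rfl, hD⟩⟩
  · exact dirSeminormPow_isLeast_of_one_lt hp hu hg σ
  · exact dirSeminormPow_isLeast_of_eq_one hu hD σ

/-- The directional seminorm of a Sobolev or `BV` function is continuous in the direction, and it
is the supremum of the difference quotients. -/
theorem exists_dirSeminorm (hp : 1 ≤ p) (hu : u ∈ SobBV N p) :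
    ∃ e : RN N → ℝ, Continuous e ∧ (∀ σ, 0 ≤ e σ) ∧
      (∀ σ, dirSeminormPow p u σ = ENNReal.ofReal (e σ ^ p)) ∧
      (∀ σ r, incrNorm p u (r • σ) ≤ e σ * |r|) ∧
      ∀ σ C, 0 ≤ C → (∀ n : ℕ, incrNorm p u ((2⁻¹ : ℝ) ^ n • σ) ≤ C * (2⁻¹ : ℝ) ^ n) → e σ ≤ C := by
  have hP : Fact (1 ≤ ENNReal.ofReal p) := ⟨one_le_ofReal hp⟩
  set q := ENNReal.conjExponent (ENNReal.ofReal p)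
  choose e he0 hepow heb hel using dirSeminormPow_isLeast (q := q) hu
  refine ⟨e, ?_, he0, hepow, fun σ r => (heb σ).incrNorm_le hp hu.1 (he0 σ) r, ?_⟩
  -- Minimality of e turns the algebra of `DirBound` into sublinearity; a finite convex function on
  -- a finite-dimensional space is continuous.
  · have hadd : ∀ σ τ, e (σ + τ) ≤ e σ + e τ := fun σ τ =>
      hel _ _ (add_nonneg (he0 _) (he0 _)) ((heb σ).add hp hu.1 (heb τ))
    have hsmul : ∀ (c : ℝ) σ, e (c • σ) ≤ |c| * e σ := fun c σ =>
      hel _ _ (mul_nonneg (abs_nonneg _) (he0 _)) ((heb σ).smul c)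
    have hconv : ConvexOn ℝ univ e := by
      refine ⟨convex_univ, fun x _ y _ a b ha hb _ => ?_⟩
      have h1 := hsmul a x
      have h2 := hsmul b y
      rw [abs_of_nonneg ha] at h1
      rw [abs_of_nonneg hb] at h2
      simp only [smul_eq_mul]
      linarith [hadd (a • x) (b • y)]
    exact continuousOn_univ.1 (hconv.continuousOn isOpen_univ)
  · intro σ C hC h
    refine hel σ C hC (dirBound_of_tendsto (l := atTop) hp hu.1 (r := fun n : ℕ => (2⁻¹ : ℝ) ^ n)
      ?_ (Eventually.of_forall fun n => ?_))
    · exact tendsto_nhdsWithin_of_tendsto_nhds_of_eventually_within _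
        (tendsto_pow_atTop_nhds_zero_of_lt_one (by norm_num) (by norm_num))
        (Eventually.of_forall fun n => by simp)
    · rw [abs_of_pos (by positivity)]
      exact h n

end DirSeminorm

/-! ### Functions with bounded increments in `N` independent directions -/

section Representation

variable {N : ℕ} {p : ℝ} {q : ℝ≥0∞}

/-- A bounded sequence of non-negative functions in `L^p` converges to a Radon measure along an
ultrafilter. -/
lemma exists_measure_tendsto_of_bounded [hq : (ENNReal.ofReal p).HolderConjugate q]
    {f : ℕ → RN N → ℝ} (hf : ∀ n, MemLp (f n) (ENNReal.ofReal p) volume) (hf0 : ∀ n x, 0 ≤ f n x)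
    {C : ℝ} (hC : ∀ n, (eLpNorm (f n) (ENNReal.ofReal p) volume).toReal ≤ C)
    (𝒰 : Ultrafilter ℕ) :
    ∃ m : Measure (RN N), m.Regular ∧ ∀ φ : RN N → ℝ, Continuous φ → HasCompactSupport φ →
      Tendsto (fun n => ∫ x, f n x * φ x) 𝒰 (𝓝 (∫ x, φ x ∂m)) := by
  have hφq : ∀ φ : CompactlySupportedContinuousMap (RN N) ℝ, MemLp φ q volume :=
    fun φ => φ.continuous.memLp_of_hasCompactSupport φ.hasCompactSupport
  have hint : ∀ n (φ : CompactlySupportedContinuousMap (RN N) ℝ),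
      Integrable (fun x => f n x * φ x) volume := fun n φ => (hf n).integrable_mul (hφq φ)
  have hlim : ∀ φ : CompactlySupportedContinuousMap (RN N) ℝ, ∃ y : ℝ,
      Tendsto (fun n => ∫ x, f n x * φ x) 𝒰 (𝓝 y) := by
    intro φ
    set K := C * (eLpNorm φ q volume).toReal
    -- Hölder confines the pairings to a compact interval. One ultrafilter gives limits for all φ at
    -- once, so the limit is automatically linear and positive.
    obtain ⟨y, -, hy⟩ := IsCompact.ultrafilter_le_nhds' (isCompact_Icc (a := -K) (b := K))
      (𝒰.map fun n => ∫ x, f n x * φ x) (by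
        refine Ultrafilter.mem_map.2 (Filter.univ_mem' fun n => ?_)
        have h1 := (abs_integral_mul_le (hf n) (hφq φ)).trans
          (mul_le_mul_of_nonneg_right (hC n) ENNReal.toReal_nonneg)
        exact abs_le.1 h1)
    exact ⟨y, hy⟩
  choose Λ hΛ using hlim
  let Λ' : CompactlySupportedContinuousMap (RN N) ℝ →ₚ[ℝ] ℝ :=
  { toFun := Λ
    map_add' φ ψ := by
      have h : Tendsto (fun n => ∫ x, f n x * (φ + ψ) x) 𝒰 (𝓝 (Λ φ + Λ ψ)) := by
        refine ((hΛ φ).add (hΛ ψ)).congr fun n => ?_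
        rw [← integral_add (hint n φ) (hint n ψ)]
        congr 1; ext x
        simp [mul_add]
      exact tendsto_nhds_unique (hΛ (φ + ψ)) h
    map_smul' c φ := by
      have h : Tendsto (fun n => ∫ x, f n x * (c • φ) x) 𝒰 (𝓝 (c * Λ φ)) := by
        refine ((hΛ φ).const_mul c).congr fun n => ?_
        rw [← integral_const_mul]
        congr 1; ext x
        simp only [CompactlySupportedContinuousMap.smul_apply, smul_eq_mul]; ring
      exact tendsto_nhds_unique (hΛ (c • φ)) h
    monotone' φ ψ hle := by
      refine le_of_tendsto_of_tendsto' (hΛ φ) (hΛ ψ) fun n => ?_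
      exact integral_mono (hint n φ) (hint n ψ) fun x =>
        mul_le_mul_of_nonneg_left (hle x) (hf0 n x) }
  refine ⟨RealRMK.rieszMeasure Λ', inferInstance, fun φ h1 h2 => ?_⟩
  let φ' : CompactlySupportedContinuousMap (RN N) ℝ := ⟨⟨φ, h1⟩, h2⟩
  have h3 : ∫ x, φ x ∂(RealRMK.rieszMeasure Λ') = Λ φ' := RealRMK.integral_rieszMeasure Λ' φ'
  rw [h3]
  exact hΛ φ'

/-- The measure `m` acts on `C_c` as a functional bounded by `C` in the dual of `L^q`. -/
def CcBound (q : ℝ≥0∞) (m : Measure (RN N)) (C : ℝ) : Prop :=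
  ∀ φ : RN N → ℝ, Continuous φ → HasCompactSupport φ →
    |∫ x, φ x ∂m| ≤ C * (eLpNorm φ q volume).toReal

/-- Inner regularity reduces to compact K ⊆ U, and a Urysohn function between K and U is tested in
the bound. -/
lemma CcBound.measure_isOpen_le {m : Measure (RN N)} [m.Regular] {C : ℝ} (hC : 0 ≤ C)
    (h : CcBound q m C) {U : Set (RN N)} (hU : IsOpen U) :
    m U ≤ ENNReal.ofReal C * eLpNorm (U.indicator fun _ => (1 : ℝ)) q volume := by
  rw [hU.measure_eq_iSup_isCompact]
  refine iSup_le fun K => iSup_le fun hKU => iSup_le fun hK => ?_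
  obtain ⟨f, hf1, hfc, hfU, hf01⟩ := exists_continuousMap_one_of_isCompact_subset_isOpen hK hU hKU
  have hfq : MemLp f q volume := f.continuous.memLp_of_hasCompactSupport hfc
  have hfi : Integrable f m := f.continuous.integrable_of_hasCompactSupport hfc
  have h1 : m K ≤ ENNReal.ofReal (∫ x, f x ∂m) := by
    rw [ofReal_integral_eq_lintegral_ofReal hfi (Eventually.of_forall fun x => (hf01 x).1)]
    calc m K = ∫⁻ x, K.indicator 1 x ∂m := by rw [lintegral_indicator_one hK.measurableSet]
      _ ≤ _ := by
        refine lintegral_mono fun x => ?_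
        by_cases hx : x ∈ K
        · rw [indicator_of_mem hx, hf1 hx]; simp
        · rw [indicator_of_notMem hx]; simp
  refine h1.trans ((ENNReal.ofReal_le_ofReal ((le_abs_self _).trans
    (h f f.continuous hfc))).trans ?_)
  rw [ENNReal.ofReal_mul hC, ENNReal.ofReal_toReal hfq.eLpNorm_ne_top]
  gcongr
  refine eLpNorm_mono fun x => ?_
  by_cases hx : x ∈ U
  · rw [indicator_of_mem hx, norm_one, Real.norm_of_nonneg (hf01 x).1]
    exact (hf01 x).2
  · have : f x = 0 := image_eq_zero_of_notMem_tsupport fun h => hx (hfU h)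
    simp [this]

lemma CcBound.isFiniteMeasure {m : Measure (RN N)} [m.Regular] {C : ℝ} (hC : 0 ≤ C)
    (h : CcBound ∞ m C) : IsFiniteMeasure m := by
  refine ⟨(h.measure_isOpen_le hC isOpen_univ).trans_lt ?_⟩
  refine ENNReal.mul_lt_top ENNReal.ofReal_lt_top ?_
  rw [indicator_univ]
  exact (memLp_top_const (1 : ℝ)).eLpNorm_lt_top

/-- A null set lies in open sets of arbitrarily small volume, whose indicators are small in L^q
precisely because q is finite. -/
lemma CcBound.absolutelyContinuous {m : Measure (RN N)} [m.Regular] {C : ℝ} (hC : 0 ≤ C)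
    (h : CcBound q m C) (hq0 : q ≠ 0) (hq : q ≠ ∞) : m ≪ volume := by
  intro A hA
  have hr : 0 < 1 / q.toReal := one_div_pos.2 (ENNReal.toReal_pos hq0 hq)
  have key : ∀ ε : ℝ≥0∞, ε ≠ 0 → m A ≤ ENNReal.ofReal C * ε ^ (1 / q.toReal) := by
    intro ε hε
    obtain ⟨U, hAU, hU, hUε⟩ := A.exists_isOpen_lt_add (μ := volume) (by rw [hA]; simp) hε
    rw [hA, zero_add] at hUε
    refine (measure_mono hAU).trans ((h.measure_isOpen_le hC hU).trans ?_)
    rw [eLpNorm_indicator_const hU.measurableSet hq0 hq]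
    simp only [enorm_one, one_mul]
    gcongr
  have hlim : Tendsto (fun ε : ℝ≥0∞ => ENNReal.ofReal C * ε ^ (1 / q.toReal)) (𝓝[≠] 0)
      (𝓝 (ENNReal.ofReal C * 0 ^ (1 / q.toReal))) := by
    refine ENNReal.Tendsto.const_mul ?_ (Or.inr ENNReal.ofReal_ne_top)
    exact (ENNReal.continuous_rpow_const.tendsto 0).mono_left nhdsWithin_le_nhds
  rw [ENNReal.zero_rpow_of_pos hr, mul_zero] at hlim
  have hne : (𝓝[≠] (0 : ℝ≥0∞)).NeBot := inferInstance
  exact le_antisymm (ge_of_tendsto hlim (by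
    filter_upwards [self_mem_nhdsWithin] with ε hε using key ε hε)) zero_le

/-- A functional on `C_c` given by a measure and bounded in the dual of `L^q` is given by a function
in `L^p`. -/
lemma CcBound.exists_memLp (hp : 1 < p) [hq : (ENNReal.ofReal p).HolderConjugate q]
    {m : Measure (RN N)} [m.Regular] {C : ℝ} (hC : 0 ≤ C) (h : CcBound q m C) :
    ∃ g : RN N → ℝ, MemLp g (ENNReal.ofReal p) volume ∧
      ∀ φ : RN N → ℝ, ∫ x, φ x ∂m = ∫ x, g x * φ x := by
  have hqtop := holderConjugate_ne_top (q := q) hp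
  have hq1 := one_le_of_holderConjugate (ENNReal.ofReal p) q
  have hac := h.absolutelyContinuous hC (by rintro rfl; simp at hq1) hqtop
  set G := m.rnDeriv volume with hG
  have hGm : Measurable G := Measure.measurable_rnDeriv _ _
  have hGfin : ∀ᵐ x ∂(volume : Measure (RN N)), G x < ∞ := Measure.rnDeriv_lt_top m volume
  have hmG : volume.withDensity G = m := Measure.withDensity_rnDeriv_eq m volume hac
  set g : RN N → ℝ := fun x => (G x).toReal with hg
  have hgm : Measurable g := hGm.ennreal_toReal
  have hg0 : ∀ x, 0 ≤ g x := fun x => ENNReal.toReal_nonneg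
  have hrep : ∀ φ : RN N → ℝ, ∫ x, φ x ∂m = ∫ x, g x * φ x := by
    intro φ
    nth_rewrite 1 [← hmG]
    exact integral_withDensity_eq_integral_toReal_smul hGm hGfin φ
  refine ⟨g, ?_, hrep⟩
  -- The density g is not yet known to be in L^p, so the duality lemma is applied to truncations in
  -- value and space, which increase to g.
  let gn : ℕ → RN N → ℝ := fun n => (Metric.ball (0 : RN N) n).indicator fun x => min (g x) n
  have hgnm : ∀ n, Measurable (gn n) := fun n =>
    (hgm.min measurable_const).indicator Metric.isOpen_ball.measurableSet
  have hgn0 : ∀ n x, 0 ≤ gn n x := fun n x =>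
    indicator_nonneg (fun y _ => le_min (hg0 y) n.cast_nonneg) x
  have hgng : ∀ n x, gn n x ≤ g x := by
    intro n x
    by_cases hx : x ∈ Metric.ball (0 : RN N) n
    · simp only [gn, indicator_of_mem hx]; exact min_le_left _ _
    · simp only [gn, indicator_of_notMem hx]; exact hg0 x
  have hgnL : ∀ n, MemLp (gn n) (ENNReal.ofReal p) volume := by
    intro n
    have h1 : MemLp ((Metric.ball (0 : RN N) n).indicator fun _ => (n : ℝ)) (ENNReal.ofReal p)
        volume := memLp_indicator_const _ Metric.isOpen_ball.measurableSet _
          (Or.inr measure_ball_lt_top.ne)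
    refine h1.mono (hgnm n).aestronglyMeasurable (Eventually.of_forall fun x => ?_)
    by_cases hx : x ∈ Metric.ball (0 : RN N) n
    · simp only [gn, indicator_of_mem hx]
      rw [Real.norm_of_nonneg (le_min (hg0 x) n.cast_nonneg), Real.norm_of_nonneg n.cast_nonneg]
      exact min_le_right _ _
    · simp [gn, indicator_of_notMem hx]
  have hgnC : ∀ n, eLpNorm (gn n) (ENNReal.ofReal p) volume ≤ ENNReal.ofReal C := by
    intro n
    rw [← ENNReal.toReal_le_toReal (hgnL n).eLpNorm_ne_top ENNReal.ofReal_ne_top,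
      ENNReal.toReal_ofReal hC]
    refine eLpNorm_le_of_test (q := q) hp.le (hgnL n) hC fun φ h1 h2 => ?_
    have h3 := h (fun x => |φ x|) h1.continuous.abs h2.norm
    have hint : Integrable (fun x => g x * |φ x|) volume := by
      have h4 : Integrable (fun x => |φ x|) m :=
        h1.continuous.abs.integrable_of_hasCompactSupport h2.norm
      rw [← hmG, integrable_withDensity_iff_integrable_smul' hGm hGfin] at h4
      exact h4
    have h5 : eLpNorm (fun x => |φ x|) q volume = eLpNorm φ q volume := eLpNorm_norm φ
    rw [hrep, h5] at h3
    refine le_trans ?_ ((le_abs_self _).trans h3)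
    rw [← Real.norm_eq_abs]
    refine (norm_integral_le_integral_norm _).trans (integral_mono ?_ hint fun x => ?_)
    · exact ((hgnL n).integrable_mul (memLp_test h1 h2 q)).norm
    · simp only [norm_mul, Real.norm_eq_abs]
      rw [abs_of_nonneg (hgn0 n x)]
      exact mul_le_mul_of_nonneg_right (hgng n x) (abs_nonneg _)
  have hlim : ∀ x, Tendsto (fun n => gn n x) atTop (𝓝 (g x)) := by
    intro x
    refine tendsto_const_nhds.congr' ?_
    obtain ⟨n₀, hn₀⟩ := exists_nat_gt (max (g x) ‖x‖)
    filter_upwards [eventually_ge_atTop n₀] with n hn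
    have h1 : max (g x) ‖x‖ < n := hn₀.trans_le (by exact_mod_cast hn)
    have hx : x ∈ Metric.ball (0 : RN N) n := by
      rw [mem_ball_zero_iff]; exact (le_max_right _ _).trans_lt h1
    simp only [gn, indicator_of_mem hx]
    rw [min_eq_left ((le_max_left _ _).trans h1.le)]
  refine ⟨hgm.aestronglyMeasurable, ?_⟩
  -- Fatou's lemma transfers the uniform bound C to g.
  refine (Lp.eLpNorm_lim_le_liminf_eLpNorm (fun n => (hgnm n).aestronglyMeasurable) g
    (Eventually.of_forall hlim)).trans_lt ?_
  refine lt_of_le_of_lt ?_ (ENNReal.ofReal_lt_top (r := C))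
  exact liminf_le_of_le (by isBoundedDefault) fun b hb => by
    obtain ⟨n, hn⟩ := hb.exists
    exact hn.trans (hgnC n)

end Representation

/-! ### From bounded dyadic increments to Sobolev and BV regularity -/

section BoundedIncrements

variable {N : ℕ} {p : ℝ} {q : ℝ≥0∞} {u : RN N → ℝ}

/-- Dyadic increments of order one in the direction `w` represent the distributional derivative
`∂_w u` as a difference of two measures. -/
lemma exists_measure_of_incrNorm_le (hp : 1 ≤ p) [hq : (ENNReal.ofReal p).HolderConjugate q]
    (hu : MemLp u (ENNReal.ofReal p) volume) {w : RN N} {C : ℝ}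
    (h : ∀ n : ℕ, incrNorm p u ((2⁻¹ : ℝ) ^ n • w) ≤ C * (2⁻¹ : ℝ) ^ n) :
    ∃ m₁ m₂ : Measure (RN N), m₁.Regular ∧ m₂.Regular ∧ CcBound q m₁ C ∧ CcBound q m₂ C ∧
      ∀ φ : RN N → ℝ, ContDiff ℝ (⊤ : ℕ∞) φ → HasCompactSupport φ →
        dirPairing u w φ = -(∫ x, φ x ∂m₁ - ∫ x, φ x ∂m₂) := by
  let r : ℕ → ℝ := fun n => (2⁻¹ : ℝ) ^ n
  have hr : ∀ n, 0 < r n := fun n => by positivity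
  let f : ℕ → RN N → ℝ := fun n x => (r n)⁻¹ * (u (x + r n • w) - u x)
  have hfL : ∀ n, MemLp (f n) (ENNReal.ofReal p) volume := fun n =>
    (memLp_incr hu (r n • w)).const_mul _
  have hfC : ∀ n, (eLpNorm (f n) (ENNReal.ofReal p) volume).toReal ≤ C := by
    intro n
    have e : f n = (r n)⁻¹ • fun x => u (x + r n • w) - u x := rfl
    rw [e, eLpNorm_const_smul, ENNReal.toReal_mul, toReal_enorm,
      Real.norm_of_nonneg (inv_nonneg.2 (hr n).le), inv_mul_le_iff₀ (hr n), mul_comm]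
    exact h n
  have hmono : ∀ g : ℕ → RN N → ℝ, (∀ n x, ‖g n x‖ ≤ ‖f n x‖) → ∀ n,
      (eLpNorm (g n) (ENNReal.ofReal p) volume).toReal ≤ C := fun g hg n =>
    (ENNReal.toReal_mono (hfL n).eLpNorm_ne_top (eLpNorm_mono (hg n))).trans (hfC n)
  -- Riesz representation needs positive functionals, so the difference quotients are split into
  -- positive and negative parts, each dominated by the quotient itself.
  have hpos : ∀ n x, ‖max (f n x) 0‖ ≤ ‖f n x‖ := fun n x => by
    rw [Real.norm_of_nonneg (le_max_right _ _), Real.norm_eq_abs]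
    exact max_le (le_abs_self _) (abs_nonneg _)
  have hneg : ∀ n x, ‖max (-f n x) 0‖ ≤ ‖f n x‖ := fun n x => by
    rw [Real.norm_of_nonneg (le_max_right _ _), Real.norm_eq_abs]
    exact max_le (neg_le_abs _) (abs_nonneg _)
  have hposL : ∀ n, MemLp (fun x => max (f n x) 0) (ENNReal.ofReal p) volume := fun n =>
    (hfL n).pos_part
  have hnegL : ∀ n, MemLp (fun x => max (-f n x) 0) (ENNReal.ofReal p) volume := fun n =>
    (hfL n).neg_part
  -- The same ultrafilter serves both parts, so that their difference converges too. It is finer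
  -- than `atTop`, so the scales tend to 0 along it.
  let 𝒰 : Ultrafilter ℕ := Filter.hyperfilter ℕ
  obtain ⟨m₁, hm₁, ht₁⟩ := exists_measure_tendsto_of_bounded (q := q) hposL
    (fun n x => le_max_right _ _) (hmono _ hpos) 𝒰
  obtain ⟨m₂, hm₂, ht₂⟩ := exists_measure_tendsto_of_bounded (q := q) hnegL
    (fun n x => le_max_right _ _) (hmono _ hneg) 𝒰
  refine ⟨m₁, m₂, hm₁, hm₂, ?_, ?_, ?_⟩
  · intro φ h1 h2
    refine le_of_tendsto' (ht₁ φ h1 h2).abs fun n => ?_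
    exact (abs_integral_mul_le (hposL n) (h1.memLp_of_hasCompactSupport h2)).trans
      (mul_le_mul_of_nonneg_right (hmono _ hpos n) ENNReal.toReal_nonneg)
  · intro φ h1 h2
    refine le_of_tendsto' (ht₂ φ h1 h2).abs fun n => ?_
    exact (abs_integral_mul_le (hnegL n) (h1.memLp_of_hasCompactSupport h2)).trans
      (mul_le_mul_of_nonneg_right (hmono _ hneg n) ENNReal.toReal_nonneg)
  · intro φ h1 h2
    have hr0 : Tendsto r 𝒰 (𝓝[≠] 0) := by
      refine Tendsto.mono_left ?_ (Nat.hyperfilter_le_atTop)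
      exact tendsto_nhdsWithin_of_tendsto_nhds_of_eventually_within _
        (tendsto_pow_atTop_nhds_zero_of_lt_one (by norm_num) (by norm_num))
        (Eventually.of_forall fun n => (hr n).ne')
    have hA := (tendsto_integral_incr hp hu h1 h2 w).comp hr0
    have hB := (ht₁ φ h1.continuous h2).sub (ht₂ φ h1.continuous h2)
    have hAB := tendsto_nhds_unique hA (hB.congr fun n => by
      have hφ := memLp_test h1 h2 q
      have i1 : Integrable (fun x => max (f n x) 0 * φ x) volume := (hposL n).integrable_mul hφ
      have i2 : Integrable (fun x => max (-f n x) 0 * φ x) volume := (hnegL n).integrable_mul hφ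
      rw [← integral_sub i1 i2]
      simp only [Function.comp]
      congr 1; ext x
      rw [← sub_mul]
      congr 1
      change max (f n x) 0 - max (-f n x) 0 = f n x
      rcases le_total 0 (f n x) with h0 | h0
      · rw [max_eq_left h0, max_eq_right (by linarith), sub_zero]
      · rw [max_eq_right h0, max_eq_left (by linarith), zero_sub, neg_neg])
    linarith

/-- Since the w_i span, y is determined by its inner products with them; a linear left inverse of
this injection, evaluated on the standard basis, gives the dual family. -/
lemma exists_dual_family {w : Fin N → RN N} (hw : LinearIndependent ℝ w) :
    ∃ w' : Fin N → RN N, ∀ y : RN N, ∑ i, inner ℝ (w i) y • w' i = y := by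
  let A : RN N →ₗ[ℝ] (Fin N → ℝ) := LinearMap.pi fun i => (innerSL ℝ (w i)).toLinearMap
  have hspan : Submodule.span ℝ (range w) = ⊤ :=
    hw.span_eq_top_of_card_eq_finrank' (by simp)
  have hker : LinearMap.ker A = ⊥ := by
    rw [LinearMap.ker_eq_bot']
    intro y hy
    have h1 : ∀ i, inner ℝ (w i) y = 0 := fun i => congrFun hy i
    have h2 : Submodule.span ℝ (range w) ≤ LinearMap.ker (innerSL ℝ y).toLinearMap := by
      rw [Submodule.span_le]
      rintro _ ⟨i, rfl⟩
      exact (real_inner_comm _ _).trans (h1 i)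
    rw [hspan] at h2
    have h3 : inner ℝ y y = 0 := h2 (Submodule.mem_top (x := y))
    exact inner_self_eq_zero.1 h3
  obtain ⟨G, hG⟩ := A.exists_leftInverse_of_injective hker
  refine ⟨fun i => G (Pi.single i 1), fun y => ?_⟩
  have h1 : G (A y) = y := LinearMap.congr_fun hG y
  have h2 : A y = ∑ i, inner ℝ (w i) y • (Pi.single i (1 : ℝ) : Fin N → ℝ) := by
    ext j
    simp [A, Finset.sum_apply, Pi.single_apply]
  nth_rewrite 2 [← h1]
  rw [h2, map_sum]
  simp_rw [map_smul]

lemma integral_mapRange_toSignedMeasure (m : Measure (RN N)) [IsFiniteMeasure m] {φ : RN N → ℝ}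
    (hφ : Continuous φ) (hφc : HasCompactSupport φ) (v : RN N) :
    ∫ᵛ x, φ x ∂•(m.toSignedMeasure.mapRange
      (ContinuousLinearMap.toSpanSingleton ℝ v).toLinearMap.toAddMonoidHom
      (ContinuousLinearMap.toSpanSingleton ℝ v).continuous) = (∫ x, φ x ∂m) • v := by
  rw [← clm_apply_integral_vectorMeasure, integral_vectorMeasure_toSignedMeasure,
    ContinuousLinearMap.toSpanSingleton_apply]
  rw [Measure.variation_toSignedMeasure]
  exact hφ.integrable_of_hasCompactSupport hφc

lemma exists_vectorMeasure_integral_eq (m : Measure (RN N)) [IsFiniteMeasure m] (v : RN N) :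
    ∃ D : VectorMeasure (RN N) (RN N), D.variation univ < ∞ ∧
      ∀ φ : RN N → ℝ, Continuous φ → HasCompactSupport φ →
        ∫ᵛ x, φ x ∂•D = (∫ x, φ x ∂m) • v := by
  refine ⟨_, ?_, fun φ h1 h2 => integral_mapRange_toSignedMeasure m h1 h2 v⟩
  refine (variation_mapRange_le _ _ univ).trans_lt ?_
  rw [Measure.variation_toSignedMeasure]
  exact measure_lt_top _ _

/-- A function in `L^p` whose dyadic increments are of order one in `N` independent directions
is a Sobolev function, or a function of bounded variation. -/
theorem mem_sobBV_of_incrNorm_le (hp : 1 ≤ p) (hu : MemLp u (ENNReal.ofReal p) volume)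
    {w : Fin N → RN N} (hw : LinearIndependent ℝ w) {C : Fin N → ℝ} (hC : ∀ i, 0 ≤ C i)
    (h : ∀ i (n : ℕ), incrNorm p u ((2⁻¹ : ℝ) ^ n • w i) ≤ C i * (2⁻¹ : ℝ) ^ n) :
    u ∈ SobBV N p := by
  have hP : Fact (1 ≤ ENNReal.ofReal p) := ⟨one_le_ofReal hp⟩
  set q := ENNReal.conjExponent (ENNReal.ofReal p) with hqdef
  obtain ⟨w', hw'⟩ := exists_dual_family hw
  choose m₁ m₂ hr₁ hr₂ hb₁ hb₂ hpair using fun i =>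
    exists_measure_of_incrNorm_le (q := q) hp hu (h i)
  -- The dual family reassembles the full gradient from the N directional derivatives, each of which
  -- is a difference of two measures.
  have hdecomp : ∀ φ : RN N → ℝ, ContDiff ℝ (⊤ : ℕ∞) φ → HasCompactSupport φ →
      ∫ x, u x • gradient φ x = -∑ i, (∫ x, φ x ∂m₁ i - ∫ x, φ x ∂m₂ i) • w' i := by
    intro φ h1 h2
    rw [← hw' (∫ x, u x • gradient φ x), ← Finset.sum_neg_distrib]
    refine Finset.sum_congr rfl fun i _ => ?_
    rw [inner_integral_smul_gradient hp hu h1 h2, hpair i φ h1 h2, neg_smul]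
  refine ⟨hu, ?_⟩
  rcases hp.eq_or_lt with rfl | hp1
  · right
    refine ⟨rfl, ?_⟩
    have hq' : q = ∞ := by
      have hq : (1 : ℝ≥0∞).HolderConjugate q := by
        rw [← ENNReal.ofReal_one]; infer_instance
      simpa using ENNReal.HolderConjugate.conj_eq (p := 1) (q := q)
    have hf₁ : ∀ i, IsFiniteMeasure (m₁ i) := fun i =>
      CcBound.isFiniteMeasure (hC i) (by rw [← hq']; exact hb₁ i)
    have hf₂ : ∀ i, IsFiniteMeasure (m₂ i) := fun i =>
      CcBound.isFiniteMeasure (hC i) (by rw [← hq']; exact hb₂ i)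
    choose D₁ hD₁ hφ₁ using fun i => exists_vectorMeasure_integral_eq (m₁ i) (w' i)
    choose D₂ hD₂ hφ₂ using fun i => exists_vectorMeasure_integral_eq (m₂ i) (w' i)
    refine ⟨∑ i, (D₁ i - D₂ i), ?_, fun φ h1 h2 => ?_⟩
    · refine (VectorMeasure.variation_finsetSum_le _ _ univ).trans_lt ?_
      rw [Measure.finsetSum_apply]
      refine ENNReal.sum_lt_top.2 fun i _ => ?_
      refine (VectorMeasure.variation_sub_le univ).trans_lt ?_
      rw [Measure.add_apply]
      exact ENNReal.add_lt_top.2 ⟨hD₁ i, hD₂ i⟩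
    · have i1 : ∀ i, (D₁ i).Integrable φ := fun i => by
        have : IsFiniteMeasure (D₁ i).variation := ⟨hD₁ i⟩
        exact h1.continuous.integrable_of_hasCompactSupport h2
      have i2 : ∀ i, (D₂ i).Integrable φ := fun i => by
        have : IsFiniteMeasure (D₂ i).variation := ⟨hD₂ i⟩
        exact h1.continuous.integrable_of_hasCompactSupport h2
      rw [hdecomp φ h1 h2, VectorMeasure.integral_finsetSum_vectorMeasure
        fun i _ => (i1 i).sub_vectorMeasure (i2 i)]
      congr 1
      refine Finset.sum_congr rfl fun i _ => ?_
      rw [VectorMeasure.integral_sub_vectorMeasure (i1 i) (i2 i), hφ₁ i φ h1.continuous h2,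
        hφ₂ i φ h1.continuous h2, sub_smul]
  · left
    refine ⟨hp1, ?_⟩
    choose g₁ hg₁L hg₁ using fun i => (hb₁ i).exists_memLp hp1 (hC i)
    choose g₂ hg₂L hg₂ using fun i => (hb₂ i).exists_memLp hp1 (hC i)
    refine ⟨fun x => ∑ i, (g₁ i x - g₂ i x) • w' i, ?_, fun φ h1 h2 => ?_⟩
    · refine memLp_finsetSum _ fun i _ => ?_
      exact (ContinuousLinearMap.toSpanSingleton ℝ (w' i)).comp_memLp' ((hg₁L i).sub (hg₂L i))
    · have hφ := memLp_test h1 h2 q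
      have i1 : ∀ i, Integrable (fun x => g₁ i x * φ x) volume := fun i =>
        (hg₁L i).integrable_mul hφ
      have i2 : ∀ i, Integrable (fun x => g₂ i x * φ x) volume := fun i =>
        (hg₂L i).integrable_mul hφ
      rw [hdecomp φ h1 h2]
      congr 1
      simp_rw [Finset.smul_sum]
      rw [integral_finsetSum]
      · refine Finset.sum_congr rfl fun i _ => ?_
        rw [hg₁ i φ, hg₂ i φ, ← integral_sub (i1 i) (i2 i), ← integral_smul_const]
        congr 1; ext1 x
        rw [smul_smul]
        congr 1; ring
      · intro i _
        have : (fun x => φ x • (g₁ i x - g₂ i x) • w' i) =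
            fun x => (g₁ i x * φ x - g₂ i x * φ x) • w' i := by
          ext1 x
          rw [smul_smul]
          congr 1; ring
        rw [this]
        exact ((i1 i).sub (i2 i)).smul_const (w' i)

end BoundedIncrements

/-! ### Bounds on the kernels -/

section KernelBounds

variable {N : ℕ} {p : ℝ} {J : Set ℝ} {ρ : ℝ → RN N → ℝ}

/-- The common consequence of the five bounds: for large radii, the kernels are eventually bounded
in mass on the ball and with weight `R ^ p / |z| ^ p` on its complement. -/
def EventualKernelBound (p : ℝ) (J : Set ℝ) (ρ : ℝ → RN N → ℝ) : Prop :=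
  ∃ M : ℝ≥0∞, M ≠ ∞ ∧ ∃ R₀ : ℝ, 1 ≤ R₀ ∧ ∀ R, R₀ < R → ∀ᶠ t in 𝓝[J] 0,
    ∫⁻ z in Metric.ball 0 R, ENNReal.ofReal (ρ t z) ≤ M ∧
    ENNReal.ofReal (R ^ p) *
      ∫⁻ z in (Metric.ball 0 R)ᶜ, ENNReal.ofReal (ρ t z / ‖z‖ ^ p) ≤ M

lemma eventually_mul_le_of_mul_limsup_lt {α : Type*} {l : Filter α} {f : α → ℝ≥0∞} {c M : ℝ≥0∞}
    (hc0 : c ≠ 0) (hc : c ≠ ∞) (h : c * limsup f l < M) : ∀ᶠ t in l, c * f t ≤ M := by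
  have h1 : limsup f l < M / c := by
    rw [ENNReal.lt_div_iff_mul_lt (Or.inl hc0) (Or.inl hc), mul_comm]
    exact h
  filter_upwards [eventually_lt_of_limsup_lt h1] with t ht
  rw [mul_comm]
  exact (ENNReal.lt_div_iff_mul_lt (Or.inl hc0) (Or.inl hc)).1 ht |>.le

lemma KernelBound3.eventualKernelBound (h : KernelBound3 p J ρ) :
    EventualKernelBound p J ρ := by
  obtain ⟨R₀, hR₀, h⟩ := h
  set S := ⨆ (R : ℝ) (_ : R₀ < R), (innerMass J ρ R + ENNReal.ofReal (R ^ p) * outerMass p J ρ R)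
  -- The unit of slack turns bounds on upper limits into bounds for t close to 0.
  have hS : S < S + 1 := ENNReal.lt_add_right h.ne one_ne_zero
  refine ⟨S + 1, ENNReal.add_ne_top.2 ⟨h.ne, ENNReal.one_ne_top⟩, max R₀ 1, le_max_right _ _,
    fun R hR => ?_⟩
  have hRpos : 0 < R := zero_lt_one.trans ((le_max_right _ _).trans_lt hR)
  have hle : innerMass J ρ R + ENNReal.ofReal (R ^ p) * outerMass p J ρ R ≤ S :=
    le_iSup₂ (f := fun (R : ℝ) (_ : R₀ < R) =>
      innerMass J ρ R + ENNReal.ofReal (R ^ p) * outerMass p J ρ R) R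
      ((le_max_left _ _).trans_lt hR)
  have h1 : innerMass J ρ R < S + 1 := (le_self_add.trans hle).trans_lt hS
  have h2 : ENNReal.ofReal (R ^ p) * outerMass p J ρ R < S + 1 :=
    (le_add_self.trans hle).trans_lt hS
  filter_upwards [eventually_lt_of_limsup_lt h1, eventually_mul_le_of_mul_limsup_lt
    (ENNReal.ofReal_pos.2 (Real.rpow_pos_of_pos hRpos p)).ne' ENNReal.ofReal_ne_top h2]
    with t ht1 ht2
  exact ⟨ht1.le, ht2⟩

lemma KernelBound2.kernelBound3 (h : KernelBound2 p J ρ) : KernelBound3 p J ρ :=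
  ⟨1, one_pos, lt_of_le_of_lt (iSup₂_le fun R hR =>
    le_iSup₂ (f := fun (R : ℝ) (_ : 0 < R) =>
      innerMass J ρ R + ENNReal.ofReal (R ^ p) * outerMass p J ρ R) R (one_pos.trans hR)) h⟩

lemma KernelBound4.kernelBound3 (h : KernelBound4 p J ρ) : KernelBound3 p J ρ :=
  ⟨1, one_pos, lt_of_le_of_lt (iSup₂_le fun R hR => by
    rw [h.2 R (one_pos.trans hR), mul_zero, add_zero]
    exact le_iSup₂ (f := fun (R : ℝ) (_ : 0 < R) => innerMass J ρ R) R (one_pos.trans hR)) h.1⟩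

/-- R^p + |z|^p is at most 2 R^p inside the ball and at most 2 |z|^p outside it, so the single
integral controls both pieces up to a factor 2. -/
lemma KernelBound1.eventualKernelBound (hp : 1 ≤ p) (h : KernelBound1 p J ρ) :
    EventualKernelBound p J ρ := by
  set F : ℝ → ℝ → ℝ≥0∞ := fun R t => ENNReal.ofReal (R ^ p) *
      ∫⁻ z, ENNReal.ofReal (ρ t z / (R ^ p + ‖z‖ ^ p))
  set S := ⨆ (R : ℝ) (_ : 0 < R), limsup (F R) (𝓝[J] 0)
  have h : S < ∞ := h
  have hS : S < S + 1 := ENNReal.lt_add_right h.ne one_ne_zero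
  refine ⟨2 * (S + 1), ENNReal.mul_ne_top (by simp)
    (ENNReal.add_ne_top.2 ⟨h.ne, ENNReal.one_ne_top⟩), 1, le_rfl, fun R hR => ?_⟩
  have hRpos : 0 < R := zero_lt_one.trans hR
  have hRp : 0 < R ^ p := Real.rpow_pos_of_pos hRpos p
  have h1 : limsup (F R) (𝓝[J] 0) < S + 1 :=
    (le_iSup₂ (f := fun (R : ℝ) (_ : 0 < R) => limsup (F R) (𝓝[J] 0)) R hRpos).trans_lt hS
  filter_upwards [eventually_lt_of_limsup_lt h1] with t ht
  have hmain : ∀ (A : Set (RN N)) (f : RN N → ℝ), MeasurableSet A →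
      (∀ z ∈ A, 0 ≤ ρ t z → f z ≤ 2 * (R ^ p * (ρ t z / (R ^ p + ‖z‖ ^ p)))) →
      (∀ z ∈ A, ρ t z < 0 → f z ≤ 0) →
      ∫⁻ z in A, ENNReal.ofReal (f z) ≤ 2 * (S + 1) := by
    intro A f hA h1 h2
    calc ∫⁻ z in A, ENNReal.ofReal (f z)
        ≤ ∫⁻ z in A, 2 * (ENNReal.ofReal (R ^ p) *
            ENNReal.ofReal (ρ t z / (R ^ p + ‖z‖ ^ p))) := by
          refine setLIntegral_mono' hA fun z hz => ?_
          rcases lt_or_ge (ρ t z) 0 with h0 | h0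
          · rw [ENNReal.ofReal_of_nonpos (h2 z hz h0)]; exact zero_le
          · refine (ENNReal.ofReal_le_ofReal (h1 z hz h0)).trans_eq ?_
            rw [ENNReal.ofReal_mul (by norm_num), ENNReal.ofReal_mul hRp.le]
            simp
      _ ≤ ∫⁻ z, 2 * (ENNReal.ofReal (R ^ p) *
            ENNReal.ofReal (ρ t z / (R ^ p + ‖z‖ ^ p))) := setLIntegral_le_lintegral _ _
      _ = 2 * F R t := by
          rw [lintegral_const_mul' _ _ (by simp), lintegral_const_mul' _ _ ENNReal.ofReal_ne_top]
      _ ≤ _ := by gcongr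
  constructor
  · refine hmain _ _ Metric.isOpen_ball.measurableSet (fun z hz h0 => ?_) fun z hz h0 => h0.le
    have hz' : ‖z‖ < R := by simpa using hz
    have hzp : ‖z‖ ^ p ≤ R ^ p := Real.rpow_le_rpow (norm_nonneg _) hz'.le (by linarith)
    have hz0 : 0 ≤ ‖z‖ ^ p := Real.rpow_nonneg (norm_nonneg _) _
    rw [← mul_div_assoc, ← mul_div_assoc, le_div_iff₀ (by linarith)]
    nlinarith
  · rw [← lintegral_const_mul' _ _ ENNReal.ofReal_ne_top]
    simp_rw [← ENNReal.ofReal_mul hRp.le]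
    refine hmain _ _ Metric.isOpen_ball.measurableSet.compl (fun z hz h0 => ?_) fun z hz h0 => ?_
    · have hz' : R ≤ ‖z‖ := by simpa using hz
      have hzp : R ^ p ≤ ‖z‖ ^ p := Real.rpow_le_rpow hRpos.le hz' (by linarith)
      have hz0 : 0 < ‖z‖ ^ p := hRp.trans_le hzp
      have : ρ t z / ‖z‖ ^ p ≤ 2 * (ρ t z / (R ^ p + ‖z‖ ^ p)) := by
        rw [← mul_div_assoc, div_le_div_iff₀ hz0 (by linarith)]
        nlinarith
      nlinarith
    · exact mul_nonpos_of_nonneg_of_nonpos hRp.le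
        (div_nonpos_of_nonpos_of_nonneg h0.le (Real.rpow_nonneg (norm_nonneg _) _))

/-- The weight is 1 on the unit ball. Off it the weighted mass vanishes in the limit, hence falls
below any multiple of R^(-p): this absorbs the factor R^p in the tail, and also on 1 ≤ |z| < R,
where |z|^(-p) ≥ R^(-p). -/
lemma KernelBound5.eventualKernelBound (hN : 1 ≤ N) (hp : 1 ≤ p) (h : KernelBound5 p J ρ) :
    EventualKernelBound p J ρ := by
  have : Nonempty (Fin N) := ⟨⟨0, hN⟩⟩
  obtain ⟨h, h0⟩ := h
  set S := limsup (fun t => ∫⁻ z, ENNReal.ofReal (min 1 (‖z‖ ^ (-p)) * ρ t z)) (𝓝[J] 0)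
  have hS : S < S + 1 := ENNReal.lt_add_right h.ne one_ne_zero
  refine ⟨S + 1 + 1, by simp [h.ne], 1, le_rfl, fun R hR => ?_⟩
  have hRpos : 0 < R := zero_lt_one.trans hR
  have hRp : 0 < R ^ p := Real.rpow_pos_of_pos hRpos p
  have hmin : ∀ z : RN N, 1 ≤ ‖z‖ → min 1 (‖z‖ ^ (-p)) = ‖z‖ ^ (-p) := fun z hz =>
    min_eq_right (Real.rpow_le_one_of_one_le_of_nonpos hz (by linarith))
  have hsmall : ∀ r : ℝ, 0 < r → ∀ᶠ t in 𝓝[J] 0, ENNReal.ofReal (R ^ p) *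
      ∫⁻ z in (Metric.ball 0 r)ᶜ, ENNReal.ofReal (min 1 (‖z‖ ^ (-p)) * ρ t z) ≤ 1 :=
    fun r hr => eventually_mul_le_of_mul_limsup_lt (ENNReal.ofReal_pos.2 hRp).ne'
      ENNReal.ofReal_ne_top (by rw [h0 r hr]; simp)
  filter_upwards [eventually_lt_of_limsup_lt hS, hsmall 1 one_pos,
    hsmall R hRpos] with t ht1 ht2 ht3
  constructor
  · have hsub : Metric.ball (0 : RN N) R ⊆
        Metric.ball 0 1 ∪ (Metric.ball 0 R ∩ (Metric.ball 0 1)ᶜ) := by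
      intro z hz
      by_cases h1 : z ∈ Metric.ball (0 : RN N) 1
      · exact Or.inl h1
      · exact Or.inr ⟨hz, h1⟩
    refine (lintegral_mono_set hsub).trans ((lintegral_union_le _ _ _).trans ?_)
    refine add_le_add ?_ ?_
    · refine le_trans ?_ ht1.le
      refine le_trans ?_ (setLIntegral_le_lintegral (Metric.ball 0 1) _)
      refine lintegral_mono_ae ?_
      -- The origin must be excluded: there `‖z‖ ^ (-p)` is 0 by convention, not large.
      have hne : ∀ᵐ z ∂(volume : Measure (RN N)), z ≠ 0 := by
        rw [ae_iff]; simp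
      filter_upwards [ae_restrict_mem Metric.isOpen_ball.measurableSet, ae_restrict_of_ae hne]
        with z hz hz0
      have hz' : ‖z‖ < 1 := by simpa using hz
      rw [min_eq_left, one_mul]
      exact Real.one_le_rpow_of_pos_of_le_one_of_nonpos (norm_pos_iff.2 hz0) hz'.le (by linarith)
    · refine le_trans ?_ ht2
      rw [← lintegral_const_mul' _ _ ENNReal.ofReal_ne_top]
      refine le_trans ?_ (lintegral_mono_set (inter_subset_right (s := Metric.ball (0 : RN N) R)))
      refine setLIntegral_mono' (Metric.isOpen_ball.measurableSet.inter
        Metric.isOpen_ball.measurableSet.compl) fun z hz => ?_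
      have hz1 : ‖z‖ < R := by simpa using hz.1
      have hz2 : 1 ≤ ‖z‖ := by simpa using hz.2
      rw [← ENNReal.ofReal_mul hRp.le, hmin z hz2, ← mul_assoc]
      rcases le_total (ρ t z) 0 with h3 | h3
      · rw [ENNReal.ofReal_of_nonpos h3]; exact zero_le
      · refine ENNReal.ofReal_le_ofReal (le_mul_of_one_le_left h3 ?_)
        rw [Real.rpow_neg (norm_nonneg _), ← div_eq_mul_inv,
          one_le_div (Real.rpow_pos_of_pos (by linarith) _)]
        exact Real.rpow_le_rpow (norm_nonneg _) hz1.le (by linarith)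
  · refine le_trans ?_ (ht3.trans le_add_self)
    gcongr ENNReal.ofReal (R ^ p) * ?_
    refine setLIntegral_mono' Metric.isOpen_ball.measurableSet.compl fun z hz => ?_
    have hz2 : 1 ≤ ‖z‖ := hR.le.trans (by simpa using hz)
    rw [hmin z hz2, Real.rpow_neg (norm_nonneg _), div_eq_inv_mul]

end KernelBounds

/-! ### Weak limits of measures in polar coordinates -/

section PolarLimit

/-- Bounds on a sequence of measures on `ℝ × S`, uniform on `|r| < R` and with weight
`R ^ p / |r| ^ p` on `|r| ≥ R`, for large `R`. -/
def PolarBound {S : Type*} [MeasurableSpace S] (p : ℝ) (M : ℝ≥0) (R₀ : ℝ)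
    (m : ℕ → Measure (ℝ × S)) : Prop :=
  ∀ R, R₀ < R → ∀ᶠ k in atTop, m k {x | |x.1| < R} ≤ M ∧
    ENNReal.ofReal (R ^ p) * ∫⁻ x in {x | R ≤ |x.1|}, ENNReal.ofReal (|x.1| ^ (-p)) ∂m k ≤ M

/-- The weight `(1 + |r|) ^ (-p)`. -/
def polarWeight {S : Type*} (p : ℝ) (x : ℝ × S) : ℝ := (1 + |x.1|) ^ (-p)

lemma polarWeight_pos {S : Type*} {p : ℝ} (x : ℝ × S) : 0 < polarWeight p x := by
  unfold polarWeight; positivity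

lemma continuous_polarWeight {S : Type*} [TopologicalSpace S] {p : ℝ} :
    Continuous (polarWeight p : ℝ × S → ℝ) := by
  unfold polarWeight
  have h : Continuous fun x : ℝ × S => 1 + |x.1| := by fun_prop
  exact h.rpow_const fun x => Or.inl (by positivity)

lemma polarWeight_le_one {S : Type*} {p : ℝ} (hp : 0 ≤ p) (x : ℝ × S) : polarWeight p x ≤ 1 :=
  Real.rpow_le_one_of_one_le_of_nonpos (by linarith [abs_nonneg x.1]) (by linarith)

lemma polarWeight_le {S : Type*} {p : ℝ} (hp : 0 ≤ p) {x : ℝ × S} (hx : 0 < |x.1|) :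
    polarWeight p x ≤ |x.1| ^ (-p) :=
  Real.rpow_le_rpow_of_nonpos hx (by linarith) (by linarith)

lemma measurableSet_abs_fst_lt {S : Type*} [MeasurableSpace S] (R : ℝ) :
    MeasurableSet {x : ℝ × S | |x.1| < R} :=
  measurableSet_lt (by fun_prop) measurable_const

lemma measurableSet_le_abs_fst {S : Type*} [MeasurableSpace S] (R : ℝ) :
    MeasurableSet {x : ℝ × S | R ≤ |x.1|} :=
  measurableSet_le measurable_const (by fun_prop)

/-- A continuous function equal to `1` for `|r| ≤ R` and to `0` for `|r| ≥ 2 R`. -/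
def plateau (R r : ℝ) : ℝ := max 0 (min 1 (2 - |r| / R))

lemma continuous_plateau (R : ℝ) : Continuous (plateau R) := by
  unfold plateau; fun_prop

lemma plateau_nonneg (R r : ℝ) : 0 ≤ plateau R r := le_max_left _ _

lemma plateau_le_one (R r : ℝ) : plateau R r ≤ 1 := max_le zero_le_one (min_le_left _ _)

lemma plateau_eq_one {R r : ℝ} (hR : 0 < R) (h : |r| ≤ R) : plateau R r = 1 := by
  have : |r| / R ≤ 1 := (div_le_one hR).2 h
  rw [plateau, min_eq_left (by linarith), max_eq_right zero_le_one]

lemma plateau_eq_zero {R r : ℝ} (hR : 0 < R) (h : 2 * R ≤ |r|) : plateau R r = 0 := by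
  have : 2 ≤ |r| / R := (le_div_iff₀ hR).2 h
  rw [plateau, max_eq_left ((min_le_right _ _).trans (by linarith))]

lemma hasCompactSupport_of_abs_fst {S : Type*} [TopologicalSpace S] [CompactSpace S]
    [T2Space S] {f : ℝ × S → ℝ} (R : ℝ)
    (h : ∀ x : ℝ × S, R ≤ |x.1| → f x = 0) : HasCompactSupport f := by
  refine HasCompactSupport.intro (K := Icc (-R) R ×ˢ univ) (isCompact_Icc.prod isCompact_univ)
    fun x hx => h x ?_
  by_contra hlt
  exact hx ⟨abs_le.1 (not_le.1 hlt).le, mem_univ _⟩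

/-- The weight is at most |r|^(-p), so the factor R^p in the bound becomes a decay rate R^(-p). This
is the tightness of the weighted measures. -/
lemma PolarBound.withDensity_tail_le {S : Type*} [MeasurableSpace S] {p : ℝ} {M : ℝ≥0} {R₀ : ℝ}
    {m : ℕ → Measure (ℝ × S)} (hp : 0 ≤ p) (hR₀ : 1 ≤ R₀)
    (h : PolarBound p M R₀ m) {R : ℝ} (hR : R₀ < R) : ∀ᶠ k in atTop,
      (m k).withDensity (fun x => ENNReal.ofReal (polarWeight p x)) {x | R ≤ |x.1|} ≤
        M * ENNReal.ofReal (R ^ (-p)) := by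
  have hRpos : 0 < R := by linarith
  filter_upwards [h R hR] with k hk
  rw [withDensity_apply _ (measurableSet_le_abs_fst R)]
  calc _ ≤ ∫⁻ x in {x | R ≤ |x.1|}, ENNReal.ofReal (|x.1| ^ (-p)) ∂m k :=
        setLIntegral_mono' (measurableSet_le_abs_fst R) fun x hx =>
          ENNReal.ofReal_le_ofReal (polarWeight_le hp (hRpos.trans_le hx))
    _ = ENNReal.ofReal (R ^ p) * (∫⁻ x in {x | R ≤ |x.1|}, ENNReal.ofReal (|x.1| ^ (-p)) ∂m k) *
          ENNReal.ofReal (R ^ (-p)) := by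
        rw [mul_right_comm, ← ENNReal.ofReal_mul (by positivity), ← Real.rpow_add hRpos]
        simp
    _ ≤ _ := by gcongr; exact hk.2

lemma PolarBound.withDensity_univ_le {S : Type*} [MeasurableSpace S] {p : ℝ} {M : ℝ≥0} {R₀ : ℝ}
    {m : ℕ → Measure (ℝ × S)} (hp : 0 ≤ p) (hR₀ : 1 ≤ R₀)
    (h : PolarBound p M R₀ m) : ∀ᶠ k in atTop,
      (m k).withDensity (fun x => ENNReal.ofReal (polarWeight p x)) univ ≤ 2 * M := by
  filter_upwards [h (R₀ + 1) (by linarith), h.withDensity_tail_le hp hR₀ (R := R₀ + 1)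
    (by linarith)] with k hk1 hk2
  have hcov : (univ : Set (ℝ × S)) ⊆ {x | |x.1| < R₀ + 1} ∪ {x | R₀ + 1 ≤ |x.1|} :=
    fun x _ => lt_or_ge |x.1| (R₀ + 1)
  refine (measure_mono hcov).trans ((measure_union_le _ _).trans ?_)
  rw [two_mul]
  refine add_le_add ?_ (hk2.trans ?_)
  · rw [withDensity_apply _ (measurableSet_abs_fst_lt _)]
    refine le_trans (setLIntegral_mono' (measurableSet_abs_fst_lt _)
      (g := fun _ => 1) fun x _ => ?_) ?_
    · exact ENNReal.ofReal_le_one.2 (polarWeight_le_one hp x)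
    · simpa using hk1.1
  · refine mul_le_of_le_one_right zero_le (ENNReal.ofReal_le_one.2 ?_)
    exact Real.rpow_le_one_of_one_le_of_nonpos (by linarith) (by linarith)

variable {S : Type*} [MetricSpace S] [CompactSpace S] [MeasurableSpace S] [BorelSpace S]
  {p : ℝ} {M : ℝ≥0} {R₀ : ℝ}

/-- A bounded sequence of measures on `r > 0` can be completed to probability measures by a mass at
`r = -1`, after multiplication by the weight. -/
lemma exists_probabilityMeasure_subseq {m : ℕ → Measure (ℝ × S)} (hp : 1 ≤ p) (hR₀ : 1 ≤ R₀)
    (hM : 0 < M) (h : PolarBound p M R₀ m) (σ₀ : S) :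
    ∃ (φ : ℕ → ℕ) (P : ℕ → ProbabilityMeasure (ℝ × S)) (P' : ProbabilityMeasure (ℝ × S)),
      StrictMono φ ∧ Tendsto P atTop (𝓝 P') ∧
      ∀ k, ∃ c : ℝ≥0∞, (2 * M : ℝ≥0∞) • (P k : Measure (ℝ × S)) =
        (m (φ k)).withDensity (fun x => ENNReal.ofReal (polarWeight p x)) +
          c • Measure.dirac (-1, σ₀) := by
  have hp0 : 0 ≤ p := by linarith
  -- The mass bound holds only for large indices, so the first terms are discarded.
  obtain ⟨k₀, hk₀⟩ := eventually_atTop.1 (h.withDensity_univ_le hp0 hR₀)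
  set n : ℕ → Measure (ℝ × S) := fun k =>
    (m (k + k₀)).withDensity fun x => ENNReal.ofReal (polarWeight p x) with hn
  have hnC : ∀ k, n k univ ≤ 2 * M := fun k => hk₀ _ (by omega)
  have hC0 : (2 * M : ℝ≥0∞) ≠ 0 := by simp [hM.ne']
  have hCtop : (2 * M : ℝ≥0∞) ≠ ∞ := ENNReal.mul_ne_top (by simp) (by simp)
  -- The mass missing from 2M; placed at r = -1 it cannot interfere with measures living on r > 0.
  set c : ℕ → ℝ≥0∞ := fun k => 2 * M - n k univ
  let Q : ℕ → Measure (ℝ × S) := fun k =>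
    (2 * M : ℝ≥0∞)⁻¹ • (n k + c k • Measure.dirac (-1, σ₀))
  have hQ : ∀ k, IsProbabilityMeasure (Q k) := fun k => ⟨by
    simp only [Q, Measure.smul_apply, Measure.add_apply, measure_univ, smul_eq_mul, mul_one, c]
    rw [add_tsub_cancel_of_le (hnC k), ENNReal.inv_mul_cancel hC0 hCtop]⟩
  have hQn : ∀ k, (2 * M : ℝ≥0∞) • Q k = n k + c k • Measure.dirac (-1, σ₀) := fun k => by
    simp only [Q]
    rw [smul_smul, ENNReal.mul_inv_cancel hC0 hCtop, one_smul]
  -- The sphere factor is compact, so only radial escape matters; the added atom has radius 1 ≤ R₀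
  -- and never enters the tails.
  have htight : IsTightMeasureSet (range Q) := by
    refine IsTightMeasureSet.prodMk ?_ IsTightMeasureSet.of_compactSpace
    rw [← range_comp]
    have hfin : ∀ k, IsFiniteMeasure ((Measure.fst ∘ Q) k) := fun k => by
      simp only [Function.comp]; infer_instance
    refine isTightMeasureSet_range_of_tendsto_limsup_measure_norm_gt ?_
    have hbd : ∀ R : ℝ, R₀ < R → limsup (fun k => (Measure.fst ∘ Q) k {x | R < ‖x‖}) atTop ≤
        (2 * M : ℝ≥0∞)⁻¹ * (M * ENNReal.ofReal (R ^ (-p))) := by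
      intro R hR
      refine limsup_le_of_le (by isBoundedDefault) ?_
      filter_upwards [(tendsto_add_atTop_nat k₀).eventually
        (h.withDensity_tail_le hp0 hR₀ hR)] with k hk
      have hmeas : MeasurableSet {x : ℝ | R < ‖x‖} :=
        measurableSet_lt measurable_const (by fun_prop)
      simp only [Function.comp]
      rw [Measure.fst_apply hmeas]
      simp only [Q, Measure.smul_apply, Measure.add_apply, smul_eq_mul]
      have h1 : (Measure.dirac ((-1 : ℝ), σ₀)) (Prod.fst ⁻¹' {x : ℝ | R < ‖x‖}) = 0 := by
        rw [Measure.dirac_apply' _ (measurable_fst hmeas)]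
        refine indicator_of_notMem (fun hh => ?_) _
        have : R < 1 := by simpa using hh
        linarith
      rw [h1, mul_zero, add_zero]
      gcongr
      refine (measure_mono fun x hx => ?_).trans hk
      have hx' : R < |x.1| := hx
      exact hx'.le
    have hlim : Tendsto (fun R : ℝ => (2 * M : ℝ≥0∞)⁻¹ * (M * ENNReal.ofReal (R ^ (-p)))) atTop
        (𝓝 0) := by
      have h1 : Tendsto (fun R : ℝ => ENNReal.ofReal (R ^ (-p))) atTop (𝓝 0) := by
        rw [← ENNReal.ofReal_zero]
        exact ENNReal.tendsto_ofReal (tendsto_rpow_neg_atTop (by linarith))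
      have h2 := ENNReal.Tendsto.const_mul (a := (2 * M : ℝ≥0∞)⁻¹)
        (ENNReal.Tendsto.const_mul (a := (M : ℝ≥0∞)) h1 (Or.inr (by simp)))
        (Or.inr (ENNReal.inv_ne_top.2 hC0))
      simpa using h2
    refine tendsto_of_tendsto_of_tendsto_of_le_of_le' tendsto_const_nhds hlim
      (Eventually.of_forall fun _ => zero_le) ?_
    filter_upwards [eventually_gt_atTop R₀] with R hR using hbd R hR
  let P : ℕ → ProbabilityMeasure (ℝ × S) := fun k => ⟨Q k, hQ k⟩
  have hcomp : IsCompact (closure (range P)) := by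
    refine isCompact_closure_of_isTightMeasureSet (htight.subset ?_)
    rintro _ ⟨_, ⟨k, rfl⟩, rfl⟩
    exact ⟨k, rfl⟩
  obtain ⟨P', -, ψ, hψ, hlim⟩ := hcomp.isSeqCompact (x := P) fun k => subset_closure ⟨k, rfl⟩
  exact ⟨fun k => ψ k + k₀, P ∘ ψ, P', fun a b hab => by simpa using hψ hab, hlim,
    fun k => ⟨c (ψ k), hQn (ψ k)⟩⟩

/-- Compactness of bounded sequences of measures on `r > 0`. -/
theorem PolarBound.exists_subseq_tendsto {m : ℕ → Measure (ℝ × S)} (hp : 1 ≤ p) (hR₀ : 1 ≤ R₀)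
    (hM : 0 < M) (h : PolarBound p M R₀ m) (h0 : ∀ k, ∀ᵐ x ∂m k, 0 < x.1) (σ₀ : S) :
    ∃ (φ : ℕ → ℕ) (m' : Measure (ℝ × S)), StrictMono φ ∧ m' univ ≤ M ∧
      ∀ f : ℝ × S → ℝ, Continuous f → HasCompactSupport f → (∀ x, 0 ≤ f x) →
        Tendsto (fun k => ∫⁻ x, ENNReal.ofReal (f x) ∂m (φ k)) atTop
          (𝓝 (∫⁻ x, ENNReal.ofReal (f x) ∂m')) := by
  obtain ⟨φ, P, P', hφ, hlim, hP⟩ := exists_probabilityMeasure_subseq hp hR₀ hM h σ₀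
  -- A continuous cutoff equal to 1 on r > 0 and 0 at r = -1: it removes the auxiliary atom, while
  -- `d` also undoes the weight.
  let χ : ℝ → ℝ := fun r => max 0 (min 1 (1 + r))
  have hχc : Continuous χ := by fun_prop
  have hχ0 : ∀ r, 0 ≤ χ r := fun r => le_max_left _ _
  have hχ1 : ∀ r, 0 < r → χ r = 1 := fun r hr => by
    simp only [χ]; rw [min_eq_left (by linarith), max_eq_right zero_le_one]
  have hχm : χ (-1) = 0 := by simp [χ]
  have hw : Continuous (polarWeight p : ℝ × S → ℝ) := continuous_polarWeight
  let d : ℝ × S → ℝ := fun x => χ x.1 / polarWeight p x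
  have hd : Continuous d :=
    (hχc.comp continuous_fst).div hw fun x => (polarWeight_pos x).ne'
  have hd0 : ∀ x, 0 ≤ d x := fun x => div_nonneg (hχ0 _) (polarWeight_pos x).le
  have hdm : Measurable fun x => (2 * M : ℝ≥0∞) * ENNReal.ofReal (d x) :=
    hd.measurable.ennreal_ofReal.const_mul _
  set m' : Measure (ℝ × S) :=
    (P' : Measure (ℝ × S)).withDensity fun x => (2 * M : ℝ≥0∞) * ENNReal.ofReal (d x)
  have hconv : ∀ f : ℝ × S → ℝ, Continuous f → HasCompactSupport f → (∀ x, 0 ≤ f x) →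
      Tendsto (fun k => ∫⁻ x, ENNReal.ofReal (f x) ∂m (φ k)) atTop
        (𝓝 (∫⁻ x, ENNReal.ofReal (f x) ∂m')) := by
    intro f hf hfc hf0
    let g : ℝ × S → ℝ := fun x => d x * f x
    have hg : Continuous g := hd.mul hf
    have hg0 : ∀ x, 0 ≤ g x := fun x => mul_nonneg (hd0 x) (hf0 x)
    have hgm : Measurable fun x => ENNReal.ofReal (g x) := hg.measurable.ennreal_ofReal
    obtain ⟨C, hC⟩ := (hfc.mul_left (f := d)).exists_bound_of_continuous hg
    have h1 := (ProbabilityMeasure.tendsto_iff_forall_lintegral_tendsto.1 hlim)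
      (BoundedContinuousFunction.ofNormedAddCommGroup g hg C hC).nnrealPart
    have h2 : Tendsto (fun k => ∫⁻ x, ENNReal.ofReal (g x) ∂(P k : Measure (ℝ × S))) atTop
        (𝓝 (∫⁻ x, ENNReal.ofReal (g x) ∂(P' : Measure (ℝ × S)))) := h1
    have h3 := ENNReal.Tendsto.const_mul (a := (2 * M : ℝ≥0∞)) h2
      (Or.inr (ENNReal.mul_ne_top (by simp) (by simp)))
    have h4 : ∫⁻ x, ENNReal.ofReal (f x) ∂m' =
        2 * M * ∫⁻ x, ENNReal.ofReal (g x) ∂(P' : Measure (ℝ × S)) := by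
      rw [lintegral_withDensity_eq_lintegral_mul _ hdm hf.measurable.ennreal_ofReal,
        ← lintegral_const_mul _ hgm]
      refine lintegral_congr fun x => ?_
      simp only [Pi.mul_apply, g]
      rw [ENNReal.ofReal_mul (hd0 x), mul_assoc]
    rw [h4]
    refine h3.congr fun k => ?_
    obtain ⟨c, hc⟩ := hP k
    have hw' : Measurable fun x : ℝ × S => ENNReal.ofReal (polarWeight p x) :=
      hw.measurable.ennreal_ofReal
    have hg1 : g (-1, σ₀) = 0 := by simp [g, d, hχm]
    rw [← smul_eq_mul, ← lintegral_smul_measure, hc, lintegral_add_measure,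
      lintegral_smul_measure, lintegral_dirac' _ hgm, hg1, ENNReal.ofReal_zero, smul_zero, add_zero,
      lintegral_withDensity_eq_lintegral_mul _ hw' hgm]
    refine lintegral_congr_ae ?_
    filter_upwards [h0 (φ k)] with x hx
    rw [Pi.mul_apply, ← ENNReal.ofReal_mul (polarWeight_pos x).le]
    congr 1
    have := (polarWeight_pos (p := p) x).ne'
    simp only [g, d, hχ1 x.1 hx]
    field_simp
  refine ⟨φ, m', hφ, ?_, hconv⟩
  -- M does not depend on R, so letting R grow bounds the total mass: nothing worse than M survives
  -- at infinity.
  have hball : ∀ R, R₀ < R → m' {x | |x.1| < R} ≤ M := by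
    intro R hR
    have hRpos : 0 < R := by linarith
    have hc := hconv (fun x => plateau R x.1) ((continuous_plateau R).comp continuous_fst)
      (hasCompactSupport_of_abs_fst (2 * R) fun x hx => plateau_eq_zero hRpos hx)
      fun x => plateau_nonneg _ _
    have hle : ∫⁻ x, ENNReal.ofReal (plateau R x.1) ∂m' ≤ M := by
      refine le_of_tendsto hc ?_
      filter_upwards [hφ.tendsto_atTop.eventually (h (2 * R) (by linarith))] with k hk
      refine le_trans ?_ hk.1
      rw [← lintegral_indicator_one (measurableSet_abs_fst_lt _)]
      refine lintegral_mono fun x => ?_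
      by_cases hx : |x.1| < 2 * R
      · rw [indicator_of_mem (by exact hx)]
        exact ENNReal.ofReal_le_one.2 (plateau_le_one _ _)
      · rw [plateau_eq_zero hRpos (not_lt.1 hx)]; simp
    refine le_trans ?_ hle
    rw [← lintegral_indicator_one (measurableSet_abs_fst_lt _)]
    refine lintegral_mono fun x => ?_
    by_cases hx : |x.1| < R
    · rw [plateau_eq_one hRpos hx.le]
      simpa using indicator_le_self' (f := (1 : ℝ × S → ℝ≥0∞)) (fun _ _ => zero_le) x
    · rw [indicator_of_notMem (by exact hx)]; exact zero_le
  have hmono : Monotone fun n : ℕ => {x : ℝ × S | |x.1| < n} := fun a b hab x hx => by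
    have hx' : |x.1| < a := hx
    exact hx'.trans_le (by exact_mod_cast hab)
  have hU : ⋃ n : ℕ, {x : ℝ × S | |x.1| < n} = univ := by
    refine eq_univ_of_forall fun x => ?_
    obtain ⟨n, hn⟩ := exists_nat_gt |x.1|
    exact mem_iUnion.2 ⟨n, hn⟩
  have ht := tendsto_measure_iUnion_atTop (μ := m') hmono
  rw [hU] at ht
  refine le_of_tendsto ht ?_
  obtain ⟨n₀, hn₀⟩ := exists_nat_gt R₀
  filter_upwards [eventually_ge_atTop n₀] with n hn
  exact hball n (hn₀.trans_le (by exact_mod_cast hn))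

end PolarLimit

/-! ### The kernels in polar coordinates -/

section Polar

variable {N : ℕ} {p : ℝ} {σ₀ : SphereN N} {r : RN N → ℝ}

lemma norm_sphereN (σ : SphereN N) : ‖(σ : RN N)‖ = 1 := by simp

open Classical in
/-- The direction of `z`, with an arbitrary value at the origin. -/
def unitVec (σ₀ : SphereN N) (z : RN N) : SphereN N :=
  if h : z = 0 then σ₀ else ⟨‖z‖⁻¹ • z, by
    rw [mem_sphere_zero_iff_norm, norm_smul, norm_inv, norm_norm,
      inv_mul_cancel₀ (norm_ne_zero_iff.2 h)]⟩

/-- Polar coordinates. -/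
def polar (σ₀ : SphereN N) (z : RN N) : ℝ × SphereN N := (‖z‖, unitVec σ₀ z)

/-- The point with given polar coordinates. -/
def cart (x : ℝ × SphereN N) : RN N := x.1 • (x.2 : RN N)

lemma continuous_cart : Continuous (cart : ℝ × SphereN N → RN N) := by
  unfold cart; fun_prop

lemma norm_cart (x : ℝ × SphereN N) : ‖cart x‖ = |x.1| := by
  simp [cart, norm_smul]

lemma cart_polar (z : RN N) : cart (polar σ₀ z) = z := by
  by_cases h : z = 0
  · simp [cart, polar, h]
  · simp only [cart, polar, unitVec, dif_neg h]
    rw [smul_smul, mul_inv_cancel₀ (norm_ne_zero_iff.2 h), one_smul]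

lemma measurable_polar : Measurable (polar σ₀) := by
  refine measurable_norm.prodMk ?_
  rw [← (MeasurableEmbedding.subtype_coe
    Metric.isClosed_sphere.measurableSet).measurable_comp_iff]
  have : (Subtype.val ∘ unitVec σ₀ : RN N → RN N) =
      fun z => ({0} : Set (RN N)).piecewise (fun _ => (σ₀ : RN N)) (fun z => ‖z‖⁻¹ • z) z := by
    ext1 z
    by_cases h : z = 0
    · simp [unitVec, h]
    · simp [unitVec, h]
  rw [this]
  exact Measurable.piecewise (measurableSet_singleton 0) measurable_const
    (measurable_norm.inv.smul measurable_id)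

/-- The measure of density `r`, in polar coordinates. -/
def polarKernel (σ₀ : SphereN N) (r : RN N → ℝ) : Measure (ℝ × SphereN N) :=
  (kernelMeasure r).map (polar σ₀)

lemma setLIntegral_polarKernel {f : ℝ × SphereN N → ℝ≥0∞} (hf : Measurable f)
    {A : Set (ℝ × SphereN N)} (hA : MeasurableSet A) :
    ∫⁻ x in A, f x ∂polarKernel σ₀ r =
      ∫⁻ z in polar σ₀ ⁻¹' A, f (polar σ₀ z) ∂kernelMeasure r :=
  setLIntegral_map hA hf measurable_polar

lemma lintegral_polarKernel_comp_cart {f : RN N → ℝ≥0∞} (hf : Measurable f) :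
    ∫⁻ x, f (cart x) ∂polarKernel σ₀ r = ∫⁻ z, f z ∂kernelMeasure r := by
  refine (lintegral_map (hf.comp continuous_cart.measurable) measurable_polar).trans ?_
  simp only [Function.comp, cart_polar]

lemma aemeasurable_ofReal_of_locallyIntegrable (hr : LocallyIntegrable r volume) :
    AEMeasurable (fun z => ENNReal.ofReal (r z)) volume :=
  hr.aestronglyMeasurable.aemeasurable.ennreal_ofReal

lemma bbmEnergy_eq_lintegral_polarKernel (hp : 1 ≤ p) (hr : LocallyIntegrable r volume)
    {u : RN N → ℝ} (hu : MemLp u (ENNReal.ofReal p) volume) :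
    bbmEnergy p r u = ∫⁻ x, diffQuot p u (cart x) ∂polarKernel σ₀ r := by
  have hm := measurable_diffQuot hp hu
  rw [lintegral_polarKernel_comp_cart hm, kernelMeasure, lintegral_withDensity_eq_lintegral_mul₀
    (aemeasurable_ofReal_of_locallyIntegrable hr) hm.aemeasurable, bbmEnergy]
  simp only [Pi.mul_apply, mul_comm]

lemma ae_polarKernel_pos (hN : 1 ≤ N) : ∀ᵐ x ∂polarKernel σ₀ r, 0 < x.1 := by
  have : Nonempty (Fin N) := ⟨⟨0, hN⟩⟩
  rw [polarKernel, ae_map_iff measurable_polar.aemeasurable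
    (measurableSet_lt measurable_const measurable_fst)]
  refine (withDensity_absolutelyContinuous volume _).ae_le ?_
  have hne : ∀ᵐ z ∂(volume : Measure (RN N)), z ≠ 0 := by
    rw [ae_iff]; simp
  filter_upwards [hne] with z hz using norm_pos_iff.2 hz

lemma isFiniteMeasureOnCompacts_kernelMeasure (hr : LocallyIntegrable r volume) :
    IsFiniteMeasureOnCompacts (kernelMeasure r) := by
  refine ⟨fun K hK => ?_⟩
  rw [kernelMeasure, withDensity_apply _ hK.measurableSet]
  have h := (hr.integrableOn_isCompact hK).2
  refine lt_of_le_of_lt (lintegral_mono fun z => ?_) h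
  rw [← ofReal_norm]
  exact ENNReal.ofReal_le_ofReal (le_abs_self _)

lemma polarKernel_abs_fst_lt (R : ℝ) : polarKernel σ₀ r {x | |x.1| < R} =
    ∫⁻ z in Metric.ball 0 R, ENNReal.ofReal (r z) := by
  rw [polarKernel, Measure.map_apply measurable_polar (measurableSet_abs_fst_lt R), kernelMeasure,
    withDensity_apply _ (measurable_polar (measurableSet_abs_fst_lt R))]
  congr 2
  ext z; simp [polar]

lemma setLIntegral_polarKernel_tail (hr : LocallyIntegrable r volume) (R : ℝ) :
    ∫⁻ x in {x | R ≤ |x.1|}, ENNReal.ofReal (|x.1| ^ (-p)) ∂polarKernel σ₀ r =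
      ∫⁻ z in (Metric.ball 0 R)ᶜ, ENNReal.ofReal (r z / ‖z‖ ^ p) := by
  have hm : Measurable fun x : ℝ × SphereN N => ENNReal.ofReal (|x.1| ^ (-p)) := by fun_prop
  have hset : polar σ₀ ⁻¹' {x | R ≤ |x.1|} = (Metric.ball (0 : RN N) R)ᶜ := by
    ext z; simp [polar]
  have hm2 : Measurable fun z : RN N => ENNReal.ofReal (‖z‖ ^ (-p)) := by fun_prop
  rw [setLIntegral_polarKernel hm (measurableSet_le_abs_fst R), hset, kernelMeasure,
    restrict_withDensity Metric.isOpen_ball.measurableSet.compl]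
  simp only [polar, abs_norm]
  rw [lintegral_withDensity_eq_lintegral_mul₀
    (aemeasurable_ofReal_of_locallyIntegrable hr).restrict hm2.aemeasurable]
  refine lintegral_congr fun z => ?_
  rw [Pi.mul_apply, mul_comm, ← ENNReal.ofReal_mul (Real.rpow_nonneg (norm_nonneg _) _),
    Real.rpow_neg (norm_nonneg _), div_eq_inv_mul]

lemma EventualKernelBound.exists_seq {J : Set ℝ} {ρ : ℝ → RN N → ℝ}
    (h : EventualKernelBound p J ρ) (hJ0 : (0 : ℝ) ∈ closure J)
    (hρ : ∀ t ∈ J, LocallyIntegrable (ρ t) volume) (σ₀ : SphereN N) :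
    ∃ (t : ℕ → ℝ) (M : ℝ≥0) (R₀ : ℝ), (∀ k, t k ∈ J) ∧ Tendsto t atTop (𝓝[J] 0) ∧
      0 < M ∧ 1 ≤ R₀ ∧ PolarBound p M R₀ fun k => polarKernel σ₀ (ρ (t k)) := by
  have hne : (𝓝[J] (0 : ℝ)).NeBot := mem_closure_iff_nhdsWithin_neBot.1 hJ0
  obtain ⟨s, hs⟩ := exists_seq_tendsto (𝓝[J] (0 : ℝ))
  obtain ⟨n, hn⟩ := eventually_atTop.1 (hs.eventually self_mem_nhdsWithin)
  obtain ⟨M, hM, R₀, hR₀, hb⟩ := h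
  have ht : Tendsto (fun k => s (k + n)) atTop (𝓝[J] 0) := hs.comp (tendsto_add_atTop_nat n)
  have htJ : ∀ k, s (k + n) ∈ J := fun k => hn _ (by omega)
  -- Adding 1 makes the constant strictly positive, as needed to normalise to probability measures.
  have hM1 : M ≤ ((M.toNNReal + 1 : ℝ≥0) : ℝ≥0∞) := by
    rw [ENNReal.coe_add, ENNReal.coe_toNNReal hM]; exact le_self_add
  refine ⟨fun k => s (k + n), M.toNNReal + 1, R₀, htJ, ht, by positivity, hR₀, fun R hR => ?_⟩
  filter_upwards [ht.eventually (hb R hR)] with k hk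
  rw [polarKernel_abs_fst_lt, setLIntegral_polarKernel_tail (hρ _ (htJ k))]
  exact ⟨hk.1.trans hM1, hk.2.trans hM1⟩

end Polar

/-! ### The limit functional in polar coordinates -/

section LimitFunctional

variable {N : ℕ} {p : ℝ}

/-- Convergence of the integrals of non-negative functions in `C_c(ℝ × 𝕊)`. -/
def PolarConv (m : ℕ → Measure (ℝ × SphereN N)) (m' : Measure (ℝ × SphereN N)) : Prop :=
  ∀ f : ℝ × SphereN N → ℝ, Continuous f → HasCompactSupport f → (∀ x, 0 ≤ f x) →
    Tendsto (fun k => ∫⁻ x, ENNReal.ofReal (f x) ∂m k) atTop (𝓝 (∫⁻ x, ENNReal.ofReal (f x) ∂m'))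

/-- The part of the limit measure at `r = 0`, on the sphere. -/
def sphericalPart (m' : Measure (ℝ × SphereN N)) : Measure (SphereN N) :=
  (m'.restrict {x | x.1 = 0}).map Prod.snd

lemma measurableSet_fst_eq_zero : MeasurableSet {x : ℝ × SphereN N | x.1 = 0} :=
  measurable_fst (measurableSet_singleton 0)

lemma hasCompactSupport_comp_cart {f : RN N → ℝ} (hfc : HasCompactSupport f) :
    HasCompactSupport (f ∘ cart) := by
  obtain ⟨R, hR⟩ := hfc.isCompact.isBounded.subset_closedBall 0
  refine hasCompactSupport_of_abs_fst (R + 1) fun x hx => ?_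
  refine image_eq_zero_of_notMem_tsupport (f := f) fun h => ?_
  have h1 := hR h
  rw [mem_closedBall_zero_iff, norm_cart] at h1
  linarith

/-- Test with f ∘ `cart`, which is compactly supported since the sphere is compact. Positive and
negative parts are treated separately, because `PolarConv` concerns non-negative functions. -/
lemma PolarConv.weakStarLoc {σ₀ : SphereN N} {r : ℕ → RN N → ℝ}
    {m' : Measure (ℝ × SphereN N)} [IsFiniteMeasure m']
    (h : PolarConv (fun k => polarKernel σ₀ (r k)) m')
    (hr : ∀ k, LocallyIntegrable (r k) volume) :
    WeakStarLoc (fun k => kernelMeasure (r k)) (m'.map cart) := by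
  have key : ∀ f : RN N → ℝ, Continuous f → HasCompactSupport f →
      Tendsto (fun k => (∫⁻ z, ENNReal.ofReal (f z) ∂kernelMeasure (r k)).toReal) atTop
        (𝓝 (∫⁻ z, ENNReal.ofReal (f z) ∂(m'.map cart)).toReal) := by
    intro f hf hfc
    have hm : Measurable fun z => ENNReal.ofReal (f z) := hf.measurable.ennreal_ofReal
    have hfin := hf.integrable_of_hasCompactSupport hfc (μ := m'.map cart)
    refine (ENNReal.tendsto_toReal ?_).comp ?_
    · refine ne_top_of_le_ne_top hfin.2.ne (lintegral_mono fun z => ?_)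
      rw [← ofReal_norm]
      exact ENNReal.ofReal_le_ofReal (le_abs_self _)
    · have h1 := h (fun x => max (f (cart x)) 0) ((hf.comp continuous_cart).max continuous_const)
        ((hasCompactSupport_comp_cart hfc).comp_left (g := fun y => max y 0) (by simp))
        fun x => le_max_right _ _
      have h2 : ∀ x : ℝ × SphereN N, ENNReal.ofReal (max (f (cart x)) 0) =
          ENNReal.ofReal (f (cart x)) := fun x => by simp
      simp_rw [h2, lintegral_polarKernel_comp_cart hm] at h1
      rwa [lintegral_map hm continuous_cart.measurable]
  intro f hf hfc
  have h1 := (key f hf hfc).sub (key (fun z => -f z) hf.neg hfc.neg)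
  rw [← integral_eq_lintegral_pos_part_sub_lintegral_neg_part
    (hf.integrable_of_hasCompactSupport hfc)] at h1
  refine h1.congr fun k => ?_
  have := isFiniteMeasureOnCompacts_kernelMeasure (hr k)
  rw [← integral_eq_lintegral_pos_part_sub_lintegral_neg_part
    (hf.integrable_of_hasCompactSupport hfc)]

open Classical in
-- The fibre r = 0 is exactly the preimage of the origin. It may give ν an atom at 0, which the
-- nonlocal term ignores and μ records direction by direction.
lemma limitEnergy_eq_lintegral (hp : 1 ≤ p) {u : RN N → ℝ} (hu : u ∈ SobBV N p)
    (m' : Measure (ℝ × SphereN N)) :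
    limitEnergy p (sphericalPart m') (m'.map cart) u =
      ∫⁻ x, (if x.1 = 0 then dirSeminormPow p u (x.2 : RN N) else diffQuot p u (cart x)) ∂m' := by
  obtain ⟨e, he, -, hepow, -⟩ := exists_dirSeminorm hp hu
  have hm : Measurable fun σ : SphereN N => dirSeminormPow p u (σ : RN N) := by
    simp_rw [hepow]
    have h1 : Measurable fun σ : SphereN N => e (σ : RN N) :=
      (he.comp continuous_subtype_val).measurable
    exact (h1.pow_const p).ennreal_ofReal
  have hset : cart ⁻¹' ({0}ᶜ : Set (RN N)) = {x : ℝ × SphereN N | x.1 = 0}ᶜ := by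
    ext x
    simp only [mem_preimage, mem_compl_iff, mem_singleton_iff, mem_ofPred_eq]
    rw [← norm_eq_zero, norm_cart, abs_eq_zero]
  rw [limitEnergy, if_pos hu, sphericalPart, lintegral_map hm measurable_snd,
    setLIntegral_map (measurableSet_singleton 0).compl (measurable_diffQuot hp hu.1)
      continuous_cart.measurable, hset]
  refine Eq.trans ?_ (lintegral_add_compl _ measurableSet_fst_eq_zero)
  congr 1
  · exact setLIntegral_congr_fun measurableSet_fst_eq_zero fun x hx => by
      have hx' : x.1 = 0 := hx
      simp [hx']
  · exact setLIntegral_congr_fun measurableSet_fst_eq_zero.compl fun x hx => by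
      have hx' : ¬ x.1 = 0 := hx
      simp [hx']

end LimitFunctional

/-! ### The upper bound -/

section Limsup

variable {N : ℕ} {p : ℝ} {u : RN N → ℝ}

/-- The difference quotient in polar coordinates, with the denominator bounded below by `d`. -/
def truncQuot (p : ℝ) (u : RN N → ℝ) (d η : ℝ) (x : ℝ × SphereN N) : ℝ :=
  max (incrNorm p u (cart x) - η) 0 / max |x.1| d

lemma truncQuot_nonneg {d η : ℝ} (hd : 0 < d) (x : ℝ × SphereN N) : 0 ≤ truncQuot p u d η x :=
  div_nonneg (le_max_right _ _) (hd.le.trans (le_max_right _ _))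

lemma continuous_truncQuot (hp : 1 ≤ p) (hu : MemLp u (ENNReal.ofReal p) volume) {d : ℝ}
    (hd : 0 < d) (η : ℝ) : Continuous (truncQuot p u d η) := by
  unfold truncQuot
  refine Continuous.div ?_ (by fun_prop) fun x => (hd.trans_le (le_max_right _ _)).ne'
  exact ((((continuous_incrNorm hp hu).comp continuous_cart).sub continuous_const).max
    continuous_const)

lemma diffQuot_cart (hp : 1 ≤ p) (hu : MemLp u (ENNReal.ofReal p) volume) (x : ℝ × SphereN N) :
    diffQuot p u (cart x) = ENNReal.ofReal ((incrNorm p u (cart x) / |x.1|) ^ p) := by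
  rw [diffQuot_eq hp hu, norm_cart]

/-- The interpolation between `a` near `r = 0` and `b` away from `r = 0`, cut off at infinity. -/
def cutBlend (p R d : ℝ) (a b : ℝ × SphereN N → ℝ) (x : ℝ × SphereN N) : ℝ :=
  plateau R x.1 * (plateau d x.1 * a x ^ p + (1 - plateau d x.1) * b x ^ p)

lemma continuous_cutBlend (hp : 1 ≤ p) (R d : ℝ) {a b : ℝ × SphereN N → ℝ} (ha : Continuous a)
    (hb : Continuous b) : Continuous (cutBlend p R d a b) := by
  have h1 := (continuous_plateau R).comp (continuous_fst (X := ℝ) (Y := SphereN N))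
  have h2 := (continuous_plateau d).comp (continuous_fst (X := ℝ) (Y := SphereN N))
  have hp0 : 0 ≤ p := by linarith
  exact h1.mul ((h2.mul (ha.rpow_const fun _ => Or.inr hp0)).add
    ((continuous_const.sub h2).mul (hb.rpow_const fun _ => Or.inr hp0)))

lemma cutBlend_nonneg {R d : ℝ} {a b : ℝ × SphereN N → ℝ} (ha : ∀ x, 0 ≤ a x)
    (hb : ∀ x, 0 ≤ b x) (x : ℝ × SphereN N) : 0 ≤ cutBlend p R d a b x :=
  mul_nonneg (plateau_nonneg _ _) (add_nonneg
    (mul_nonneg (plateau_nonneg _ _) (Real.rpow_nonneg (ha x) _))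
    (mul_nonneg (sub_nonneg.2 (plateau_le_one _ _)) (Real.rpow_nonneg (hb x) _)))

lemma hasCompactSupport_cutBlend {R : ℝ} (hR : 0 < R) (d : ℝ) (a b : ℝ × SphereN N → ℝ) :
    HasCompactSupport (cutBlend p R d a b) :=
  hasCompactSupport_of_abs_fst (2 * R) fun x hx => by
    rw [cutBlend, plateau_eq_zero hR hx, zero_mul]

/-- A convex combination times a factor at most 1: each of a and b needs to be bounded only where
its coefficient can be nonzero. -/
lemma cutBlend_le {R d C : ℝ} {a b : ℝ × SphereN N → ℝ} {x : ℝ × SphereN N} (hp : 0 ≤ p)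
    (hd : 0 < d) (hC : 0 ≤ C) (ha0 : 0 ≤ a x) (hb0 : 0 ≤ b x) (ha : |x.1| < 2 * d → a x ≤ C)
    (hb : d < |x.1| → b x ≤ C) : cutBlend p R d a b x ≤ C ^ p := by
  have h1 : plateau d x.1 * a x ^ p ≤ plateau d x.1 * C ^ p := by
    rcases lt_or_ge |x.1| (2 * d) with h | h
    · exact mul_le_mul_of_nonneg_left (Real.rpow_le_rpow ha0 (ha h) hp) (plateau_nonneg _ _)
    · rw [plateau_eq_zero hd h]; simp
  have h2 : (1 - plateau d x.1) * b x ^ p ≤ (1 - plateau d x.1) * C ^ p := by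
    rcases lt_or_ge d |x.1| with h | h
    · exact mul_le_mul_of_nonneg_left (Real.rpow_le_rpow hb0 (hb h) hp)
        (sub_nonneg.2 (plateau_le_one _ _))
    · rw [plateau_eq_one hd h]; simp
  have hCp : 0 ≤ C ^ p := Real.rpow_nonneg hC p
  refine (mul_le_mul_of_nonneg_left (add_le_add h1 h2) (plateau_nonneg R x.1)).trans ?_
  rw [← add_mul, add_sub_cancel, one_mul]
  exact mul_le_of_le_one_left hCp (plateau_le_one _ _)

/-- Pointwise limits of blends, as the inner radius shrinks and the outer radius grows. -/
lemma tendsto_cutBlend {R d : ℕ → ℝ} {a b : ℕ → ℝ × SphereN N → ℝ} {α β : ℝ} (hp : 0 ≤ p)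
    (hR : Tendsto R atTop atTop) (hd : Tendsto d atTop (𝓝 0)) (hdpos : ∀ j, 0 < d j)
    {x : ℝ × SphereN N}
    (ha : x.1 = 0 → Tendsto (fun j => a j x) atTop (𝓝 α))
    (hb : x.1 ≠ 0 → Tendsto (fun j => b j x) atTop (𝓝 β)) :
    Tendsto (fun j => cutBlend p (R j) (d j) (a j) (b j) x) atTop
      (𝓝 (if x.1 = 0 then α ^ p else β ^ p)) := by
  have hR1 : ∀ᶠ j in atTop, plateau (R j) x.1 = 1 := by
    filter_upwards [hR.eventually_ge_atTop |x.1|, hR.eventually_gt_atTop 0] with j h1 h2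
    exact plateau_eq_one h2 h1
  by_cases hx : x.1 = 0
  · rw [if_pos hx]
    refine ((ha hx).rpow_const (Or.inr hp)).congr' ?_
    filter_upwards [hR1] with j hj
    rw [cutBlend, hj, plateau_eq_one (hdpos j) (by rw [hx, abs_zero]; exact (hdpos j).le)]
    ring
  · rw [if_neg hx]
    refine ((hb hx).rpow_const (Or.inr hp)).congr' ?_
    have hsmall : ∀ᶠ j in atTop, d j < |x.1| / 2 :=
      hd.eventually (gt_mem_nhds (half_pos (abs_pos.2 hx)))
    filter_upwards [hR1, hsmall] with j hj hj'
    rw [cutBlend, hj, plateau_eq_zero (hdpos j) (by linarith)]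
    ring

lemma tendsto_truncQuot {d η : ℕ → ℝ} (hd : Tendsto d atTop (𝓝 0)) (hη : Tendsto η atTop (𝓝 0))
    {x : ℝ × SphereN N} (hx : x.1 ≠ 0) :
    Tendsto (fun j => truncQuot p u (d j) (η j) x) atTop (𝓝 (incrNorm p u (cart x) / |x.1|)) := by
  have h1 : Tendsto (fun j => max (incrNorm p u (cart x) - η j) 0) atTop
      (𝓝 (incrNorm p u (cart x))) := by
    have := ((tendsto_const_nhds (x := incrNorm p u (cart x))).sub hη).max
      (tendsto_const_nhds (x := (0 : ℝ)))
    rwa [sub_zero, max_eq_left (incrNorm_nonneg _)] at this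
  have h2 : Tendsto (fun j => max |x.1| (d j)) atTop (𝓝 |x.1|) := by
    have := (tendsto_const_nhds (x := |x.1|)).max hd
    rwa [max_eq_left (abs_nonneg _)] at this
  exact h1.div h2 (abs_pos.2 hx).ne'

/-- Within radius R the quotient is at most e(σ), and equals the truncated quotient once |r| > d;
beyond R the increment is at most 2‖u‖. -/
lemma diffQuot_cart_le_cutBlend_add (hp : 1 ≤ p) (hu : MemLp u (ENNReal.ofReal p) volume)
    {e : RN N → ℝ} (he : ∀ (σ : RN N) (r : ℝ), incrNorm p u (r • σ) ≤ e σ * |r|) {R d : ℝ}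
    (hR : 0 < R) (hd : 0 < d) {x : ℝ × SphereN N} (hx : 0 < x.1) :
    diffQuot p u (cart x) ≤
      ENNReal.ofReal (cutBlend p R d (fun x => e (x.2 : RN N)) (truncQuot p u d 0) x) +
      {x : ℝ × SphereN N | R ≤ |x.1|}.indicator (fun x =>
        ENNReal.ofReal ((2 * (eLpNorm u (ENNReal.ofReal p) volume).toReal) ^ p) *
          ENNReal.ofReal (|x.1| ^ (-p))) x := by
  have hp0 : 0 ≤ p := by linarith
  have hx' : 0 < |x.1| := abs_pos.2 hx.ne'
  rw [diffQuot_cart hp hu]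
  rcases le_or_gt R |x.1| with h | h
  · refine le_trans ?_ le_add_self
    rw [indicator_of_mem (by exact h), ← ENNReal.ofReal_mul (by positivity),
      Real.rpow_neg (abs_nonneg _), ← div_eq_mul_inv, ← Real.div_rpow (by positivity) hx'.le]
    refine ENNReal.ofReal_le_ofReal (Real.rpow_le_rpow ?_ ?_ hp0)
    · exact div_nonneg (incrNorm_nonneg _) hx'.le
    · exact div_le_div_of_nonneg_right (incrNorm_le_two_mul hp hu _) hx'.le
  · refine le_trans (ENNReal.ofReal_le_ofReal ?_) le_self_add
    set q := incrNorm p u (cart x) / |x.1|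
    have hq0 : 0 ≤ q := div_nonneg (incrNorm_nonneg _) hx'.le
    have hqe : q ≤ e (x.2 : RN N) := by
      rw [div_le_iff₀ hx']; exact he _ _
    rw [cutBlend, plateau_eq_one hR h.le, one_mul]
    have h1 : plateau d x.1 * q ^ p ≤ plateau d x.1 * e (x.2 : RN N) ^ p :=
      mul_le_mul_of_nonneg_left (Real.rpow_le_rpow hq0 hqe hp0) (plateau_nonneg _ _)
    have h2 : (1 - plateau d x.1) * q ^ p = (1 - plateau d x.1) * truncQuot p u d 0 x ^ p := by
      rcases lt_or_ge d |x.1| with h | h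
      · rw [truncQuot, max_eq_left h.le, sub_zero, max_eq_left (incrNorm_nonneg _)]
      · rw [plateau_eq_one hd h]; simp
    linarith

open Classical in
-- The quotient has no continuous extension to r = 0 to test against, so it is majorised by a
-- continuous blend that uses e(σ) there, plus a tail controlled by `PolarBound`.
theorem PolarConv.limsup_le {m : ℕ → Measure (ℝ × SphereN N)} {m' : Measure (ℝ × SphereN N)}
    [IsFiniteMeasure m'] {M : ℝ≥0} {R₀ : ℝ} (h : PolarConv m m') (hp : 1 ≤ p)
    (hb : PolarBound p M R₀ m) (h0 : ∀ k, ∀ᵐ x ∂m k, 0 < x.1) (hu : u ∈ SobBV N p) :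
    limsup (fun k => ∫⁻ x, diffQuot p u (cart x) ∂m k) atTop ≤
      ∫⁻ x, (if x.1 = 0 then dirSeminormPow p u (x.2 : RN N) else diffQuot p u (cart x)) ∂m' := by
  have hp0 : 0 ≤ p := by linarith
  obtain ⟨e, hec, he0, hepow, he, -⟩ := exists_dirSeminorm hp hu
  set K := ENNReal.ofReal ((2 * (eLpNorm u (ENNReal.ofReal p) volume).toReal) ^ p)
  have hec' : Continuous fun x : ℝ × SphereN N => e (x.2 : RN N) :=
    hec.comp (continuous_subtype_val.comp continuous_snd)
  let G : ℝ → ℝ → ℝ × SphereN N → ℝ := fun R d =>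
    cutBlend p R d (fun x => e (x.2 : RN N)) (truncQuot p u d 0)
  have hGc : ∀ R d, 0 < d → Continuous (G R d) := fun R d hd =>
    continuous_cutBlend hp R d hec' (continuous_truncQuot hp hu.1 hd 0)
  have hG0 : ∀ R d, 0 < d → ∀ x, 0 ≤ G R d x := fun R d hd =>
    cutBlend_nonneg (fun x => he0 _) (truncQuot_nonneg hd)
  have hbound : ∀ R d, R₀ < R → 0 < R → 0 < d →
      limsup (fun k => ∫⁻ x, diffQuot p u (cart x) ∂m k) atTop ≤
        ∫⁻ x, ENNReal.ofReal (G R d x) ∂m' + K * (M * ENNReal.ofReal (R ^ (-p))) := by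
    intro R d hR hRpos hd
    have hlim := h (G R d) (hGc R d hd) (hasCompactSupport_cutBlend hRpos _ _ _) (hG0 R d hd)
    have hlim' := hlim.add (tendsto_const_nhds (x := K * (M * ENNReal.ofReal (R ^ (-p)))))
    rw [← hlim'.limsup_eq]
    refine limsup_le_limsup ?_ (by isBoundedDefault) (by isBoundedDefault)
    filter_upwards [hb R hR] with k hk
    have htm : Measurable fun x : ℝ × SphereN N => ENNReal.ofReal (|x.1| ^ (-p)) := by fun_prop
    calc ∫⁻ x, diffQuot p u (cart x) ∂m k
        ≤ ∫⁻ x, (ENNReal.ofReal (G R d x) + {x : ℝ × SphereN N | R ≤ |x.1|}.indicator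
            (fun x => K * ENNReal.ofReal (|x.1| ^ (-p))) x) ∂m k := by
          refine lintegral_mono_ae ?_
          filter_upwards [h0 k] with x hx
          exact diffQuot_cart_le_cutBlend_add hp hu.1 he hRpos hd hx
      _ = ∫⁻ x, ENNReal.ofReal (G R d x) ∂m k +
            K * ∫⁻ x in {x | R ≤ |x.1|}, ENNReal.ofReal (|x.1| ^ (-p)) ∂m k := by
          rw [lintegral_add_left (hGc R d hd).measurable.ennreal_ofReal,
            lintegral_indicator (measurableSet_le_abs_fst R), lintegral_const_mul _ htm]
      _ ≤ _ := by
          gcongr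
          calc _ = ENNReal.ofReal (R ^ p) *
                (∫⁻ x in {x | R ≤ |x.1|}, ENNReal.ofReal (|x.1| ^ (-p)) ∂m k) *
                  ENNReal.ofReal (R ^ (-p)) := by
                rw [mul_right_comm, ← ENNReal.ofReal_mul (by positivity), ← Real.rpow_add hRpos]
                simp
            _ ≤ _ := by gcongr; exact hk.2
  -- With k gone, the inner radius shrinks and the outer one grows. The blends are dominated by e^p,
  -- bounded on the sphere and thus integrable for the finite measure m'.
  let d : ℕ → ℝ := fun j => 1 / ((j : ℝ) + 1)
  let R : ℕ → ℝ := fun j => (j : ℝ) + 1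
  have hd : Tendsto d atTop (𝓝 0) := tendsto_one_div_add_atTop_nhds_zero_nat
  have hdpos : ∀ j, 0 < d j := fun j => by positivity
  have hRlim : Tendsto R atTop atTop :=
    tendsto_atTop_add_const_right _ _ tendsto_natCast_atTop_atTop
  have hdct : Tendsto (fun j => ∫⁻ x, ENNReal.ofReal (G (R j) (d j) x) ∂m') atTop
      (𝓝 (∫⁻ x, (if x.1 = 0 then dirSeminormPow p u (x.2 : RN N)
        else diffQuot p u (cart x)) ∂m')) := by
    refine tendsto_lintegral_of_dominated_convergence
      (fun x : ℝ × SphereN N => ENNReal.ofReal (e (x.2 : RN N) ^ p))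
      (fun j => (hGc _ _ (hdpos j)).measurable.ennreal_ofReal) (fun j => ?_) ?_ ?_
    · refine Eventually.of_forall fun x => ENNReal.ofReal_le_ofReal ?_
      refine cutBlend_le hp0 (hdpos j) (he0 _) (he0 _) (truncQuot_nonneg (hdpos j) x)
        (fun _ => le_rfl) fun hx => ?_
      have hx' : 0 < |x.1| := (hdpos j).trans hx
      rw [truncQuot, max_eq_left hx.le, sub_zero, max_eq_left (incrNorm_nonneg _),
        div_le_iff₀ hx']
      exact he _ _
    · obtain ⟨C, hC⟩ := (isCompact_sphere (0 : RN N) 1).exists_bound_of_continuousOn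
        hec.continuousOn
      have h1 : ∀ x : ℝ × SphereN N, ENNReal.ofReal (e (x.2 : RN N) ^ p) ≤
          ENNReal.ofReal (C ^ p) := fun x => ENNReal.ofReal_le_ofReal
        (Real.rpow_le_rpow (he0 _) ((le_abs_self _).trans (hC _ x.2.2)) hp0)
      refine ne_top_of_le_ne_top ?_ (lintegral_mono h1)
      rw [lintegral_const]
      exact ENNReal.mul_ne_top ENNReal.ofReal_ne_top (measure_ne_top _ _)
    · refine Eventually.of_forall fun x => ?_
      have h1 := ENNReal.tendsto_ofReal (tendsto_cutBlend (p := p) (x := x)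
        (a := fun _ x => e (x.2 : RN N)) (b := fun j => truncQuot p u (d j) 0) hp0 hRlim hd hdpos
        (fun _ => tendsto_const_nhds) fun hx => tendsto_truncQuot hd tendsto_const_nhds hx)
      convert h1 using 2
      split_ifs
      · exact hepow _
      · exact diffQuot_cart hp hu.1 x
  have htail : Tendsto (fun j => K * (M * ENNReal.ofReal (R j ^ (-p)))) atTop (𝓝 0) := by
    have h1 : Tendsto (fun j => ENNReal.ofReal (R j ^ (-p))) atTop (𝓝 0) := by
      rw [← ENNReal.ofReal_zero]
      exact ENNReal.tendsto_ofReal ((tendsto_rpow_neg_atTop (by linarith)).comp hRlim)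
    have h2 := ENNReal.Tendsto.const_mul (a := K)
      (ENNReal.Tendsto.const_mul (a := (M : ℝ≥0∞)) h1 (Or.inr (by simp)))
      (Or.inr ENNReal.ofReal_ne_top)
    simpa using h2
  have hsum := hdct.add htail
  rw [add_zero] at hsum
  refine ge_of_tendsto hsum ?_
  filter_upwards [hRlim.eventually_gt_atTop R₀] with j hj
  exact hbound _ _ hj (by positivity) (hdpos j)

end Limsup

/-! ### The lower bound -/

section Liminf

variable {N : ℕ} {p : ℝ} {u : RN N → ℝ}

/-- Subadditivity gives ω(rσ) ≤ 2 ω(rσ/2), so halving the scale does not decrease the quotient. -/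
lemma monotone_diffQuot_dyadic (hp : 1 ≤ p) (hu : MemLp u (ENNReal.ofReal p) volume)
    {σ : RN N} (hσ : ‖σ‖ = 1) : Monotone fun n : ℕ => diffQuot p u ((2⁻¹ : ℝ) ^ n • σ) := by
  refine monotone_nat_of_le_succ fun n => ?_
  rw [diffQuot_eq hp hu, diffQuot_eq hp hu]
  refine ENNReal.ofReal_le_ofReal (Real.rpow_le_rpow
    (div_nonneg (incrNorm_nonneg _) (norm_nonneg _)) ?_ (by linarith))
  set r : ℝ := 2⁻¹ ^ n with hr
  have hrpos : 0 < r := by positivity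
  have hsucc : (2⁻¹ : ℝ) ^ (n + 1) = r / 2 := by rw [pow_succ]; ring
  have h := incrNorm_add_le hp hu ((r / 2) • σ) ((r / 2) • σ)
  rw [← add_smul, add_halves] at h
  rw [hsucc, norm_smul, norm_smul, hσ, mul_one, mul_one, Real.norm_of_nonneg hrpos.le,
    Real.norm_of_nonneg (half_pos hrpos).le, div_le_div_iff₀ hrpos (half_pos hrpos)]
  nlinarith

/-- The lower bound at the scale `s`. -/
lemma eventually_cutBlend_le_diffQuot (hp : 1 ≤ p) {w : ℕ → RN N → ℝ} (hw : LpConv p w u)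
    {s η d R : ℝ} (hs : 0 < s) (hη : 0 < η) (hd : 0 < d)
    (hsmall : ∀ z : RN N, ‖z‖ ≤ 2 * d → incrNorm p u z ≤ η / 2) :
    ∀ᶠ k in atTop, ∀ x : ℝ × SphereN N, 0 < x.1 →
      ENNReal.ofReal (cutBlend p R d
        (fun x => max (incrNorm p u (s • (x.2 : RN N)) - 2 * η) 0 / (s + 2 * d))
        (truncQuot p u d η) x) ≤ diffQuot p (w k) (cart x) := by
  obtain ⟨hwL, hu, hlim⟩ := hw
  have hlim' : Tendsto (fun k => 2 * (eLpNorm (fun x => w k x - u x) (ENNReal.ofReal p)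
      volume).toReal) atTop (𝓝 0) := by
    have := ((ENNReal.tendsto_toReal ENNReal.zero_ne_top).comp hlim).const_mul 2
    simpa using this
  -- For large k the increments of u and w_k differ by at most η/2, uniformly in z. Those of w_k are
  -- then at most η on the ball of radius 2d, and u at scale s exceeds w_k by at most η/2:
  -- subtracting 2η covers both errors.
  filter_upwards [hlim'.eventually (gt_mem_nhds (half_pos hη))] with k hk x hx
  have hx' : 0 < |x.1| := abs_pos.2 hx.ne'
  have hlow : ∀ z, incrNorm p u z ≤ incrNorm p (w k) z + η / 2 := fun z =>
    (incrNorm_sub_le hp hu (hwL k) z).trans (by linarith)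
  have hup : ∀ z, incrNorm p (w k) z ≤ incrNorm p u z + η / 2 := fun z => by
    refine (incrNorm_sub_le hp (hwL k) hu z).trans ?_
    have : eLpNorm (fun x => u x - w k x) (ENNReal.ofReal p) volume =
        eLpNorm (fun x => w k x - u x) (ENNReal.ofReal p) volume := by
      rw [← eLpNorm_neg]
      congr 1; ext y; simp
    rw [this]; linarith
  have hsmall' : ∀ z : RN N, ‖z‖ ≤ 2 * d → incrNorm p (w k) z ≤ η := fun z hz => by
    linarith [hup z, hsmall z hz]
  rw [diffQuot_cart hp (hwL k)]
  refine ENNReal.ofReal_le_ofReal ?_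
  have hq0 : 0 ≤ incrNorm p (w k) (cart x) / |x.1| := div_nonneg (incrNorm_nonneg _) hx'.le
  refine cutBlend_le (by linarith) hd hq0 (div_nonneg (le_max_right _ _) (by linarith))
    (truncQuot_nonneg hd x) (fun h => ?_) fun h => ?_
  · rcases le_total (incrNorm p u (s • (x.2 : RN N)) - 2 * η) 0 with h1 | h1
    · rw [max_eq_right h1, zero_div]; exact hq0
    · rw [max_eq_left h1]
      have h2 := incrNorm_div_le_of_small hp (hwL k) hs hx.ne' h.le x.2 (norm_sphereN _) hsmall'
      refine le_trans (div_le_div_of_nonneg_right ?_ (by linarith)) h2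
      linarith [hlow (s • (x.2 : RN N))]
  · rw [truncQuot, max_eq_left h.le]
    refine div_le_div_of_nonneg_right (max_le ?_ (incrNorm_nonneg _)) hx'.le
    linarith [hlow (cart x)]

open Classical in
-- For fixed tolerance η_j, a continuous compactly supported minorant of the quotients of w_k is
-- integrated and k is sent to infinity. Fatou's lemma then removes the tolerance and the cutoffs.
lemma PolarConv.lintegral_le_liminf_of_scale {m : ℕ → Measure (ℝ × SphereN N)}
    {m' : Measure (ℝ × SphereN N)} (h : PolarConv m m') (hp : 1 ≤ p)
    (h0 : ∀ k, ∀ᵐ x ∂m k, 0 < x.1) {w : ℕ → RN N → ℝ} (hw : LpConv p w u) {s : ℝ} (hs : 0 < s) :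
    ∫⁻ x, (if x.1 = 0 then diffQuot p u (s • (x.2 : RN N)) else diffQuot p u (cart x)) ∂m' ≤
      liminf (fun k => ∫⁻ x, diffQuot p (w k) (cart x) ∂m k) atTop := by
  have hu := hw.2.1
  let η : ℕ → ℝ := fun j => 1 / ((j : ℝ) + 1)
  let R : ℕ → ℝ := fun j => (j : ℝ) + 1
  have hη : Tendsto η atTop (𝓝 0) := tendsto_one_div_add_atTop_nhds_zero_nat
  have hηpos : ∀ j, 0 < η j := fun j => by positivity
  have hRlim : Tendsto R atTop atTop :=
    tendsto_atTop_add_const_right _ _ tendsto_natCast_atTop_atTop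
  have hd : ∀ j, ∃ d : ℝ, 0 < d ∧ d ≤ η j ∧
      ∀ z : RN N, ‖z‖ ≤ 2 * d → incrNorm p u z ≤ η j / 2 := by
    intro j
    obtain ⟨ε, hε, hball⟩ := Metric.eventually_nhds_iff_ball.1
      ((tendsto_incrNorm_zero hp hu).eventually (gt_mem_nhds (half_pos (hηpos j))))
    refine ⟨min (ε / 4) (η j), lt_min (by linarith) (hηpos j), min_le_right _ _, fun z hz => ?_⟩
    refine (hball z ?_).le
    rw [mem_ball_zero_iff]
    linarith [min_le_left (ε / 4) (η j)]
  choose d hdpos hdη hdsmall using hd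
  have hdlim : Tendsto d atTop (𝓝 0) :=
    squeeze_zero (fun j => (hdpos j).le) hdη hη
  let a : ℕ → ℝ × SphereN N → ℝ := fun j x =>
    max (incrNorm p u (s • (x.2 : RN N)) - 2 * η j) 0 / (s + 2 * d j)
  let G : ℕ → ℝ × SphereN N → ℝ := fun j =>
    cutBlend p (R j) (d j) (a j) (truncQuot p u (d j) (η j))
  have ha : ∀ j, Continuous (a j) := fun j => by
    have h1 : Continuous fun x : ℝ × SphereN N => incrNorm p u (s • (x.2 : RN N)) :=
      (continuous_incrNorm hp hu).comp (by fun_prop)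
    exact ((h1.sub continuous_const).max continuous_const).div_const _
  have hGc : ∀ j, Continuous (G j) := fun j =>
    continuous_cutBlend hp _ _ (ha j) (continuous_truncQuot hp hu (hdpos j) _)
  have hG0 : ∀ j x, 0 ≤ G j x := fun j =>
    cutBlend_nonneg (fun x => div_nonneg (le_max_right _ _) (by linarith [hdpos j]))
      (truncQuot_nonneg (hdpos j))
  have hle : ∀ j, ∫⁻ x, ENNReal.ofReal (G j x) ∂m' ≤
      liminf (fun k => ∫⁻ x, diffQuot p (w k) (cart x) ∂m k) atTop := by
    intro j
    rw [← (h (G j) (hGc j) (hasCompactSupport_cutBlend (by positivity) _ _ _) (hG0 j)).liminf_eq]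
    refine liminf_le_liminf ?_ (by isBoundedDefault) (by isBoundedDefault)
    filter_upwards [eventually_cutBlend_le_diffQuot (R := R j) hp hw hs (hηpos j) (hdpos j)
      (hdsmall j)] with k hk
    refine lintegral_mono_ae ?_
    filter_upwards [h0 k] with x hx using hk x hx
  calc _ = ∫⁻ x, liminf (fun j => ENNReal.ofReal (G j x)) atTop ∂m' := by
        refine lintegral_congr fun x => ?_
        have h1 := ENNReal.tendsto_ofReal (tendsto_cutBlend (p := p) (x := x) (a := a)
          (b := fun j => truncQuot p u (d j) (η j))
          (α := incrNorm p u (s • (x.2 : RN N)) / s) (by linarith) hRlim hdlim hdpos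
          (fun _ => ?_) fun hx => tendsto_truncQuot hdlim hη hx)
        · rw [h1.liminf_eq]
          split_ifs
          · rw [diffQuot_eq hp hu, norm_smul, norm_sphereN, mul_one, Real.norm_of_nonneg hs.le]
          · exact diffQuot_cart hp hu x
        · have h2 : Tendsto (fun j => max (incrNorm p u (s • (x.2 : RN N)) - 2 * η j) 0) atTop
              (𝓝 (incrNorm p u (s • (x.2 : RN N)))) := by
            have := ((tendsto_const_nhds (x := incrNorm p u (s • (x.2 : RN N)))).sub
              (hη.const_mul 2)).max (tendsto_const_nhds (x := (0 : ℝ)))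
            rwa [mul_zero, sub_zero, max_eq_left (incrNorm_nonneg _)] at this
          have h3 : Tendsto (fun j => s + 2 * d j) atTop (𝓝 s) := by
            simpa using (hdlim.const_mul 2).const_add s
          exact h2.div h3 hs.ne'
    _ ≤ liminf (fun j => ∫⁻ x, ENNReal.ofReal (G j x) ∂m') atTop :=
        lintegral_liminf_le fun j => (hGc j).measurable.ennreal_ofReal
    _ ≤ _ := by
        refine (liminf_le_liminf (Eventually.of_forall hle)).trans ?_
        rw [liminf_const]

open Classical in
-- Monotone convergence over dyadic scales. The absence of any regularity assumption on u lets this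
-- serve both the Γ-liminf inequality and coercivity.
theorem PolarConv.lintegral_iSup_le_liminf {m : ℕ → Measure (ℝ × SphereN N)}
    {m' : Measure (ℝ × SphereN N)} (h : PolarConv m m') (hp : 1 ≤ p)
    (h0 : ∀ k, ∀ᵐ x ∂m k, 0 < x.1) {w : ℕ → RN N → ℝ} (hw : LpConv p w u) :
    ∫⁻ x, (if x.1 = 0 then ⨆ n : ℕ, diffQuot p u ((2⁻¹ : ℝ) ^ n • (x.2 : RN N))
        else diffQuot p u (cart x)) ∂m' ≤
      liminf (fun k => ∫⁻ x, diffQuot p (w k) (cart x) ∂m k) atTop := by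
  have hm := measurable_diffQuot hp hw.2.1
  calc _ = ∫⁻ x, (⨆ n : ℕ, if x.1 = 0 then diffQuot p u ((2⁻¹ : ℝ) ^ n • (x.2 : RN N))
        else diffQuot p u (cart x)) ∂m' := by
        refine lintegral_congr fun x => ?_
        split_ifs
        · rfl
        · rw [iSup_const]
    _ = ⨆ n : ℕ, ∫⁻ x, (if x.1 = 0 then diffQuot p u ((2⁻¹ : ℝ) ^ n • (x.2 : RN N))
        else diffQuot p u (cart x)) ∂m' := by
        refine lintegral_iSup (fun n => ?_) fun a b hab x => ?_
        · refine Measurable.ite measurableSet_fst_eq_zero (hm.comp ?_)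
            (hm.comp continuous_cart.measurable)
          exact (by fun_prop : Continuous fun x : ℝ × SphereN N =>
            (2⁻¹ : ℝ) ^ n • (x.2 : RN N)).measurable
        · simp only
          split_ifs
          · exact monotone_diffQuot_dyadic hp hw.2.1 (norm_sphereN _) hab
          · exact le_rfl
    _ ≤ _ := iSup_le fun n => h.lintegral_le_liminf_of_scale hp h0 hw (by positivity)

lemma incrNorm_le_of_iSup_diffQuot (hp : 1 ≤ p) (hu : MemLp u (ENNReal.ofReal p) volume)
    {σ : RN N} (hσ : ‖σ‖ = 1) (h : ⨆ n : ℕ, diffQuot p u ((2⁻¹ : ℝ) ^ n • σ) ≠ ∞) (n : ℕ) :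
    incrNorm p u ((2⁻¹ : ℝ) ^ n • σ) ≤
      (⨆ n : ℕ, diffQuot p u ((2⁻¹ : ℝ) ^ n • σ)).toReal ^ p⁻¹ * (2⁻¹ : ℝ) ^ n := by
  have hp0 : 0 < p := by linarith
  have hle := ENNReal.toReal_mono h
    (le_iSup (fun n : ℕ => diffQuot p u ((2⁻¹ : ℝ) ^ n • σ)) n)
  have hr : (0 : ℝ) < 2⁻¹ ^ n := by positivity
  have hq : 0 ≤ incrNorm p u ((2⁻¹ : ℝ) ^ n • σ) / 2⁻¹ ^ n := div_nonneg (incrNorm_nonneg _) hr.le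
  rw [diffQuot_eq hp hu, norm_smul, hσ, mul_one, Real.norm_of_nonneg hr.le,
    ENNReal.toReal_ofReal (Real.rpow_nonneg hq p)] at hle
  rw [← div_le_iff₀ hr]
  have h1 := Real.rpow_le_rpow (Real.rpow_nonneg hq p) hle (inv_nonneg.2 hp0.le)
  rwa [Real.rpow_rpow_inv hq hp0.ne'] at h1

/-- A finite supremum bounds all dyadic increments, and the directional seminorm is the least
constant compatible with such bounds. -/
lemma dirSeminormPow_le_iSup (hp : 1 ≤ p) (hu : u ∈ SobBV N p) {σ : RN N} (hσ : ‖σ‖ = 1) :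
    dirSeminormPow p u σ ≤ ⨆ n : ℕ, diffQuot p u ((2⁻¹ : ℝ) ^ n • σ) := by
  have hp0 : 0 < p := by linarith
  obtain ⟨e, -, he0, hepow, -, hel⟩ := exists_dirSeminorm hp hu
  set S := ⨆ n : ℕ, diffQuot p u ((2⁻¹ : ℝ) ^ n • σ) with hS
  rcases eq_or_ne S ∞ with htop | htop
  · rw [htop]; exact le_top
  have h := incrNorm_le_of_iSup_diffQuot hp hu.1 hσ htop
  have h1 := hel σ (S.toReal ^ p⁻¹) (by positivity) h
  rw [hepow, ← ENNReal.ofReal_toReal htop]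
  refine ENNReal.ofReal_le_ofReal ?_
  calc e σ ^ p ≤ (S.toReal ^ p⁻¹) ^ p := Real.rpow_le_rpow (he0 σ) h1 hp0.le
    _ = S.toReal := Real.rpow_inv_rpow ENNReal.toReal_nonneg hp0.ne'

end Liminf

/-! ### Maximal rank -/

section MaximalRank

variable {N : ℕ} {p : ℝ}

/-- A continuous function equal to `1` on the cone and decreasing to its indicator. -/
def coneCutoff (τ : ℝ) (v : RN N) (n : ℕ) (σ : RN N) : ℝ :=
  max 0 (min 1 (1 + n * (inner ℝ σ v - (1 - τ))))

lemma smul_inv_norm_mem_coneN {τ : ℝ} {v z : RN N} (hz : z ∈ coneN τ v) (h0 : z ≠ 0) :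
    1 - τ ≤ inner ℝ (‖z‖⁻¹ • z) v := by
  rw [real_inner_smul_left, ← div_eq_inv_mul, le_div_iff₀ (norm_pos_iff.2 h0)]
  exact hz

/-- Continuous cutoffs equal to 1 on the ball of radius d_n within the cone have m'-integral at
least c. As n grows they converge to the indicator of the directions of the closed cone on r = 0, so
no mass c is lost by dominated convergence. -/
lemma PolarConv.measure_cone_pos {J : Set ℝ} {ρ : ℝ → RN N → ℝ} {t : ℕ → ℝ} {σ₀ : SphereN N}
    {m' : Measure (ℝ × SphereN N)} [IsFiniteMeasure m'] (hN : 1 ≤ N)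
    (h : PolarConv (fun k => polarKernel σ₀ (ρ (t k))) m') (ht : Tendsto t atTop (𝓝[J] 0))
    {τ : ℝ} {v : RN N} {c : ℝ≥0∞} (hc : 0 < c)
    (hmass : ∀ δ : ℝ, 0 < δ →
      c < liminf (fun t => ∫⁻ z in Metric.ball 0 δ ∩ coneN τ v, ENNReal.ofReal (ρ t z)) (𝓝[J] 0)) :
    0 < m' {x | x.1 = 0 ∧ (x.2 : RN N) ∈ coneN τ v} := by
  have hne : Nonempty (Fin N) := ⟨⟨0, hN⟩⟩
  let d : ℕ → ℝ := fun n => 1 / ((n : ℝ) + 1)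
  have hd : Tendsto d atTop (𝓝 0) := tendsto_one_div_add_atTop_nhds_zero_nat
  have hdpos : ∀ n, 0 < d n := fun n => by positivity
  have hcone : MeasurableSet (coneN τ v) := measurableSet_le (by fun_prop) (by fun_prop)
  let f : ℕ → ℝ × SphereN N → ℝ := fun n x => plateau (d n) x.1 * coneCutoff τ v n (x.2 : RN N)
  have hf : ∀ n, Continuous (f n) := fun n => by
    refine ((continuous_plateau _).comp continuous_fst).mul ?_
    unfold coneCutoff; fun_prop
  have hf0 : ∀ n x, 0 ≤ f n x := fun n x => mul_nonneg (plateau_nonneg _ _) (le_max_left _ _)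
  have hf1 : ∀ n x, f n x ≤ 1 := fun n x => mul_le_one₀ (plateau_le_one _ _) (le_max_left _ _)
    (max_le zero_le_one (min_le_left _ _))
  have hge : ∀ n, c ≤ ∫⁻ x, ENNReal.ofReal (f n x) ∂m' := by
    intro n
    refine ge_of_tendsto (h (f n) (hf n) (hasCompactSupport_of_abs_fst (2 * d n) fun x hx => by
      simp only [f]; rw [plateau_eq_zero (hdpos n) hx, zero_mul]) (hf0 n)) ?_
    filter_upwards [ht.eventually (eventually_lt_of_lt_liminf (hmass (d n) (hdpos n)))] with k hk
    refine hk.le.trans ?_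
    have hA : MeasurableSet (Metric.ball (0 : RN N) (d n) ∩ coneN τ v) :=
      Metric.isOpen_ball.measurableSet.inter hcone
    rw [polarKernel, lintegral_map (hf n).measurable.ennreal_ofReal measurable_polar,
      ← withDensity_apply _ hA, ← lintegral_indicator_one hA]
    refine lintegral_mono_ae ((withDensity_absolutelyContinuous volume _).ae_le ?_)
    have hne0 : ∀ᵐ z ∂(volume : Measure (RN N)), z ≠ 0 := by
      rw [ae_iff]; simp
    filter_upwards [hne0] with z hz
    by_cases hzA : z ∈ Metric.ball (0 : RN N) (d n) ∩ coneN τ v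
    · have h1 : plateau (d n) ‖z‖ = 1 := plateau_eq_one (hdpos n) (by
        rw [abs_norm]; exact (mem_ball_zero_iff.1 hzA.1).le)
      have h2 := smul_inv_norm_mem_coneN hzA.2 hz
      have h3 : (0 : ℝ) ≤ n * (inner ℝ (‖z‖⁻¹ • z) v - (1 - τ)) :=
        mul_nonneg n.cast_nonneg (by linarith)
      have h4 : f n (polar σ₀ z) = 1 := by
        simp only [f, polar, unitVec, dif_neg hz, coneCutoff]
        rw [h1, one_mul, min_eq_left (by linarith), max_eq_right zero_le_one]
      rw [h4]
      simp [indicator_of_mem hzA]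
    · rw [indicator_of_notMem hzA]; exact zero_le
  set A : Set (ℝ × SphereN N) := {x | x.1 = 0 ∧ (x.2 : RN N) ∈ coneN τ v} with hA
  have hAm : MeasurableSet A := measurableSet_fst_eq_zero.inter
    (measurable_subtype_coe.comp measurable_snd hcone)
  have hlim : Tendsto (fun n => ∫⁻ x, ENNReal.ofReal (f n x) ∂m') atTop
      (𝓝 (∫⁻ x, A.indicator 1 x ∂m')) := by
    refine tendsto_lintegral_of_dominated_convergence (fun _ => 1)
      (fun n => (hf n).measurable.ennreal_ofReal)
      (fun n => Eventually.of_forall fun x => ENNReal.ofReal_le_one.2 (hf1 n x))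
      (by simp) (Eventually.of_forall fun x => ?_)
    have hmem : (x.2 : RN N) ∈ coneN τ v ↔ 1 - τ ≤ inner ℝ (x.2 : RN N) v := by
      rw [coneN, mem_ofPred_eq, norm_sphereN, mul_one]
    by_cases hx : x.1 = 0
    · have h1 : ∀ n, plateau (d n) x.1 = 1 := fun n =>
        plateau_eq_one (hdpos n) (by rw [hx, abs_zero]; exact (hdpos n).le)
      by_cases hxc : (x.2 : RN N) ∈ coneN τ v
      · rw [indicator_of_mem (show x ∈ A from ⟨hx, hxc⟩)]
        refine tendsto_const_nhds.congr fun n => ?_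
        have h3 : (0 : ℝ) ≤ n * (inner ℝ (x.2 : RN N) v - (1 - τ)) :=
          mul_nonneg n.cast_nonneg (by linarith [hmem.1 hxc])
        simp only [f, coneCutoff]
        rw [h1, one_mul, min_eq_left (by linarith), max_eq_right zero_le_one]
        simp
      · rw [indicator_of_notMem fun hh => hxc hh.2]
        refine tendsto_const_nhds.congr' ?_
        -- Strictly outside the cone the affine expression in the cutoff tends to -∞, so the cutoff
        -- eventually vanishes.
        have hg : inner ℝ (x.2 : RN N) v - (1 - τ) < 0 := by
          have := mt hmem.2 hxc; linarith
        have ht' := tendsto_natCast_atTop_atTop.atTop_mul_const_of_neg hg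
        filter_upwards [ht'.eventually_le_atBot (-1)] with n hn
        simp only [f, coneCutoff]
        rw [max_eq_left ((min_le_right _ _).trans (by linarith)), mul_zero, ENNReal.ofReal_zero]
    · rw [indicator_of_notMem fun hh => hx hh.1]
      refine tendsto_const_nhds.congr' ?_
      filter_upwards [hd.eventually (gt_mem_nhds (half_pos (abs_pos.2 hx)))] with n hn
      simp only [f]
      rw [plateau_eq_zero (hdpos n) (by linarith), zero_mul, ENNReal.ofReal_zero]
  rw [lintegral_indicator_one hAm] at hlim
  exact hc.trans_le (ge_of_tendsto' hlim hge)

open Classical in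
-- The supremum is finite almost everywhere, so each set of directions of positive measure contains
-- a good one; the chosen N directions are independent by hypothesis.
lemma mem_sobBV_of_lintegral_ne_top (hp : 1 ≤ p) {u : RN N → ℝ}
    (hu : MemLp u (ENNReal.ofReal p) volume) {m' : Measure (ℝ × SphereN N)}
    {C : Fin N → Set (RN N)}
    (hind : ∀ w : Fin N → RN N, (∀ i, w i ∈ C i ∧ w i ≠ 0) → LinearIndependent ℝ w)
    (hpos : ∀ i, 0 < m' {x | x.1 = 0 ∧ (x.2 : RN N) ∈ C i})
    (hfin : ∫⁻ x, (if x.1 = 0 then ⨆ n : ℕ, diffQuot p u ((2⁻¹ : ℝ) ^ n • (x.2 : RN N))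
        else diffQuot p u (cart x)) ∂m' ≠ ∞) :
    u ∈ SobBV N p := by
  have hm := measurable_diffQuot hp hu
  have hmeas : Measurable fun x : ℝ × SphereN N =>
      if x.1 = 0 then ⨆ n : ℕ, diffQuot p u ((2⁻¹ : ℝ) ^ n • (x.2 : RN N))
        else diffQuot p u (cart x) := by
    refine Measurable.ite measurableSet_fst_eq_zero (Measurable.iSup fun n => hm.comp ?_)
      (hm.comp continuous_cart.measurable)
    exact (by fun_prop : Continuous fun x : ℝ × SphereN N =>
      (2⁻¹ : ℝ) ^ n • (x.2 : RN N)).measurable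
  have hae := ae_lt_top hmeas hfin
  have hex : ∀ i, ∃ σ : SphereN N, (σ : RN N) ∈ C i ∧
      ⨆ n : ℕ, diffQuot p u ((2⁻¹ : ℝ) ^ n • (σ : RN N)) ≠ ∞ := by
    intro i
    obtain ⟨x, ⟨hx0, hxC⟩, hx⟩ := Measure.exists_mem_of_measure_ne_zero_of_ae (hpos i).ne'
      (ae_restrict_of_ae hae)
    rw [if_pos hx0] at hx
    exact ⟨x.2, hxC, hx.ne⟩
  choose σ hσC hσ using hex
  exact mem_sobBV_of_incrNorm_le hp hu (w := fun i => (σ i : RN N))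
    (hind _ fun i => ⟨hσC i, norm_ne_zero_iff.1 (by rw [norm_sphereN]; exact one_ne_zero)⟩)
    (fun i => Real.rpow_nonneg ENNReal.toReal_nonneg _)
    fun i n => incrNorm_le_of_iSup_diffQuot hp hu (norm_sphereN _) (hσ i) n

end MaximalRank

end

/-! ### Assembly of the main theorem -/

theorem mainTheorem2 (N : ℕ) (hN : 1 ≤ N) (p : ℝ) (hp : 1 ≤ p)
    (ρ : ℝ → RN N → ℝ)
    (hρ_int : ∀ t ∈ Ioo (0 : ℝ) 1, LocallyIntegrable (ρ t) volume)
    (hρ_nonneg : ∀ t ∈ Ioo (0 : ℝ) 1, ∀ᵐ z ∂(volume : Measure (RN N)), 0 ≤ ρ t z)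
    (J : Set ℝ) (hJ : J ⊆ Ioo (0 : ℝ) 1) (hJ0 : (0 : ℝ) ∈ closure J)
    (hbound : KernelBound1 p J ρ ∨ KernelBound2 p J ρ ∨ KernelBound3 p J ρ ∨
      KernelBound4 p J ρ ∨ KernelBound5 p J ρ) :
    ∃ (t : ℕ → ℝ) (μ : Measure (SphereN N)) (ν : Measure (RN N)),
      (∀ k, t k ∈ J) ∧ Tendsto t atTop (𝓝 0) ∧
      IsFiniteMeasure μ ∧ IsFiniteMeasure ν ∧
      WeakStarLoc (fun k => kernelMeasure (ρ (t k))) ν ∧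
      (∀ u ∈ SobBV N p,
        limsup (fun k => bbmEnergy p (ρ (t k)) u) atTop ≤ limitEnergy p μ ν u) ∧
      GammaLiminfOn p (SobBV N p) (fun k => bbmEnergy p (ρ (t k))) (limitEnergy p μ ν) ∧
      PointwiseConvOn (SobBV N p) (fun k => bbmEnergy p (ρ (t k))) (limitEnergy p μ ν) ∧
      GammaConvOn p (SobBV N p) (fun k => bbmEnergy p (ρ (t k))) (limitEnergy p μ ν) ∧
      (HasMaximalRank J ρ →
        CoerciveOn p (SobBV N p) (fun k => bbmEnergy p (ρ (t k)))) := by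
  classical
  have hne : Nonempty (Fin N) := ⟨⟨0, hN⟩⟩
  obtain ⟨σ, hσ⟩ : (Metric.sphere (0 : RN N) 1).Nonempty :=
    NormedSpace.sphere_nonempty.2 zero_le_one
  have hloc : ∀ t ∈ J, LocallyIntegrable (ρ t) volume := fun t ht => hρ_int t (hJ ht)
  have hev : EventualKernelBound p J ρ := by
    rcases hbound with h | h | h | h | h
    · exact h.eventualKernelBound hp
    · exact h.kernelBound3.eventualKernelBound
    · exact h.eventualKernelBound
    · exact h.kernelBound3.eventualKernelBound
    · exact h.eventualKernelBound hN hp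
  obtain ⟨s, M, R₀, hsJ, hs, hM, hR₀, hb⟩ := hev.exists_seq hJ0 hloc ⟨σ, hσ⟩
  obtain ⟨φ, m', hφ, hm', hconv⟩ :=
    hb.exists_subseq_tendsto hp hR₀ hM (fun k => ae_polarKernel_pos hN) ⟨σ, hσ⟩
  have hfin : IsFiniteMeasure m' := ⟨hm'.trans_lt ENNReal.coe_lt_top⟩
  let t : ℕ → ℝ := s ∘ φ
  have ht : Tendsto t atTop (𝓝[J] 0) := hs.comp hφ.tendsto_atTop
  have htJ : ∀ k, t k ∈ J := fun k => hsJ _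
  have htloc : ∀ k, LocallyIntegrable (ρ (t k)) volume := fun k => hloc _ (htJ k)
  let m : ℕ → Measure (ℝ × SphereN N) := fun k => polarKernel ⟨σ, hσ⟩ (ρ (t k))
  have hPC : PolarConv m m' := hconv
  have hbt : PolarBound p M R₀ m := fun R hR => hφ.tendsto_atTop.eventually (hb R hR)
  have hpos : ∀ k, ∀ᵐ x ∂m k, 0 < x.1 := fun k => ae_polarKernel_pos hN
  have hE : ∀ k u, MemLp u (ENNReal.ofReal p) volume →
      bbmEnergy p (ρ (t k)) u = ∫⁻ x, diffQuot p u (cart x) ∂m k := fun k u hu =>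
    bbmEnergy_eq_lintegral_polarKernel hp (htloc k) hu
  have hsup : ∀ u ∈ SobBV N p, limsup (fun k => bbmEnergy p (ρ (t k)) u) atTop ≤
      limitEnergy p (sphericalPart m') (m'.map cart) u := by
    intro u hu
    simp_rw [fun k => hE k u hu.1]
    rw [limitEnergy_eq_lintegral hp hu]
    exact hPC.limsup_le hp hbt hpos hu
  -- Stated for every L^p limit u, in S^p or not, since coercivity will use it before regularity is
  -- known.
  have hlow : ∀ (w : ℕ → RN N → ℝ) (u : RN N → ℝ), LpConv p w u →
      ∫⁻ x, (if x.1 = 0 then ⨆ n : ℕ, diffQuot p u ((2⁻¹ : ℝ) ^ n • (x.2 : RN N))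
        else diffQuot p u (cart x)) ∂m' ≤
      liminf (fun k => bbmEnergy p (ρ (t k)) (w k)) atTop := by
    intro w u hw
    simp_rw [fun k => hE k (w k) (hw.1 k)]
    exact hPC.lintegral_iSup_le_liminf hp hpos hw
  have hinf : GammaLiminfOn p (SobBV N p) (fun k => bbmEnergy p (ρ (t k)))
      (limitEnergy p (sphericalPart m') (m'.map cart)) := by
    intro w u hu hw
    refine le_trans ?_ (hlow w u hw)
    rw [limitEnergy_eq_lintegral hp hu]
    refine lintegral_mono fun x => ?_
    simp only
    split_ifs
    · exact dirSeminormPow_le_iSup hp hu (norm_sphereN _)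
    · exact le_rfl
  -- Constant sequences are recovery sequences, and they turn the Γ-liminf inequality into the lower
  -- half of pointwise convergence.
  have hconst : ∀ u ∈ SobBV N p, LpConv p (fun _ => u) u := fun u hu =>
    ⟨fun _ => hu.1, hu.1, by simp⟩
  refine ⟨t, sphericalPart m', m'.map cart, htJ, ht.mono_right nhdsWithin_le_nhds, ?_, ?_,
    hPC.weakStarLoc htloc, hsup, hinf, ?_, ⟨hinf, ?_⟩, ?_⟩
  · unfold sphericalPart; infer_instance
  · infer_instance
  · exact fun u hu => tendsto_of_le_liminf_of_limsup_le (hinf _ u hu (hconst u hu)) (hsup u hu)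
  · exact fun u hu => ⟨fun _ => u, fun _ => hu, hconst u hu, hsup u hu⟩
  · rintro ⟨τ, -, v, -, -, -, hind, hmass⟩ w u hw hlt
    -- A level strictly below the infimum gives a strict lower bound on the mass for every δ and
    -- every cone simultaneously.
    obtain ⟨c, hc0, hc⟩ := exists_between hmass
    refine mem_sobBV_of_lintegral_ne_top hp hw.2.1 hind (fun i => ?_)
      ((hlow w u hw).trans_lt hlt).ne
    refine hPC.measure_cone_pos hN ht hc0 fun δ hδ => hc.trans_le ?_
    exact (iInf₂_le δ hδ).trans (iInf_le _ i)
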